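/- Over the base theory $\mathbf{RCA}_0$ of second order arithmetic, the following are equivalent (equivalently, by G\"odel's completeness theorem: every model of $\mathbf{RCA}_0$, possibly with non-standard numbers, satisfies (i) if and only if it satisfies (ii)): (i) arithmetical comprehension, i.e. the scheme stating that $\{n\in\mathbb N\mid\varphi(n)\}$ exists for every formula $\varphi$ without set quantifiers (number and set parameters are allowed); (ii) the extended Goodstein theorem for the binary representation: for any Goodstein system $(b,c)$ and any $m<2^{b(0)}$ there is an $i\in\mathbb N$ with $G^2_{b,c,m}(i)=0$. Here a Goodstein system is a pair $(b,c)$ of a non-decreasing function $b:\mathbb N\to\mathbb N$ with $b(0)>0$ and a family $c=\langle c_i\rangle_{i\in\mathbb N}$ of strictly increasing functions $c_i:\{0,\dots,b(i)-1\}\to\{0,\dots,b(i+1)-1\}$ with the following property: for any function $d:\mathbb N\to\mathbb N$ with $d(i)<b(i)$ for all $i\in\mathbb N$ and any infinite $Y\subseteq\mathbb N$, there are $i,j\in Y$ with $i<j$ and $c_{ij}(d(i))\le d(j)$, where $c_{ij}:=c_{j-1}\circ\dots\circ c_i$. For a Goodstein system $(b,c)$ and $m<2^{b(0)}$, the Goodstein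 sequence $G^2_{b,c,m}(0),G^2_{b,c,m}(1),\dots$ is given by $G^2_{b,c,m}(0)=m$ and \[ G^2_{b,c,m}(i+1)=\begin{cases}0 & \text{if } G^2_{b,c,m}(i)=0,\\ 2^{c_i(n_0)}+\dots+2^{c_i(n_k)}-1 & \text{if } G^2_{b,c,m}(i)=2^{n_0}+\dots+2^{n_k}\text{ with } b(i)>n_0>\dots>n_k.\end{cases} \] -/

import Mathlib

universe u

/-! ## The language of second order arithmetic -/

namespace SecondOrderArithmetic

/-- Numerical terms; the number variables are indexed by `ℕ`. -/
inductive Term : Type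
  | var (x : ℕ) : Term
  | zero : Term
  | one : Term
  | add (s t : Term) : Term
  | mul (s t : Term) : Term

/-- The number variable `x` occurs in a term. -/
def Term.Occurs (x : ℕ) : Term → Prop
  | .var y => x = y
  | .zero => False
  | .one => False
  | .add s t => s.Occurs x ∨ t.Occurs x
  | .mul s t => s.Occurs x ∨ t.Occurs x

/-- Formulas of second order arithmetic. Number variables and set variables are indexed by `ℕ`
(separately). -/
inductive Formula : Type
  | eq (s t : Term) : Formula
  | lt (s t : Term) : Formula
  | mem (t : Term) (X : ℕ) : Formula
  | not (φ : Formula) : Formula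
  | and (φ ψ : Formula) : Formula
  | or (φ ψ : Formula) : Formula
  | imp (φ ψ : Formula) : Formula
  | all (x : ℕ) (φ : Formula) : Formula
  | ex (x : ℕ) (φ : Formula) : Formula
  | allSet (X : ℕ) (φ : Formula) : Formula
  | exSet (X : ℕ) (φ : Formula) : Formula

/-- Bounded quantifier formulas: all quantifiers are of the form `∀ x < t` or `∃ x < t`, for a
term `t` in which `x` does not occur. -/
inductive Formula.IsBounded : Formula → Prop
  | eq (s t : Term) : IsBounded (.eq s t)
  | lt (s t : Term) : IsBounded (.lt s t)
  | mem (t : Term) (X : ℕ) : IsBounded (.mem t X)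
  | not {φ : Formula} : IsBounded φ → IsBounded (.not φ)
  | and {φ ψ : Formula} : IsBounded φ → IsBounded ψ → IsBounded (.and φ ψ)
  | or {φ ψ : Formula} : IsBounded φ → IsBounded ψ → IsBounded (.or φ ψ)
  | imp {φ ψ : Formula} : IsBounded φ → IsBounded ψ → IsBounded (.imp φ ψ)
  | all {φ : Formula} (x : ℕ) (t : Term) : ¬ t.Occurs x → IsBounded φ →
      IsBounded (.all x (.imp (.lt (.var x) t) φ))
  | ex {φ : Formula} (x : ℕ) (t : Term) : ¬ t.Occurs x → IsBounded φ →
      IsBounded (.ex x (.and (.lt (.var x) t) φ))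

/-- `Σ⁰₁` formulas: `∃ x θ` with `θ` a bounded quantifier formula. -/
def Formula.IsSigma (φ : Formula) : Prop :=
  ∃ (x : ℕ) (θ : Formula), θ.IsBounded ∧ φ = .ex x θ

/-- `Π⁰₁` formulas: `∀ x θ` with `θ` a bounded quantifier formula. -/
def Formula.IsPi (φ : Formula) : Prop :=
  ∃ (x : ℕ) (θ : Formula), θ.IsBounded ∧ φ = .all x θ

/-- Arithmetical formulas: no set quantifiers (free set variables are allowed). -/
def Formula.IsArithmetical : Formula → Prop
  | .eq _ _ => True
  | .lt _ _ => True
  | .mem _ _ => True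
  | .not φ => φ.IsArithmetical
  | .and φ ψ => φ.IsArithmetical ∧ ψ.IsArithmetical
  | .or φ ψ => φ.IsArithmetical ∧ ψ.IsArithmetical
  | .imp φ ψ => φ.IsArithmetical ∧ ψ.IsArithmetical
  | .all _ φ => φ.IsArithmetical
  | .ex _ φ => φ.IsArithmetical
  | .allSet _ _ => False
  | .exSet _ _ => False

end SecondOrderArithmetic

open SecondOrderArithmetic

/-! ## Structures and satisfaction -/

/-- A structure for the language of second order arithmetic (general, i.e. Henkin, semantics):
number variables range over `Num` and set variables over the collection `sets` of subsets of
`Num`. Equality is interpreted as equality. -/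
structure SecondOrderStructure : Type (u + 1) where
  Num : Type u
  [instZero : Zero Num]
  [instOne : One Num]
  [instAdd : Add Num]
  [instMul : Mul Num]
  [instLT : LT Num]
  sets : Set (Set Num)
  sets_nonempty : sets.Nonempty

attribute [instance] SecondOrderStructure.instZero SecondOrderStructure.instOne
  SecondOrderStructure.instAdd SecondOrderStructure.instMul SecondOrderStructure.instLT

namespace SecondOrderStructure

/-- The value of a term under an assignment of the number variables. -/
def value (M : SecondOrderStructure.{u}) (e : ℕ → M.Num) : Term → M.Num
  | .var x => e x
  | .zero => 0
  | .one => 1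
  | .add s t => M.value e s + M.value e t
  | .mul s t => M.value e s * M.value e t

/-- Satisfaction of a formula under assignments `e` of the number variables and `E` of the set
variables. -/
def Sat (M : SecondOrderStructure.{u}) : (ℕ → M.Num) → (ℕ → M.sets) → Formula → Prop
  | e, _, .eq s t => M.value e s = M.value e t
  | e, _, .lt s t => M.value e s < M.value e t
  | e, E, .mem t X => M.value e t ∈ (E X : Set M.Num)
  | e, E, .not φ => ¬ M.Sat e E φ
  | e, E, .and φ ψ => M.Sat e E φ ∧ M.Sat e E ψ
  | e, E, .or φ ψ => M.Sat e E φ ∨ M.Sat e E ψ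
  | e, E, .imp φ ψ => M.Sat e E φ → M.Sat e E ψ
  | e, E, .all x φ => ∀ a : M.Num, M.Sat (Function.update e x a) E φ
  | e, E, .ex x φ => ∃ a : M.Num, M.Sat (Function.update e x a) E φ
  | e, E, .allSet X φ => ∀ A : M.sets, M.Sat e (Function.update E X A) φ
  | e, E, .exSet X φ => ∃ A : M.sets, M.Sat e (Function.update E X A) φ

/-! ## The axioms of `RCA₀` and arithmetical comprehension -/

/-- The basic axioms. -/
structure BasicAxioms (M : SecondOrderStructure.{u}) : Prop where
  succ_ne_zero : ∀ n : M.Num, n + 1 ≠ 0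
  succ_inj : ∀ m n : M.Num, m + 1 = n + 1 → m = n
  add_zero : ∀ m : M.Num, m + 0 = m
  add_succ : ∀ m n : M.Num, m + (n + 1) = (m + n) + 1
  mul_zero : ∀ m : M.Num, m * 0 = 0
  mul_succ : ∀ m n : M.Num, m * (n + 1) = m * n + m
  not_lt_zero : ∀ m : M.Num, ¬ m < 0
  lt_succ : ∀ m n : M.Num, m < n + 1 ↔ m < n ∨ m = n

/-- The scheme of `Σ⁰₁` induction (with number and set parameters). -/
def SigmaInduction (M : SecondOrderStructure.{u}) : Prop :=
  ∀ φ : Formula, φ.IsSigma → ∀ (x : ℕ) (e : ℕ → M.Num) (E : ℕ → M.sets),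
    M.Sat (Function.update e x 0) E φ →
    (∀ n : M.Num, M.Sat (Function.update e x n) E φ → M.Sat (Function.update e x (n + 1)) E φ) →
    ∀ n : M.Num, M.Sat (Function.update e x n) E φ

/-- The scheme of `Δ⁰₁` comprehension (with number and set parameters). -/
def DeltaComprehension (M : SecondOrderStructure.{u}) : Prop :=
  ∀ φ ψ : Formula, φ.IsSigma → ψ.IsPi → ∀ (x : ℕ) (e : ℕ → M.Num) (E : ℕ → M.sets),
    (∀ n : M.Num, M.Sat (Function.update e x n) E φ ↔ M.Sat (Function.update e x n) E ψ) →
    ∃ X ∈ M.sets, ∀ n : M.Num, n ∈ X ↔ M.Sat (Function.update e x n) E φ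

/-- `M` is a model of `RCA₀`. -/
structure ModelsRCA (M : SecondOrderStructure.{u}) : Prop where
  basic : M.BasicAxioms
  induction : M.SigmaInduction
  comprehension : M.DeltaComprehension

/-- `M` satisfies the scheme of arithmetical comprehension (with number and set parameters). -/
def ArithmeticalComprehension (M : SecondOrderStructure.{u}) : Prop :=
  ∀ φ : Formula, φ.IsArithmetical → ∀ (x : ℕ) (e : ℕ → M.Num) (E : ℕ → M.sets),
    ∃ X ∈ M.sets, ∀ n : M.Num, n ∈ X ↔ M.Sat (Function.update e x n) E φ

/-! ## The extended Goodstein theorem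

The following notions are interpreted in the structure `M`: all quantifiers range over the
numbers of `M` or over the sets in `M.sets`. -/

/-- The non-strict order between numbers. -/
def Le (M : SecondOrderStructure.{u}) (x y : M.Num) : Prop := x < y ∨ x = y

/-- The number that codes the pair of `i` and `j`. -/
def pair (M : SecondOrderStructure.{u}) (i j : M.Num) : M.Num := (i + j) * (i + j) + i

/-- `f` is (the graph of) a function from the numbers to the numbers. -/
def IsFun (M : SecondOrderStructure.{u}) (f : Set M.Num) : Prop :=
  f ∈ M.sets ∧ (∀ x ∈ f, ∃ i j, x = M.pair i j) ∧ ∀ i, ∃! j, M.pair i j ∈ f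

/-- `f(i) = j`. -/
def App (M : SecondOrderStructure.{u}) (f : Set M.Num) (i j : M.Num) : Prop := M.pair i j ∈ f

/-- `2 ^ x = y`, where exponentiation is defined by primitive recursion. -/
def Pow (M : SecondOrderStructure.{u}) (x y : M.Num) : Prop :=
  ∃ p : Set M.Num, M.IsFun p ∧ M.App p 0 1 ∧
    (∀ i u, M.App p i u → M.App p (i + 1) (u + u)) ∧ M.App p x y

/-- `c_i(n) = k`, for a family `c` of functions that is coded by the set of triples
`((i, n), k)` with `c_i(n) = k`. -/
def FamApp (M : SecondOrderStructure.{u}) (c : Set M.Num) (i n k : M.Num) : Prop :=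
  M.pair (M.pair i n) k ∈ c

/-- `c` is a family of functions `c_i : {0, …, b(i) - 1} → {0, …, b(i + 1) - 1}`. -/
structure IsFamily (M : SecondOrderStructure.{u}) (b c : Set M.Num) : Prop where
  mem_sets : c ∈ M.sets
  domain : ∀ x ∈ c, ∃ i n k u, x = M.pair (M.pair i n) k ∧ M.App b i u ∧ n < u
  total : ∀ i n u, M.App b i u → n < u → ∃! k, M.FamApp c i n k
  codomain : ∀ i n k v, M.FamApp c i n k → M.App b (i + 1) v → k < v

/-- `c_{ij}(x) = y` for `c_{ij} = c_{j-1} ∘ … ∘ c_i`: there is a sequence that leads from `x` at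
position `i` to `y` at position `j` and which proceeds from position `k` to position `k + 1`
according to `c_k`. (Only the values of `f` at the positions between `i` and `j` matter.) -/
def IterApp (M : SecondOrderStructure.{u}) (c : Set M.Num) (i j x y : M.Num) : Prop :=
  ∃ f : Set M.Num, M.IsFun f ∧ M.App f i x ∧ M.App f j y ∧
    ∀ k u v, M.Le i k → k < j → M.App f k u → M.App f (k + 1) v → M.FamApp c k u v

/-- `Y` is an infinite set of numbers. -/
def IsInfinite (M : SecondOrderStructure.{u}) (Y : Set M.Num) : Prop :=
  Y ∈ M.sets ∧ ∀ n, ∃ k ∈ Y, n < k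

/-- `(b, c)` is a Goodstein system. -/
structure GoodsteinSystem (M : SecondOrderStructure.{u}) (b c : Set M.Num) : Prop where
  isFun : M.IsFun b
  mono : ∀ i j u v, M.Le i j → M.App b i u → M.App b j v → M.Le u v
  pos : ∀ u, M.App b 0 u → 0 < u
  isFamily : M.IsFamily b c
  strictMono : ∀ i n n' k k', n < n' → M.FamApp c i n k → M.FamApp c i n' k' → k < k'
  recurrent : ∀ d Y : Set M.Num, M.IsFun d → (∀ i u v, M.App d i u → M.App b i v → u < v) →
    M.IsInfinite Y → ∃ i ∈ Y, ∃ j ∈ Y, i < j ∧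
      ∃ x y z, M.App d i x ∧ M.IterApp c i j x y ∧ M.App d j z ∧ M.Le y z

/-- `2 ^ f(0) + … + 2 ^ f(k) = s`, where `σ` is the sequence of partial sums. -/
def PowSum (M : SecondOrderStructure.{u}) (f : Set M.Num) (k s : M.Num) : Prop :=
  ∃ σ : Set M.Num, M.IsFun σ ∧ M.App σ 0 0 ∧
    (∀ j n p u, M.Le j k → M.App f j n → M.Pow n p → M.App σ j u → M.App σ (j + 1) (u + p)) ∧
    M.App σ (k + 1) s

/-- One step of a Goodstein sequence, from the value `u` at `i` to the value `v` at `i + 1`: if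
`u = 0` then `v = 0`, and if `u = 2 ^ n_0 + … + 2 ^ n_k` with `b(i) > n_0 > … > n_k` then
`v = 2 ^ c_i(n_0) + … + 2 ^ c_i(n_k) - 1`. The sequences of the exponents `n_0, …, n_k` and of the
new exponents `c_i(n_0), …, c_i(n_k)` are represented by functions `f` and `g`, of which only the
values at `0, …, k` matter. -/
def GoodsteinStep (M : SecondOrderStructure.{u}) (b c : Set M.Num) (i u v : M.Num) : Prop :=
  (u = 0 ∧ v = 0) ∨
  ∃ (k : M.Num) (f g : Set M.Num), M.IsFun f ∧ M.IsFun g ∧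
    (∀ n w, M.App f 0 n → M.App b i w → n < w) ∧
    (∀ j n n', j < k → M.App f j n → M.App f (j + 1) n' → n' < n) ∧
    M.PowSum f k u ∧
    (∀ j n n', M.Le j k → M.App f j n → M.App g j n' → M.FamApp c i n n') ∧
    M.PowSum g k (v + 1)

/-- `G` is the Goodstein sequence for binary representation with respect to `(b, c)` and the
starting value `m`. -/
structure IsGoodsteinSequence (M : SecondOrderStructure.{u}) (b c : Set M.Num) (m : M.Num)
    (G : Set M.Num) : Prop where
  isFun : M.IsFun G
  start : M.App G 0 m
  step : ∀ i u v, M.App G i u → M.App G (i + 1) v → M.GoodsteinStep b c i u v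

/-- `M` satisfies the extended Goodstein theorem for the binary representation: for any Goodstein
system `(b, c)` and any `m < 2 ^ b(0)`, the Goodstein sequence reaches zero. -/
def ExtendedGoodstein (M : SecondOrderStructure.{u}) : Prop :=
  ∀ b c : Set M.Num, M.GoodsteinSystem b c →
    ∀ m w p : M.Num, M.App b 0 w → M.Pow w p → m < p →
      ∃ G : Set M.Num, M.IsGoodsteinSequence b c m G ∧ ∃ i : M.Num, M.App G i 0

end SecondOrderStructure

/-! Both directions pass through Σ⁰₁ comprehension, which over RCA₀ amounts to arithmetical
comprehension: once it is available, a quantifier in front of a Δ⁰₁ predicate yields a Δ⁰₁ predicate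
again (`dl_sat`).

Termination. Let `hat C i` be the change of exponents, so that G(i+1) = `hat C i (G i) - 1`, and let
d(i) = `val2 (G i)` be the last exponent of G(i). Suppose that G never vanishes. The indices i for
which no j > i satisfies c_ij(d(i)) ≤ d(j) form a set by Σ⁰₁ comprehension, and this set is finite
by the defining property of Goodstein systems. Hence from some i₀ on, every index has a later
return. Between an index and its first return the sequence only works off the image of the last
summand, and at the return this image is exactly used up (`goodstein_first_return`). Σ⁰₁ induction
over the digits of G(i₀), from the lowest upwards, removes all of them (`exists_goodstein_eq_zero`),
so zero is reached after all. No ordinals are involved.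

Reversal. Let a Σ⁰₁ class be enumerated in stages, and keep a stack 0, …, h-1 of candidates. A stage
pushes one more number, unless some number on the stack is newly enumerated; in that case the stack
is cut back to height k+1 for the least such k. Measure an exponent at stage i by its distance from
2i. A candidate n that is not yet enumerated is represented by the exponent at distance 2n+1, and a
marker sits at distance 2h. The function `shift Θ i` adds two to the exponents at distance at most
`keep Θ i`, which preserves their distance, and fixes all others, whose distance grows by two. The
Goodstein sequence that starts with 1 stays above the number represented in this way
(`missing_le_of_step`): at a push, the old marker pays for a new digit, a new marker and the
subtraction of one; at a cut, the digit of k, which is no longer needed, pays for a marker and the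
subtraction.

So this sequence never terminates, and by the Goodstein theorem the recurrence condition must fail:
there are D and an infinite set Y with D(j) < c_ij(D(i)) for all i < j in Y
(`ExtendedGoodstein.exists_descending`). The distances y_i = 2i - D(i) increase along Y and are thus
unbounded. They are at most twice the height of the stack, for an exponent beyond the stack is never
moved again and D would descend forever. If 2n+1 < y_i and n is not enumerated before stage i, then
it never is: otherwise the stack would be cut at or below n and y_i would leave it for good. This
defines the complement of the class by a Σ⁰₁ formula, and Δ⁰₁ comprehension applies
(`exists_decision`).

To run these arguments inside a possibly non-standard model, definability is treated semantically by
the classes `Sig`, `Dl` and `Rec`, whose closure properties are instances, and primitive recursion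
is derived from divisibility codes for finite sets (`exists_recursion`). -/

set_option linter.unusedSectionVars false
set_option synthInstance.maxHeartbeats 400000
set_option synthInstance.maxSize 4096

namespace SecondOrderStructure

/-! ## Definable predicates of tuples -/

section Definability

variable {M : SecondOrderStructure.{u}}

/-- Polynomial functions of tuples, with parameters. -/
inductive Poly (M : SecondOrderStructure.{u}) {n : ℕ} : ((Fin n → M.Num) → M.Num) → Prop
  | var (i : Fin n) : Poly M (fun v => v i)
  | const (a : M.Num) : Poly M (fun _ => a)
  | add {s t : (Fin n → M.Num) → M.Num} : Poly M s → Poly M t → Poly M (fun v => s v + t v)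
  | mul {s t : (Fin n → M.Num) → M.Num} : Poly M s → Poly M t → Poly M (fun v => s v * t v)

/-- Extend a tuple by one entry. -/
abbrev ext {n : ℕ} (v : Fin n → M.Num) (a : M.Num) : Fin (n + 1) → M.Num :=
  Fin.snoc (α := fun _ => M.Num) v a

/-- Predicates that are defined by bounded quantifier formulas with parameters. -/
inductive Bounded (M : SecondOrderStructure.{u}) : (n : ℕ) → ((Fin n → M.Num) → Prop) → Prop
  | eq {n : ℕ} {s t : (Fin n → M.Num) → M.Num} : Poly M s → Poly M t →
      Bounded M n (fun v => s v = t v)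
  | lt {n : ℕ} {s t : (Fin n → M.Num) → M.Num} : Poly M s → Poly M t →
      Bounded M n (fun v => s v < t v)
  | mem {n : ℕ} {t : (Fin n → M.Num) → M.Num} (X : M.sets) : Poly M t →
      Bounded M n (fun v => t v ∈ (X : Set M.Num))
  | not {n : ℕ} {P : (Fin n → M.Num) → Prop} : Bounded M n P → Bounded M n (fun v => ¬ P v)
  | and {n : ℕ} {P Q : (Fin n → M.Num) → Prop} : Bounded M n P → Bounded M n Q →
      Bounded M n (fun v => P v ∧ Q v)
  | bexSnoc {n : ℕ} {t : (Fin n → M.Num) → M.Num} {P : (Fin (n + 1) → M.Num) → Prop} :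
      Poly M t → Bounded M (n + 1) P → Bounded M n (fun v => ∃ a, a < t v ∧ P (ext v a))

theorem Poly.subst {n m : ℕ} {t : (Fin n → M.Num) → M.Num} (ht : Poly M t)
    (g : Fin n → (Fin m → M.Num) → M.Num) (hg : ∀ i, Poly M (g i)) :
    Poly M (fun v => t (fun i => g i v)) := by
  induction ht with
  | var i => exact hg i
  | const a => exact .const a
  | add _ _ h₁ h₂ => exact .add h₁ h₂
  | mul _ _ h₁ h₂ => exact .mul h₁ h₂

theorem Poly.weaken {n : ℕ} {t : (Fin n → M.Num) → M.Num} (ht : Poly M t) :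
    Poly M (fun v : Fin (n + 1) → M.Num => t (fun i => v i.castSucc)) :=
  ht.subst _ fun i => .var i.castSucc

theorem Bounded.subst {n m : ℕ} {P : (Fin n → M.Num) → Prop} (hP : Bounded M n P)
    (g : Fin n → (Fin m → M.Num) → M.Num) (hg : ∀ i, Poly M (g i)) :
    Bounded M m (fun v => P (fun i => g i v)) := by
  induction hP generalizing m with
  | eq h₁ h₂ => exact .eq (h₁.subst g hg) (h₂.subst g hg)
  | lt h₁ h₂ => exact .lt (h₁.subst g hg) (h₂.subst g hg)
  | mem X h₁ => exact .mem X (h₁.subst g hg)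
  | not _ h₁ => exact .not (h₁ g hg)
  | and _ _ h₁ h₂ => exact .and (h₁ g hg) (h₂ g hg)
  | @bexSnoc n t P h₁ _ h₂ =>
    -- Below the quantifier the substitution is extended by the identity on the bound variable.
    have := h₂ (m := m + 1)
      (fun i w => ext (fun j => g j (fun k => w k.castSucc)) (w (Fin.last m)) i) (by
        intro i
        refine Fin.lastCases ?_ (fun j => ?_) i
        · simpa [ext] using Poly.var (M := M) (Fin.last m)
        · simpa [ext] using (hg j).weaken)
    have h := Bounded.bexSnoc (h₁.subst g hg) this
    convert h using 5
    simp [ext]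

theorem Bounded.congr {n : ℕ} {P Q : (Fin n → M.Num) → Prop} (hP : Bounded M n P)
    (h : ∀ v, Q v ↔ P v) : Bounded M n Q := by
  rwa [show Q = P from funext fun v => propext (h v)]

theorem Bounded.bex {n : ℕ} {t : (Fin n → M.Num) → M.Num} {P : (Fin n → M.Num) → M.Num → Prop}
    (ht : Poly M t)
    (hP : Bounded M (n + 1) (fun w => P (fun i => w i.castSucc) (w (Fin.last n)))) :
    Bounded M n (fun v => ∃ a, a < t v ∧ P v a) :=
  (Bounded.bexSnoc ht hP).congr fun v => by simp [ext]

theorem Bounded.or {n : ℕ} {P Q : (Fin n → M.Num) → Prop} (hP : Bounded M n P)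
    (hQ : Bounded M n Q) : Bounded M n (fun v => P v ∨ Q v) :=
  (Bounded.not (.and (.not hP) (.not hQ))).congr fun v => by tauto

theorem Bounded.imp {n : ℕ} {P Q : (Fin n → M.Num) → Prop} (hP : Bounded M n P)
    (hQ : Bounded M n Q) : Bounded M n (fun v => P v → Q v) :=
  (Bounded.not (.and hP (.not hQ))).congr fun v => by tauto

theorem Bounded.ball {n : ℕ} {t : (Fin n → M.Num) → M.Num} {P : (Fin n → M.Num) → M.Num → Prop}
    (ht : Poly M t)
    (hP : Bounded M (n + 1) (fun w => P (fun i => w i.castSucc) (w (Fin.last n)))) :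
    Bounded M n (fun v => ∀ a, a < t v → P v a) :=
  (Bounded.not (.bex (P := fun v a => ¬ P v a) ht (.not hP))).congr fun v => by
    push Not; rfl

/-! ### Formulas for definable predicates -/

/-- Tuple entries occupy the even variables and parameters the odd ones. The parameters form a block
that starts at `K`, so subterms can be given disjoint blocks. Freshness of the even variables from
`2 * n` on is what bounded quantifiers require of their bounds. -/
theorem Poly.exists_term {n : ℕ} {t : (Fin n → M.Num) → M.Num} (ht : Poly M t) (K : ℕ) :
    ∃ (s : Term) (r : ℕ) (p : ℕ → M.Num), (∀ k, n ≤ k → ¬ s.Occurs (2 * k)) ∧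
      ∀ e : ℕ → M.Num, (∀ k, K ≤ k → k < K + r → e (2 * k + 1) = p k) →
        M.value e s = t (fun i => e (2 * i)) := by
  induction ht generalizing K with
  | var i =>
    refine ⟨.var (2 * i), 0, fun _ => 0, fun k hk h => ?_, fun e _ => rfl⟩
    have : 2 * k = 2 * (i : ℕ) := h
    omega
  | const a =>
    refine ⟨.var (2 * K + 1), 1, fun _ => a, fun k hk h => ?_, fun e h => h K le_rfl (by omega)⟩
    have : 2 * k = 2 * K + 1 := h
    omega
  | add _ _ h₁ h₂ =>
    obtain ⟨s₁, r₁, p₁, o₁, h₁⟩ := h₁ K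
    obtain ⟨s₂, r₂, p₂, o₂, h₂⟩ := h₂ (K + r₁)
    refine ⟨.add s₁ s₂, r₁ + r₂, fun k => if k < K + r₁ then p₁ k else p₂ k,
      fun k hk h => h.elim (o₁ k hk) (o₂ k hk), fun e h => ?_⟩
    rw [value, h₁ e fun k hk hk' => (h k hk (by omega)).trans (if_pos hk'),
      h₂ e fun k hk hk' =>
        (h k (by omega) (by omega)).trans (if_neg (by omega))]
  | mul _ _ h₁ h₂ =>
    obtain ⟨s₁, r₁, p₁, o₁, h₁⟩ := h₁ K
    obtain ⟨s₂, r₂, p₂, o₂, h₂⟩ := h₂ (K + r₁)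
    refine ⟨.mul s₁ s₂, r₁ + r₂, fun k => if k < K + r₁ then p₁ k else p₂ k,
      fun k hk h => h.elim (o₁ k hk) (o₂ k hk), fun e h => ?_⟩
    rw [value, h₁ e fun k hk hk' => (h k hk (by omega)).trans (if_pos hk'),
      h₂ e fun k hk hk' =>
        (h k (by omega) (by omega)).trans (if_neg (by omega))]

theorem Bounded.exists_formula {n : ℕ} {P : (Fin n → M.Num) → Prop} (hP : Bounded M n P) (K : ℕ) :
    ∃ (φ : Formula) (r : ℕ) (p : ℕ → M.Num) (E : ℕ → M.sets), φ.IsBounded ∧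
      ∀ (e : ℕ → M.Num) (E' : ℕ → M.sets),
        (∀ k, K ≤ k → k < K + r → e (2 * k + 1) = p k ∧ E' k = E k) →
        (M.Sat e E' φ ↔ P (fun i => e (2 * i))) := by
  obtain ⟨X₀, hX₀⟩ := M.sets_nonempty
  induction hP generalizing K with
  | eq h₁ h₂ =>
    obtain ⟨s₁, r₁, p₁, -, h₁⟩ := h₁.exists_term K
    obtain ⟨s₂, r₂, p₂, -, h₂⟩ := h₂.exists_term (K + r₁)
    refine ⟨.eq s₁ s₂, r₁ + r₂, fun k => if k < K + r₁ then p₁ k else p₂ k, fun _ => ⟨X₀, hX₀⟩,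
      .eq _ _, fun e E' h => ?_⟩
    rw [Sat, h₁ e fun k hk hk' => (h k hk (by omega)).1.trans (if_pos hk'),
      h₂ e fun k hk hk' =>
        (h k (by omega) (by omega)).1.trans (if_neg (by omega))]
  | lt h₁ h₂ =>
    obtain ⟨s₁, r₁, p₁, -, h₁⟩ := h₁.exists_term K
    obtain ⟨s₂, r₂, p₂, -, h₂⟩ := h₂.exists_term (K + r₁)
    refine ⟨.lt s₁ s₂, r₁ + r₂, fun k => if k < K + r₁ then p₁ k else p₂ k, fun _ => ⟨X₀, hX₀⟩,
      .lt _ _, fun e E' h => ?_⟩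
    rw [Sat, h₁ e fun k hk hk' => (h k hk (by omega)).1.trans (if_pos hk'),
      h₂ e fun k hk hk' =>
        (h k (by omega) (by omega)).1.trans (if_neg (by omega))]
  | mem X h₁ =>
    obtain ⟨s₁, r₁, p₁, -, h₁⟩ := h₁.exists_term K
    -- Number and set variables are separate sorts, so the index `K` may serve both; `r₁ + 1`
    -- ensures that `K` belongs to the block even if the term has no parameters.
    refine ⟨.mem s₁ K, r₁ + 1, p₁, fun _ => X, .mem _ _, fun e E' h => ?_⟩
    rw [Sat, h₁ e fun k hk hk' => (h k hk (by omega)).1, (h K le_rfl (by omega)).2]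
  | not _ h₁ =>
    obtain ⟨φ, r, p, E, hφ, h₁⟩ := h₁ K
    exact ⟨.not φ, r, p, E, .not hφ, fun e E' h => by rw [Sat, h₁ e E' h]⟩
  | and _ _ h₁ h₂ =>
    obtain ⟨φ₁, r₁, p₁, E₁, b₁, h₁⟩ := h₁ K
    obtain ⟨φ₂, r₂, p₂, E₂, b₂, h₂⟩ := h₂ (K + r₁)
    refine ⟨.and φ₁ φ₂, r₁ + r₂, fun k => if k < K + r₁ then p₁ k else p₂ k,
      fun k => if k < K + r₁ then E₁ k else E₂ k, .and b₁ b₂, fun e E' h => ?_⟩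
    rw [Sat, h₁ e E' fun k hk hk' => by
        simpa only [if_pos hk'] using h k hk (by omega),
      h₂ e E' fun k hk hk' => by
        simpa only [if_neg (show ¬ k < K + r₁ by omega)] using h k (by omega) (by omega)]
  | @bexSnoc n t P h₁ _ h₂ =>
    obtain ⟨s₁, r₁, p₁, o₁, h₁⟩ := h₁.exists_term K
    obtain ⟨φ₂, r₂, p₂, E₂, b₂, h₂⟩ := h₂ (K + r₁)
    -- The bound variable is the next even one, where the entry that extends the tuple is expected.
    refine ⟨.ex (2 * n) (.and (.lt (.var (2 * n)) s₁) φ₂), r₁ + r₂,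
      fun k => if k < K + r₁ then p₁ k else p₂ k, E₂, .ex _ _ (o₁ n le_rfl) b₂, fun e E' h => ?_⟩
    simp only [Sat, value, Function.update_self]
    refine exists_congr fun a => ?_
    rw [h₁ _ fun k hk hk' => by
        rw [Function.update_of_ne (by omega)]
        exact (h k hk (by omega)).1.trans (if_pos hk'),
      h₂ _ E' fun k hk hk' => by
        rw [Function.update_of_ne (by omega)]
        simpa only [if_neg (show ¬ k < K + r₁ by omega)] using h k (by omega) (by omega)]
    have e₁ : (fun i : Fin n => Function.update e (2 * n) a (2 * (i : ℕ))) =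
        fun i : Fin n => e (2 * (i : ℕ)) := by
      funext i
      rw [Function.update_of_ne (by omega)]
    have e₂ : (fun i : Fin (n + 1) => Function.update e (2 * n) a (2 * (i : ℕ))) =
        ext (fun i : Fin n => e (2 * (i : ℕ))) a := by
      funext i
      refine Fin.lastCases ?_ (fun j => ?_) i
      · simp [ext]
      · simp only [ext, Fin.snoc_castSucc, Fin.val_castSucc]
        rw [Function.update_of_ne (by omega)]
    rw [e₁, e₂]

/-- `Σ⁰₁` definable predicates of tuples, with parameters. -/
class Sig (M : SecondOrderStructure.{u}) {n : ℕ} (P : (Fin n → M.Num) → Prop) : Prop where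
  out : ∃ Q : (Fin (n + 1) → M.Num) → Prop, Bounded M (n + 1) Q ∧ ∀ v, P v ↔ ∃ a, Q (ext v a)

theorem Sig.exists_formula {n : ℕ} {P : (Fin n → M.Num) → Prop} (hP : Sig M P) :
    ∃ (θ : Formula) (e₀ : ℕ → M.Num) (E : ℕ → M.sets), θ.IsBounded ∧
      ∀ e : ℕ → M.Num, (∀ k, e (2 * k + 1) = e₀ (2 * k + 1)) →
        (M.Sat e E (.ex (2 * n) θ) ↔ P (fun i => e (2 * i))) := by
  obtain ⟨Q, hQ, h⟩ := hP.out
  obtain ⟨θ, r, p, E, hθ, h'⟩ := hQ.exists_formula 0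
  refine ⟨θ, fun k => p (k / 2), E, hθ, fun e he => ?_⟩
  rw [h, Sat]
  refine exists_congr fun a => ?_
  rw [h' _ E fun k _ _ => ⟨by
    rw [Function.update_of_ne (by omega), he]
    exact congrArg p (by omega), rfl⟩]
  have e₂ : (fun i : Fin (n + 1) => Function.update e (2 * n) a (2 * (i : ℕ))) =
      ext (fun i : Fin n => e (2 * (i : ℕ))) a := by
    funext i
    refine Fin.lastCases ?_ (fun j => ?_) i
    · simp [ext]
    · simp only [ext, Fin.snoc_castSucc, Fin.val_castSucc]
      rw [Function.update_of_ne (by omega)]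
  rw [e₂]

theorem Bounded.sig {n : ℕ} {P : (Fin n → M.Num) → Prop} (hP : Bounded M n P) : Sig M P :=
  ⟨fun w => P (fun i => w i.castSucc), hP.subst _ fun i => .var i.castSucc, fun v => by
    simp [ext]⟩

theorem Sig.congr {n : ℕ} {P Q : (Fin n → M.Num) → Prop} (hP : Sig M P)
    (h : ∀ v, Q v ↔ P v) : Sig M Q := by
  rwa [show Q = P from funext fun v => propext (h v)]

/-- `M` is a model of `RCA₀`. -/
class RCA (M : SecondOrderStructure.{u}) : Prop where
  models : M.ModelsRCA

variable [RCA M]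

theorem sig_induction {P : M.Num → Prop} (hP : Sig M (fun v : Fin 1 → M.Num => P (v 0)))
    (h0 : P 0) (hs : ∀ n, P n → P (n + 1)) (n : M.Num) : P n := by
  obtain ⟨θ, e₀, E, hθ, h⟩ := hP.exists_formula
  have key : ∀ a, M.Sat (Function.update e₀ 0 a) E (.ex (2 * 1) θ) ↔ P a := fun a => by
    rw [h _ fun k => by rw [Function.update_of_ne (by omega)]]
    simp
  have := (RCA.models (M := M)).induction (.ex (2 * 1) θ) ⟨_, θ, hθ, rfl⟩ 0 e₀ E
  simp only [key] at this
  exact this h0 hs n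

theorem bounded_induction {P : M.Num → Prop}
    (hP : Bounded M 1 (fun v : Fin 1 → M.Num => P (v 0)))
    (h0 : P 0) (hs : ∀ n, P n → P (n + 1)) (n : M.Num) : P n :=
  sig_induction hP.sig h0 hs n

end Definability

/-! ## The numbers form an ordered semiring -/

section Arithmetic

variable {M : SecondOrderStructure.{u}} [RCA M]

theorem basic : M.BasicAxioms := (RCA.models (M := M)).basic

theorem num_add_assoc (a b c : M.Num) : a + b + c = a + (b + c) := by
  induction c using bounded_induction with
  | hP => exact .eq (.add (.const _) (.var 0)) (.add (.const _) (.add (.const _) (.var 0)))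
  | h0 => rw [basic.add_zero, basic.add_zero]
  | hs n h => rw [basic.add_succ, basic.add_succ, basic.add_succ, h]

theorem num_zero_add (a : M.Num) : 0 + a = a := by
  induction a using bounded_induction with
  | hP => exact .eq (.add (.const _) (.var 0)) (.var 0)
  | h0 => rw [basic.add_zero]
  | hs n h => rw [basic.add_succ, h]

theorem num_succ_add (a b : M.Num) : a + 1 + b = a + b + 1 := by
  induction b using bounded_induction with
  | hP => exact .eq (.add (.const _) (.var 0)) (.add (.add (.const _) (.var 0)) (.const _))
  | h0 => rw [basic.add_zero, basic.add_zero]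
  | hs n h => rw [basic.add_succ, basic.add_succ, h]

theorem num_add_comm (a b : M.Num) : a + b = b + a := by
  induction b using bounded_induction with
  | hP => exact .eq (.add (.const _) (.var 0)) (.add (.var 0) (.const _))
  | h0 => rw [basic.add_zero, num_zero_add]
  | hs n h => rw [basic.add_succ, num_succ_add, h]

theorem num_zero_mul (a : M.Num) : 0 * a = 0 := by
  induction a using bounded_induction with
  | hP => exact .eq (.mul (.const _) (.var 0)) (.const _)
  | h0 => rw [basic.mul_zero]
  | hs n h => rw [basic.mul_succ, h, basic.add_zero]

theorem num_succ_mul (a b : M.Num) : (a + 1) * b = a * b + b := by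
  induction b using bounded_induction with
  | hP => exact .eq (.mul (.const _) (.var 0)) (.add (.mul (.const _) (.var 0)) (.var 0))
  | h0 => rw [basic.mul_zero, basic.mul_zero, basic.add_zero]
  | hs n h =>
    rw [basic.mul_succ, basic.mul_succ, h, basic.add_succ, basic.add_succ, num_add_assoc,
      num_add_assoc, ← num_add_assoc n a, num_add_comm n a, num_add_assoc a n,
      ← num_add_assoc (a * n), num_add_assoc _ n, num_add_assoc]

theorem num_mul_comm (a b : M.Num) : a * b = b * a := by
  induction b using bounded_induction with
  | hP => exact .eq (.mul (.const _) (.var 0)) (.mul (.var 0) (.const _))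
  | h0 => rw [basic.mul_zero, num_zero_mul]
  | hs n h => rw [basic.mul_succ, num_succ_mul, h]

theorem num_mul_add (a b c : M.Num) : a * (b + c) = a * b + a * c := by
  induction c using bounded_induction with
  | hP => exact (.eq (.mul (.const _) (.add (.const _) (.var 0)))
      (.add (.const _) (.mul (.const _) (.var 0))))
  | h0 => rw [basic.add_zero, basic.mul_zero, basic.add_zero]
  | hs n h => rw [basic.add_succ, basic.mul_succ, basic.mul_succ, h, num_add_assoc]

theorem num_mul_assoc (a b c : M.Num) : a * b * c = a * (b * c) := by
  induction c using bounded_induction with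
  | hP => exact .eq (.mul (.const _) (.var 0)) (.mul (.const _) (.mul (.const _) (.var 0)))
  | h0 => rw [basic.mul_zero, basic.mul_zero, basic.mul_zero]
  | hs n h => rw [basic.mul_succ, basic.mul_succ, num_mul_add, h]

theorem num_mul_one (a : M.Num) : a * 1 = a := by
  rw [← num_zero_add (1 : M.Num), basic.mul_succ, basic.mul_zero, num_zero_add]

theorem num_lt_trans {a b c : M.Num} (hab : a < b) : b < c → a < c := by
  induction c using bounded_induction with
  | hP => exact .imp (.lt (.const _) (.var 0)) (.lt (.const _) (.var 0))
  | h0 => exact fun h => (basic.not_lt_zero _ h).elim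
  | hs n h =>
    rw [basic.lt_succ, basic.lt_succ]
    rintro (h' | rfl)
    · exact .inl (h h')
    · exact .inl hab

theorem num_lt_succ_self (a : M.Num) : a < a + 1 := (basic.lt_succ _ _).2 (.inr rfl)

theorem num_succ_lt_succ {a b : M.Num} : a < b → a + 1 < b + 1 := by
  induction b using bounded_induction with
  | hP => exact (.imp (.lt (.const _) (.var 0)) (.lt (.add (.const _) (.const _))
      (.add (.var 0) (.const _))))
  | h0 => exact fun h => (basic.not_lt_zero _ h).elim
  | hs n h =>
    intro h'
    rcases (basic.lt_succ _ _).1 h' with h' | rfl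
    · exact num_lt_trans (h h') (num_lt_succ_self _)
    · exact num_lt_succ_self _

theorem num_lt_irrefl (a : M.Num) : ¬ a < a := by
  induction a using bounded_induction with
  | hP => exact .not (.lt (.var 0) (.var 0))
  | h0 => exact basic.not_lt_zero _
  | hs n h =>
    intro h'
    rcases (basic.lt_succ _ _).1 h' with h' | h'
    · exact h (num_lt_trans (num_lt_succ_self _) h')
    · exact h (by simpa [h'] using num_lt_succ_self n)

theorem num_zero_le (a : M.Num) : 0 < a ∨ 0 = a := by
  induction a using bounded_induction with
  | hP => exact .or (.lt (.const _) (.var 0)) (.eq (.const _) (.var 0))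
  | h0 => exact .inr rfl
  | hs n h => exact .inl ((basic.lt_succ _ _).2 h)

theorem num_trichotomy (a b : M.Num) : a < b ∨ a = b ∨ b < a := by
  induction a using bounded_induction with
  | hP => exact (.or (.lt (.var 0) (.const _)) (.or (.eq (.var 0) (.const _))
      (.lt (.const _) (.var 0))))
  | h0 => rcases num_zero_le b with h | h <;> simp [h]
  | hs n h =>
    rcases h with h | rfl | h
    · rcases (basic.lt_succ _ _).1 (num_succ_lt_succ h) with h | h <;> simp [h]
    · exact .inr (.inr (num_lt_succ_self _))
    · exact .inr (.inr (num_lt_trans h (num_lt_succ_self _)))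

theorem num_add_lt_add_right {a b : M.Num} (h : a < b) (c : M.Num) : a + c < b + c := by
  induction c using bounded_induction with
  | hP => exact .lt (.add (.const _) (.var 0)) (.add (.const _) (.var 0))
  | h0 => rwa [basic.add_zero, basic.add_zero]
  | hs n h => rw [basic.add_succ, basic.add_succ]; exact num_succ_lt_succ h

theorem num_exists_add {a b : M.Num} (h : a < b ∨ a = b) : ∃ c, b = a + c := by
  -- The alternative `b < a` removes the hypothesis on `b`, so that the claim is Σ⁰₁ in `b` and open
  -- to induction.
  have : ∃ c, b < a ∨ b = a + c := by
    clear h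
    induction b using sig_induction with
    | hP =>
      refine ⟨fun w : Fin 2 → M.Num => w 0 < a ∨ w 0 = a + w 1,
        .or (.lt (.var 0) (.const _)) (.eq (.var 0) (.add (.const _) (.var 1))), fun v => ?_⟩
      rfl
    | h0 => exact ⟨0, by rw [basic.add_zero]; rcases num_zero_le a with h | h <;> simp [h]⟩
    | hs n h =>
      obtain ⟨c, h | rfl⟩ := h
      · rcases (basic.lt_succ _ _).1 (num_succ_lt_succ h) with h | h
        · exact ⟨0, .inl h⟩
        · exact ⟨0, .inr (by rw [h, basic.add_zero])⟩
      · exact ⟨c + 1, .inr (basic.add_succ _ _).symm⟩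
  obtain ⟨c, h' | h'⟩ := this
  · rcases h with h | rfl
    · exact (num_lt_irrefl _ (num_lt_trans h h')).elim
    · exact (num_lt_irrefl _ h').elim
  · exact ⟨c, h'⟩

noncomputable instance : LinearOrder M.Num where
  le a b := a < b ∨ a = b
  lt a b := a < b
  le_refl a := .inr rfl
  le_trans a b c := by
    rintro (h | rfl) (h' | rfl)
    · exact .inl (num_lt_trans h h')
    · exact .inl h
    · exact .inl h'
    · exact .inr rfl
  le_antisymm a b := by
    rintro (h | rfl) (h' | h')
    · exact (num_lt_irrefl _ (num_lt_trans h h')).elim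
    all_goals first | exact h'.symm | rfl
  le_total a b := by rcases num_trichotomy a b with h | rfl | h <;> simp [*]
  lt_iff_le_not_ge a b := by
    constructor
    · intro h
      refine ⟨.inl h, ?_⟩
      rintro (h' | rfl)
      · exact num_lt_irrefl _ (num_lt_trans h h')
      · exact num_lt_irrefl _ h
    · rintro ⟨h | rfl, h'⟩
      · exact h
      · exact (h' (.inr rfl)).elim
  toDecidableLE := Classical.decRel _

instance : CommSemiring M.Num where
  add a b := a + b
  mul a b := a * b
  zero := 0
  one := 1
  add_assoc := num_add_assoc
  zero_add := num_zero_add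
  add_zero := basic.add_zero
  add_comm := num_add_comm
  left_distrib := num_mul_add
  right_distrib a b c := by
    rw [num_mul_comm (a + b), num_mul_add, num_mul_comm c, num_mul_comm c]
  zero_mul := num_zero_mul
  mul_zero := basic.mul_zero
  mul_assoc := num_mul_assoc
  one_mul a := by rw [num_mul_comm, num_mul_one]
  mul_one := num_mul_one
  mul_comm := num_mul_comm
  nsmul := nsmulRec
  npow := fun n a => Nat.rec 1 (fun _ b => b * a) n

instance : IsOrderedCancelAddMonoid M.Num where
  add_le_add_left a b h c := by
    rcases h with h | rfl
    · exact .inl (num_add_lt_add_right h c)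
    · exact .inr rfl
  le_of_add_le_add_left a b c h := by
    by_contra h'
    rcases num_trichotomy b c with h₁ | h₁ | h₁
    · exact h' (.inl h₁)
    · exact h' (.inr h₁)
    · have := num_add_lt_add_right h₁ a
      rw [num_add_comm _ a, num_add_comm _ a] at this
      exact not_lt_of_ge h this

theorem num_mul_lt_mul {a b c : M.Num} (h : a < b) (hc : 0 < c) : a * c < b * c := by
  obtain ⟨d, rfl⟩ := num_exists_add (.inl h)
  have hd : d ≠ 0 := by rintro rfl; simp at h
  obtain ⟨d, rfl⟩ : ∃ d', d = d' + 1 := by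
    rcases num_zero_le d with h' | h'
    · rcases num_trichotomy d 1 with h₁ | h₁ | h₁
      · rw [← zero_add (1 : M.Num)] at h₁
        rcases (basic.lt_succ _ _).1 h₁ with h₁ | h₁
        · exact (basic.not_lt_zero _ h₁).elim
        · exact (hd h₁).elim
      · exact ⟨0, by rw [h₁, zero_add]⟩
      · obtain ⟨e, rfl⟩ := num_exists_add (.inl h₁)
        exact ⟨e, add_comm _ _⟩
    · exact (hd h'.symm).elim
  have : (a + (d + 1)) * c = a * c + d * c + c := by ring
  rw [this]
  refine lt_of_le_of_lt (b := a * c + d * c) ?_ ?_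
  · have h0 : (0 : M.Num) ≤ d * c := num_zero_le _
    simpa using add_le_add_right h0 (a * c)
  · simpa using num_add_lt_add_right hc (a * c + d * c)

instance : IsStrictOrderedRing M.Num where
  zero_le_one := num_zero_le _
  exists_pair_ne := ⟨0, 1, by simpa using (basic.succ_ne_zero (0 : M.Num)).symm⟩
  mul_lt_mul_of_pos_left c hc a b h := by
    rw [mul_comm c, mul_comm c]
    exact num_mul_lt_mul h hc
  mul_lt_mul_of_pos_right c hc a b h := num_mul_lt_mul h hc

instance : CanonicallyOrderedAdd M.Num where
  exists_add_of_le h := num_exists_add h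
  le_add_self a b := by
    have h0 : (0 : M.Num) ≤ b := num_zero_le _
    simpa using add_le_add_left h0 a
  le_self_add a b := by
    have h0 : (0 : M.Num) ≤ b := num_zero_le _
    simpa using add_le_add_right h0 a

theorem num_lt_succ {a b : M.Num} : a < b + 1 ↔ a ≤ b := basic.lt_succ a b

theorem num_succ_le {a b : M.Num} : a + 1 ≤ b ↔ a < b := by
  rw [← num_lt_succ, add_lt_add_iff_right]

noncomputable instance : Sub M.Num where
  sub a b := if h : b ≤ a then (num_exists_add h).choose else 0

theorem num_add_sub {a b : M.Num} (h : b ≤ a) : b + (a - b) = a := by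
  have : a - b = (num_exists_add h).choose := dif_pos h
  rw [this]
  exact (num_exists_add h).choose_spec.symm

theorem num_sub_eq_zero {a b : M.Num} (h : a ≤ b) : a - b = 0 := by
  rcases h.eq_or_lt with rfl | h
  · simpa using num_add_sub (le_refl a)
  · exact dif_neg (not_le.2 h)

instance : OrderedSub M.Num where
  tsub_le_iff_right a b c := by
    rcases le_total b a with h | h
    · conv_rhs => rw [← num_add_sub h, add_comm]
      rw [add_le_add_iff_right]
    · rw [num_sub_eq_zero h]
      simp only [zero_le, true_iff]
      exact h.trans le_add_self

end Arithmetic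

end SecondOrderStructure

/-! ## The ring of differences of an ordered semiring -/

section Differences

variable (R : Type u) [CommSemiring R] [LinearOrder R] [IsStrictOrderedRing R]

/-- Pairs that represent the same difference. -/
def diffSetoid : Setoid (R × R) where
  r x y := x.1 + y.2 = y.1 + x.2
  iseqv := ⟨fun _ => rfl, fun h => h.symm, fun {x y z} h h' => by grind⟩

/-- The ring of formal differences. -/
def Diff : Type u := Quotient (diffSetoid R)

variable {R}

/-- The formal difference of two elements. -/
def Diff.mk (a b : R) : Diff R := Quotient.mk (diffSetoid R) (a, b)

theorem Diff.mk_eq {a b c d : R} : Diff.mk a b = Diff.mk c d ↔ a + d = c + b :=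
  ⟨fun h => Quotient.exact h, fun h => Quotient.sound h⟩

theorem Diff.ind {P : Diff R → Prop} (h : ∀ a b, P (Diff.mk a b)) (x : Diff R) : P x :=
  Quotient.ind (fun p => h p.1 p.2) x

instance : Zero (Diff R) := ⟨Diff.mk 0 0⟩
instance : One (Diff R) := ⟨Diff.mk 1 0⟩
instance : Neg (Diff R) := ⟨Quotient.map (fun x => (x.2, x.1)) fun x y (h : _ = _) => by
  change x.2 + y.1 = y.2 + x.1; grind⟩
instance : Add (Diff R) := ⟨Quotient.map₂ (fun x y => (x.1 + y.1, x.2 + y.2))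
  fun x y (h : _ = _) z w (h' : _ = _) => by
    change x.1 + z.1 + (y.2 + w.2) = y.1 + w.1 + (x.2 + z.2); grind⟩
instance : Mul (Diff R) := ⟨Quotient.map₂
  (fun x y => (x.1 * y.1 + x.2 * y.2, x.1 * y.2 + x.2 * y.1))
  fun x y (h : _ = _) z w (h' : _ = _) => by
    change x.1 * z.1 + x.2 * z.2 + (y.1 * w.2 + y.2 * w.1) =
      y.1 * w.1 + y.2 * w.2 + (x.1 * z.2 + x.2 * z.1)
    grind⟩
instance : LE (Diff R) := ⟨Quotient.lift₂ (fun x y => x.1 + y.2 ≤ y.1 + x.2)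
  fun x y z w (h : _ = _) (h' : _ = _) => by grind⟩

theorem Diff.mk_add (a b c d : R) : Diff.mk a b + Diff.mk c d = Diff.mk (a + c) (b + d) := rfl
theorem Diff.mk_mul (a b c d : R) :
    Diff.mk a b * Diff.mk c d = Diff.mk (a * c + b * d) (a * d + b * c) := rfl
theorem Diff.neg_mk (a b : R) : -Diff.mk a b = Diff.mk b a := rfl
theorem Diff.zero_def : (0 : Diff R) = Diff.mk 0 0 := rfl
theorem Diff.one_def : (1 : Diff R) = Diff.mk 1 0 := rfl
theorem Diff.mk_le {a b c d : R} : Diff.mk a b ≤ Diff.mk c d ↔ a + d ≤ c + b := Iff.rfl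

instance : CommRing (Diff R) where
  add_assoc x y z := by
    induction x using Diff.ind; induction y using Diff.ind; induction z using Diff.ind
    simp only [Diff.mk_add, add_assoc]
  zero_add x := by
    induction x using Diff.ind
    simp only [Diff.zero_def, Diff.mk_add, zero_add]
  add_zero x := by
    induction x using Diff.ind
    simp only [Diff.zero_def, Diff.mk_add, add_zero]
  add_comm x y := by
    induction x using Diff.ind; induction y using Diff.ind
    simp only [Diff.mk_add, add_comm]
  mul_assoc x y z := by
    induction x using Diff.ind; induction y using Diff.ind; induction z using Diff.ind
    simp only [Diff.mk_mul, Diff.mk_eq]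
    ring
  zero_mul x := by
    induction x using Diff.ind
    simp only [Diff.zero_def, Diff.mk_mul, Diff.mk_eq]
    ring
  mul_zero x := by
    induction x using Diff.ind
    simp only [Diff.zero_def, Diff.mk_mul, Diff.mk_eq]
    ring
  one_mul x := by
    induction x using Diff.ind
    simp only [Diff.one_def, Diff.mk_mul, Diff.mk_eq]
    ring
  mul_one x := by
    induction x using Diff.ind
    simp only [Diff.one_def, Diff.mk_mul, Diff.mk_eq]
    ring
  mul_comm x y := by
    induction x using Diff.ind; induction y using Diff.ind
    simp only [Diff.mk_mul, Diff.mk_eq]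
    ring
  left_distrib x y z := by
    induction x using Diff.ind; induction y using Diff.ind; induction z using Diff.ind
    simp only [Diff.mk_mul, Diff.mk_add, Diff.mk_eq]
    ring
  right_distrib x y z := by
    induction x using Diff.ind; induction y using Diff.ind; induction z using Diff.ind
    simp only [Diff.mk_mul, Diff.mk_add, Diff.mk_eq]
    ring
  neg_add_cancel x := by
    induction x using Diff.ind
    simp only [Diff.neg_mk, Diff.mk_add, Diff.zero_def, Diff.mk_eq]
    ring
  nsmul := nsmulRec
  zsmul := zsmulRec

noncomputable instance : LinearOrder (Diff R) where
  le_refl x := by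
    induction x using Diff.ind
    exact Diff.mk_le.2 le_rfl
  le_trans x y z := by
    induction x using Diff.ind; induction y using Diff.ind; induction z using Diff.ind
    simp only [Diff.mk_le]
    grind
  le_antisymm x y := by
    induction x using Diff.ind; induction y using Diff.ind
    simp only [Diff.mk_le, Diff.mk_eq]
    exact le_antisymm
  le_total x y := by
    induction x using Diff.ind; induction y using Diff.ind
    exact le_total _ _
  toDecidableLE := Classical.decRel _

theorem Diff.mk_lt {a b c d : R} : Diff.mk a b < Diff.mk c d ↔ a + d < c + b := by
  rw [← not_le, ← not_le, Diff.mk_le]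

/-- The purpose of the ring of differences: `linarith` and `nlinarith` can be applied to
inequalities between numbers after transfer to an ordered ring. -/
instance [ExistsAddOfLE R] : IsStrictOrderedRing (Diff R) := by
  have : IsOrderedAddMonoid (Diff R) :=
    { add_le_add_left := fun x y h z => by
        induction x using Diff.ind; induction y using Diff.ind; induction z using Diff.ind
        simp only [Diff.mk_le, Diff.mk_add] at h ⊢
        grind }
  have : Nontrivial (Diff R) := ⟨0, 1, fun h => by
    simpa using Diff.mk_eq.1 (h : Diff.mk (0 : R) 0 = Diff.mk 1 0)⟩
  have : ZeroLEOneClass (Diff R) := ⟨Diff.mk_le.2 (by simp)⟩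
  refine .of_mul_pos fun x y hx hy => ?_
  induction x using Diff.ind with | h a b => ?_
  induction y using Diff.ind with | h c d => ?_
  simp only [Diff.zero_def, Diff.mk_lt, Diff.mk_mul, zero_add, add_zero] at hx hy ⊢
  simpa only [add_comm] using mul_add_mul_lt_mul_add_mul hx hy

/-- The embedding of a semiring into its ring of differences. -/
def Diff.of (a : R) : Diff R := Diff.mk a 0

theorem Diff.of_inj {a b : R} : Diff.of a = Diff.of b ↔ a = b := by
  simp [Diff.of, Diff.mk_eq]

theorem Diff.of_le {a b : R} : Diff.of a ≤ Diff.of b ↔ a ≤ b := by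
  simp [Diff.of, Diff.mk_le]

theorem Diff.of_lt {a b : R} : Diff.of a < Diff.of b ↔ a < b := by
  simp [Diff.of, Diff.mk_lt]

theorem Diff.of_add (a b : R) : Diff.of (a + b) = Diff.of a + Diff.of b := by
  simp [Diff.of, Diff.mk_add]

theorem Diff.of_mul (a b : R) : Diff.of (a * b) = Diff.of a * Diff.of b := by
  simp [Diff.of, Diff.mk_mul]

theorem Diff.of_zero : Diff.of (0 : R) = 0 := rfl

theorem Diff.of_one : Diff.of (1 : R) = 1 := rfl

theorem Diff.of_ofNat (n : ℕ) [n.AtLeastTwo] :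
    Diff.of (ofNat(n) : R) = ofNat(n) := by
  change Diff.of ((OfNat.ofNat n : ℕ) : R) = ((OfNat.ofNat n : ℕ) : Diff R)
  generalize OfNat.ofNat n = k
  induction k with
  | zero => simp [Diff.of_zero]
  | succ k h => push_cast; rw [Diff.of_add, h, Diff.of_one]

end Differences

section

variable {M : SecondOrderStructure.{u}} [M.RCA]

theorem Diff.of_nonneg (a : M.Num) : 0 ≤ Diff.of a := Diff.of_le.2 zero_le

/-- The order is discrete. Stating strict inequalities with `+ 1` passes this information on to
linear arithmetic. -/
theorem Diff.lt_iff (a b : M.Num) : a < b ↔ Diff.of a + 1 ≤ Diff.of b := by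
  rw [← SecondOrderStructure.num_succ_le, ← Diff.of_le, Diff.of_add, Diff.of_one]

/-- Rewrite rules that turn statements about numbers into statements about differences. -/
theorem Diff.transfer : (∀ a b : M.Num, a < b ↔ Diff.of a + 1 ≤ Diff.of b) ∧
    (∀ a b : M.Num, a ≤ b ↔ Diff.of a ≤ Diff.of b) ∧
    (∀ a b : M.Num, a = b ↔ Diff.of a = Diff.of b) ∧
    (∀ a b : M.Num, Diff.of (a + b) = Diff.of a + Diff.of b) ∧
    (∀ a b : M.Num, Diff.of (a * b) = Diff.of a * Diff.of b) ∧
    Diff.of (0 : M.Num) = 0 ∧ Diff.of (1 : M.Num) = 1 ∧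
    ∀ (n : ℕ) [n.AtLeastTwo], Diff.of (ofNat(n) : M.Num) = ofNat(n) :=
  ⟨Diff.lt_iff, fun _ _ => Diff.of_le.symm, fun _ _ => Diff.of_inj.symm, Diff.of_add, Diff.of_mul,
    Diff.of_zero, Diff.of_one, fun n _ => Diff.of_ofNat n⟩

end

namespace SecondOrderStructure

/-! ## Closure properties of definable predicates and functions -/

section Closure

variable {M : SecondOrderStructure.{u}} {n m : ℕ}

theorem poly_ext {g : Fin n → (Fin m → M.Num) → M.Num} (hg : ∀ i, Poly M (g i))
    {t : (Fin m → M.Num) → M.Num} (ht : Poly M t) (i : Fin (n + 1)) :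
    Poly M (fun w => ext (fun i => g i w) (t w) i) := by
  refine Fin.lastCases ?_ (fun j => ?_) i
  · simpa [ext] using ht
  · simpa [ext] using hg j

theorem Bounded.substExt {Q : (Fin (n + 1) → M.Num) → Prop} (hQ : Bounded M (n + 1) Q)
    {g : Fin n → (Fin m → M.Num) → M.Num} (hg : ∀ i, Poly M (g i))
    {t : (Fin m → M.Num) → M.Num} (ht : Poly M t) :
    Bounded M m (fun w => Q (ext (fun i => g i w) (t w))) :=
  hQ.subst _ (poly_ext hg ht)

theorem Sig.subst {P : (Fin n → M.Num) → Prop} (hP : Sig M P)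
    (g : Fin n → (Fin m → M.Num) → M.Num) (hg : ∀ i, Poly M (g i)) :
    Sig M (fun v => P (fun i => g i v)) := by
  obtain ⟨Q, hQ, h⟩ := hP.out
  refine ⟨_, hQ.substExt (fun i => (hg i).weaken) (.var (Fin.last m)), fun v => ?_⟩
  simp [h, ext]

variable [RCA M]

/-- Two unbounded witnesses are contracted to a single one that bounds both. `Sig.exSnoc` uses the
same device. -/
instance Sig.and {P Q : (Fin n → M.Num) → Prop} [hP : Sig M P] [hQ : Sig M Q] :
    Sig M (fun v => P v ∧ Q v) := by
  obtain ⟨P', hP, h⟩ := hP.out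
  obtain ⟨Q', hQ, h'⟩ := hQ.out
  refine ⟨fun w => (∃ a, a < w (Fin.last n) ∧ P' (ext (fun i => w i.castSucc) a)) ∧
      ∃ a, a < w (Fin.last n) ∧ Q' (ext (fun i => w i.castSucc) a),
    .and (.bex (.var _) (hP.substExt (fun i => .var _) (.var _)))
      (.bex (.var _) (hQ.substExt (fun i => .var _) (.var _))), fun v => ?_⟩
  simp only [h, h', ext, Fin.snoc_last, Fin.snoc_castSucc]
  constructor
  · rintro ⟨⟨a, ha⟩, b, hb⟩
    exact ⟨max a b + 1, ⟨a, num_lt_succ.2 (le_max_left _ _), ha⟩,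
      b, num_lt_succ.2 (le_max_right _ _), hb⟩
  · rintro ⟨c, ⟨a, -, ha⟩, b, -, hb⟩
    exact ⟨⟨a, ha⟩, b, hb⟩

instance Sig.or {P Q : (Fin n → M.Num) → Prop} [hP : Sig M P] [hQ : Sig M Q] :
    Sig M (fun v => P v ∨ Q v) := by
  obtain ⟨P', hP, h⟩ := hP.out
  obtain ⟨Q', hQ, h'⟩ := hQ.out
  exact ⟨_, hP.or hQ, fun v => by rw [h, h', exists_or]⟩

theorem Sig.exSnoc {P : (Fin (n + 1) → M.Num) → Prop} (hP : Sig M P) :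
    Sig M (fun v => ∃ a, P (ext v a)) := by
  obtain ⟨P', hP, h⟩ := hP.out
  refine ⟨fun w => ∃ a, a < w (Fin.last n) ∧ ∃ b, b < w (Fin.last n) ∧
      P' (ext (ext (fun i => w i.castSucc) a) b),
    .bex (.var _) (.bex (.var (Fin.last n).castSucc) (hP.substExt
      (poly_ext (fun i => .var _) (.var (Fin.last (n + 1)).castSucc)) (.var _))), fun v => ?_⟩
  simp only [h, ext, Fin.snoc_last, Fin.snoc_castSucc]
  constructor
  · rintro ⟨a, b, hb⟩
    exact ⟨max a b + 1, a, num_lt_succ.2 (le_max_left _ _),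
      b, num_lt_succ.2 (le_max_right _ _), hb⟩
  · rintro ⟨c, a, -, b, -, hb⟩
    exact ⟨a, b, hb⟩

instance Sig.ex {P : (Fin n → M.Num) → M.Num → Prop}
    [hP : Sig M (fun w : Fin (n + 1) → M.Num => P (fun i => w i.castSucc) (w (Fin.last n)))] :
    Sig M (fun v => ∃ a, P v a) :=
  hP.exSnoc.congr fun v => by simp [ext]

/-- Σ⁰₁ bounding follows from Σ⁰₁ induction on the length of the segment that is already bounded. It
is the reason why Σ⁰₁ predicates are closed under bounded universal quantifiers. -/
theorem collection {R : M.Num → M.Num → Prop}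
    (hR : Bounded M 2 (fun v => R (v 0) (v 1))) (c : M.Num) (h : ∀ a, a < c → ∃ b, R a b) :
    ∃ z, ∀ a, a < c → ∃ b, b < z ∧ R a b := by
  have key : ∀ d, ∃ z, ∀ a, a < d → a < c → ∃ b, b < z ∧ R a b := by
    intro d
    induction d using sig_induction with
    | hP =>
      refine ⟨fun w => ∀ a, a < w 0 → a < c → ∃ b, b < w 1 ∧ R a b, .ball (.var _)
        (.imp (.lt (.var _) (.const _)) (.bex (.var (Fin.castSucc 1)) ?_)), fun v => ?_⟩
      · exact hR.subst ![fun w => w (Fin.castSucc (Fin.last 2)), fun w => w (Fin.last 3)]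
          (fun i => by fin_cases i <;> exact .var _)
      · rfl
    | h0 => exact ⟨0, fun a ha => (basic.not_lt_zero _ ha).elim⟩
    | hs d hd =>
      obtain ⟨z, hz⟩ := hd
      by_cases hdc : d < c
      · obtain ⟨b, hb⟩ := h d hdc
        refine ⟨max z (b + 1), fun a ha hac => ?_⟩
        rcases (num_lt_succ.1 ha).lt_or_eq with ha | rfl
        · obtain ⟨b', hb', h'⟩ := hz a ha hac
          exact ⟨b', lt_max_of_lt_left hb', h'⟩
        · exact ⟨b, lt_max_of_lt_right (num_lt_succ_self _), hb⟩
      · refine ⟨z, fun a ha hac => hz a ?_ hac⟩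
        exact (num_lt_succ.1 ha).lt_of_ne (by rintro rfl; exact hdc hac)
  obtain ⟨z, hz⟩ := key c
  exact ⟨z, fun a ha => hz a ha ha⟩

theorem Sig.ballPoly {t : (Fin n → M.Num) → M.Num} (ht : Poly M t)
    {P : (Fin n → M.Num) → M.Num → Prop}
    (hP : Sig M (fun w : Fin (n + 1) → M.Num => P (fun i => w i.castSucc) (w (Fin.last n)))) :
    Sig M (fun v => ∀ a, a < t v → P v a) := by
  obtain ⟨P', hP, h⟩ := hP.out
  refine ⟨fun w => ∀ a, a < t (fun i => w i.castSucc) → ∃ b, b < w (Fin.last n) ∧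
      P' (ext (ext (fun i => w i.castSucc) a) b),
    .ball ht.weaken (.bex (.var (Fin.last n).castSucc) (hP.substExt
      (poly_ext (fun i => .var _) (.var (Fin.last (n + 1)).castSucc)) (.var _))), fun v => ?_⟩
  have h' : ∀ a, P v a ↔ ∃ b, P' (ext (ext v a) b) := fun a => by
    rw [← h]; simp [ext]
  simp only [h']
  simp only [ext, Fin.snoc_last, Fin.snoc_castSucc]
  constructor
  · exact collection (R := fun a b => P' (ext (ext v a) b))
      (hP.substExt (poly_ext (fun i => .const _) (.var _)) (.var _)) _
  · rintro ⟨z, hz⟩ a ha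
    obtain ⟨b, -, hb⟩ := hz a ha
    exact ⟨b, hb⟩

/-- Functions with a `Σ⁰₁` definable graph. -/
class Rec (M : SecondOrderStructure.{u}) {n : ℕ} (f : (Fin n → M.Num) → M.Num) : Prop where
  graph : Sig M (fun w : Fin (n + 1) → M.Num => f (fun i => w i.castSucc) = w (Fin.last n))

theorem Poly.toRec {f : (Fin n → M.Num) → M.Num} (hf : Poly M f) : Rec M f :=
  ⟨(Bounded.eq hf.weaken (.var _)).sig⟩

instance Rec.var (i : Fin n) : Rec M (fun v : Fin n → M.Num => v i) := (Poly.var i).toRec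

instance Rec.const (a : M.Num) : Rec M (fun _ : Fin n → M.Num => a) := (Poly.const a).toRec

theorem Rec.weaken {f : (Fin n → M.Num) → M.Num} (hf : Rec M f) :
    Rec M (fun v : Fin (n + 1) → M.Num => f (fun i => v i.castSucc)) :=
  ⟨(hf.graph.subst (fun i v => ext (fun j : Fin n => v j.castSucc.castSucc)
    (v (Fin.last (n + 1))) i) (poly_ext (fun i => .var _) (.var _))).congr fun v => by simp [ext]⟩

/-- The value is described through its graph: some `a` equals `f v` and satisfies the predicate. -/
theorem Sig.compExt {P : (Fin (n + 1) → M.Num) → Prop} (hP : Sig M P)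
    {f : (Fin n → M.Num) → M.Num} (hf : Rec M f) : Sig M (fun v => P (ext v (f v))) := by
  have := hf.graph
  exact (Sig.and (P := fun w : Fin (n + 1) → M.Num => f (fun i => w i.castSucc) = w (Fin.last n))
    (Q := P)).exSnoc.congr fun v => by simp [ext]

theorem Sig.comp {k : ℕ} {P : (Fin k → M.Num) → Prop} (hP : Sig M P)
    (f : Fin k → (Fin n → M.Num) → M.Num) (hf : ∀ i, Rec M (f i)) :
    Sig M (fun v => P (fun i => f i v)) := by
  -- Induction on a bound `j` for the coordinates that may fail to be polynomial. The coordinate `j`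
  -- is replaced by a fresh variable, and its function is put back by `Sig.compExt`.
  have key : ∀ j : ℕ, ∀ (n : ℕ) (f : Fin k → (Fin n → M.Num) → M.Num), (∀ i, Rec M (f i)) →
      (∀ i : Fin k, j ≤ i → Poly M (f i)) → Sig M (fun v => P (fun i => f i v)) := by
    intro j
    induction j with
    | zero => exact fun n f _ h => hP.subst f fun i => h i (Nat.zero_le _)
    | succ j ih =>
      intro n f hf h
      by_cases hj : j < k
      · have := (ih (n + 1) (fun i w => if (i : ℕ) = j then w (Fin.last n) else
          f i (fun l => w l.castSucc)) (fun i => ?_) (fun i hi => ?_)).compExt (hf ⟨j, hj⟩)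
        · refine this.congr fun v => iff_of_eq (congrArg P (funext fun i => ?_))
          by_cases hi : (i : ℕ) = j
          · obtain rfl : i = ⟨j, hj⟩ := Fin.ext hi
            simp [ext]
          · simp [ext, hi]
        · by_cases hi : (i : ℕ) = j
          · simpa only [hi, if_true] using Rec.var (Fin.last n)
          · simpa only [hi, if_false] using (hf i).weaken
        · by_cases hi' : (i : ℕ) = j
          · simpa only [hi', if_true] using Poly.var (Fin.last n)
          · simpa only [hi', if_false] using (h i (by omega)).weaken
      · exact ih n f hf fun i hi => absurd i.2 (by omega)
  exact key k n f hf fun i hi => absurd i.2 (by omega)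

theorem Sig.comp₂ {P : M.Num → M.Num → Prop} (hP : Sig M (fun v : Fin 2 → M.Num => P (v 0) (v 1)))
    (f g : (Fin n → M.Num) → M.Num) [hf : Rec M f] [hg : Rec M g] :
    Sig M (fun v => P (f v) (g v)) :=
  hP.comp ![f, g] fun i => by fin_cases i <;> assumption

instance Sig.eq {f g : (Fin n → M.Num) → M.Num} [Rec M f] [Rec M g] :
    Sig M (fun v => f v = g v) :=
  Sig.comp₂ (Bounded.eq (.var _) (.var _)).sig f g

instance Sig.ne {f g : (Fin n → M.Num) → M.Num} [Rec M f] [Rec M g] :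
    Sig M (fun v => ¬ f v = g v) :=
  Sig.comp₂ (P := fun x y => ¬ x = y) (Bounded.not (.eq (.var _) (.var _))).sig f g

instance Sig.lt {f g : (Fin n → M.Num) → M.Num} [Rec M f] [Rec M g] :
    Sig M (fun v => f v < g v) :=
  Sig.comp₂ (Bounded.lt (.var _) (.var _)).sig f g

instance Sig.ball {t : (Fin n → M.Num) → M.Num} [ht : Rec M t]
    {P : (Fin n → M.Num) → M.Num → Prop}
    [hP : Sig M (fun w : Fin (n + 1) → M.Num => P (fun i => w i.castSucc) (w (Fin.last n)))] :
    Sig M (fun v => ∀ a, a < t v → P v a) := by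
  -- The bound is first treated as a variable, to which collection applies, and then replaced by the
  -- function `t`.
  have h : Sig M (fun w : Fin (n + 1) → M.Num =>
      ∀ a, a < w (Fin.last n) → P (fun i => w i.castSucc) a) := by
    refine Sig.ballPoly (.var _) ((hP.subst (fun i w => ext (fun j : Fin n => w j.castSucc.castSucc)
      (w (Fin.last (n + 1))) i) (poly_ext (fun i => .var _) (.var _))).congr fun v => ?_)
    simp [ext]
  exact (h.compExt ht).congr fun v => by simp [ext]

/-- `Δ⁰₁` definable predicates of tuples, with parameters. -/
class Dl (M : SecondOrderStructure.{u}) {n : ℕ} (P : (Fin n → M.Num) → Prop) : Prop where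
  sig : Sig M P
  sig_not : Sig M (fun v => ¬ P v)

instance (priority := low) Dl.toSig {P : (Fin n → M.Num) → Prop} [h : Dl M P] : Sig M P := h.sig

theorem Dl.congr {P Q : (Fin n → M.Num) → Prop} (hP : Dl M P) (h : ∀ v, Q v ↔ P v) : Dl M Q := by
  rwa [show Q = P from funext fun v => propext (h v)]

instance Dl.eq {f g : (Fin n → M.Num) → M.Num} [Rec M f] [Rec M g] :
    Dl M (fun v => f v = g v) := ⟨inferInstance, inferInstance⟩

instance Dl.lt {f g : (Fin n → M.Num) → M.Num} [Rec M f] [Rec M g] :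
    Dl M (fun v => f v < g v) :=
  ⟨inferInstance, (Sig.or (P := fun v => g v < f v) (Q := fun v => g v = f v)).congr fun v => by
    rw [not_lt, le_iff_lt_or_eq]⟩

instance Dl.not {P : (Fin n → M.Num) → Prop} [hP : Dl M P] : Dl M (fun v => ¬ P v) :=
  ⟨hP.sig_not, hP.sig.congr fun _ => not_not⟩

instance Dl.and {P Q : (Fin n → M.Num) → Prop} [hP : Dl M P] [hQ : Dl M Q] :
    Dl M (fun v => P v ∧ Q v) :=
  have := hP.sig_not
  have := hQ.sig_not
  ⟨inferInstance, (Sig.or (P := fun v => ¬ P v) (Q := fun v => ¬ Q v)).congr fun v => by tauto⟩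

instance Dl.or {P Q : (Fin n → M.Num) → Prop} [hP : Dl M P] [hQ : Dl M Q] :
    Dl M (fun v => P v ∨ Q v) :=
  have := hP.sig_not
  have := hQ.sig_not
  ⟨inferInstance, (Sig.and (P := fun v => ¬ P v) (Q := fun v => ¬ Q v)).congr fun v => by tauto⟩

instance Dl.imp {P Q : (Fin n → M.Num) → Prop} [hP : Dl M P] [hQ : Dl M Q] :
    Dl M (fun v => P v → Q v) :=
  (Dl.or (P := fun v => ¬ P v) (Q := Q)).congr fun v => by tauto

instance Dl.iff {P Q : (Fin n → M.Num) → Prop} [hP : Dl M P] [hQ : Dl M Q] :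
    Dl M (fun v => P v ↔ Q v) :=
  (Dl.and (P := fun v => P v → Q v) (Q := fun v => Q v → P v)).congr fun v => by tauto

instance Sig.imp {P Q : (Fin n → M.Num) → Prop} [hP : Dl M P] [hQ : Sig M Q] :
    Sig M (fun v => P v → Q v) :=
  have := hP.sig_not
  (Sig.or (P := fun v => ¬ P v) (Q := Q)).congr fun v => by tauto

instance Dl.mem {f : (Fin n → M.Num) → M.Num} [hf : Rec M f] (X : M.sets) :
    Dl M (fun v => f v ∈ (X : Set M.Num)) :=
  ⟨Sig.comp₂ (P := fun x _ => x ∈ (X : Set M.Num)) (Bounded.mem X (.var 0)).sig f f,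
    Sig.comp₂ (P := fun x _ => ¬ x ∈ (X : Set M.Num)) (Bounded.not (.mem X (.var 0))).sig f f⟩

instance Dl.ball {t : (Fin n → M.Num) → M.Num} [ht : Rec M t]
    {P : (Fin n → M.Num) → M.Num → Prop}
    [hP : Dl M (fun w : Fin (n + 1) → M.Num => P (fun i => w i.castSucc) (w (Fin.last n)))] :
    Dl M (fun v => ∀ a, a < t v → P v a) :=
  have := hP.sig_not
  have := ht.weaken
  ⟨inferInstance, (Sig.ex (P := fun v a => a < t v ∧ ¬ P v a)).congr fun v => by
    push Not; rfl⟩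

instance Dl.bex {t : (Fin n → M.Num) → M.Num} [ht : Rec M t]
    {P : (Fin n → M.Num) → M.Num → Prop}
    [hP : Dl M (fun w : Fin (n + 1) → M.Num => P (fun i => w i.castSucc) (w (Fin.last n)))] :
    Dl M (fun v => ∃ a, a < t v ∧ P v a) :=
  (Dl.not (P := fun v => ∀ a, a < t v → ¬ P v a)).congr fun v => by push Not; rfl

theorem Rec.of_graph {f : (Fin n → M.Num) → M.Num} (P : (Fin n → M.Num) → M.Num → Prop)
    [hP : Sig M (fun w : Fin (n + 1) → M.Num => P (fun i => w i.castSucc) (w (Fin.last n)))]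
    (h : ∀ v a, f v = a ↔ P v a) : Rec M f :=
  ⟨hP.congr fun _ => h _ _⟩

theorem Rec.comp {k : ℕ} {F : (Fin k → M.Num) → M.Num} (hF : Rec M F)
    (f : Fin k → (Fin n → M.Num) → M.Num) (hf : ∀ i, Rec M (f i)) :
    Rec M (fun v => F (fun i => f i v)) := by
  refine ⟨(hF.graph.comp (fun i v => ext (fun j => f j (fun l => v l.castSucc)) (v (Fin.last n)) i)
    fun i => ?_).congr fun v => by simp [ext]⟩
  refine Fin.lastCases ?_ (fun j => ?_) i
  · simpa [ext] using Rec.var (Fin.last n)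
  · simpa [ext] using (hf j).weaken

theorem Dl.comp {k : ℕ} {P : (Fin k → M.Num) → Prop} (hP : Dl M P)
    (f : Fin k → (Fin n → M.Num) → M.Num) (hf : ∀ i, Rec M (f i)) :
    Dl M (fun v => P (fun i => f i v)) :=
  ⟨hP.sig.comp f hf, hP.sig_not.comp f hf⟩

/-- Definable functions of one argument. -/
class Rec₁ (F : M.Num → M.Num) : Prop where
  out : Rec M (fun v : Fin 1 → M.Num => F (v 0))

/-- Definable functions of two arguments. -/
class Rec₂ (F : M.Num → M.Num → M.Num) : Prop where
  out : Rec M (fun v : Fin 2 → M.Num => F (v 0) (v 1))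

/-- Definable functions of three arguments. -/
class Rec₃ (F : M.Num → M.Num → M.Num → M.Num) : Prop where
  out : Rec M (fun v : Fin 3 → M.Num => F (v 0) (v 1) (v 2))

/-- Definable functions of four arguments. -/
class Rec₄ (F : M.Num → M.Num → M.Num → M.Num → M.Num) : Prop where
  out : Rec M (fun v : Fin 4 → M.Num => F (v 0) (v 1) (v 2) (v 3))

/-- Decidable predicates of one argument. -/
class Dl₁ (P : M.Num → Prop) : Prop where
  out : Dl M (fun v : Fin 1 → M.Num => P (v 0))

/-- Decidable predicates of two arguments. -/
class Dl₂ (P : M.Num → M.Num → Prop) : Prop where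
  out : Dl M (fun v : Fin 2 → M.Num => P (v 0) (v 1))

instance (priority := low) Rec₁.comp {F : M.Num → M.Num} [hF : Rec₁ F]
    {f : (Fin n → M.Num) → M.Num} [Rec M f] : Rec M (fun v => F (f v)) :=
  hF.out.comp ![f] fun i => by fin_cases i; assumption

instance (priority := low) Rec₂.comp {F : M.Num → M.Num → M.Num} [hF : Rec₂ F]
    {f g : (Fin n → M.Num) → M.Num} [Rec M f] [Rec M g] : Rec M (fun v => F (f v) (g v)) :=
  hF.out.comp ![f, g] fun i => by fin_cases i <;> assumption

instance (priority := low) Rec₃.comp {F : M.Num → M.Num → M.Num → M.Num} [hF : Rec₃ F]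
    {f g h : (Fin n → M.Num) → M.Num} [Rec M f] [Rec M g] [Rec M h] :
    Rec M (fun v => F (f v) (g v) (h v)) :=
  hF.out.comp ![f, g, h] fun i => by fin_cases i <;> assumption

instance (priority := low) Rec₄.comp {F : M.Num → M.Num → M.Num → M.Num → M.Num} [hF : Rec₄ F]
    {f g h k : (Fin n → M.Num) → M.Num} [Rec M f] [Rec M g] [Rec M h] [Rec M k] :
    Rec M (fun v => F (f v) (g v) (h v) (k v)) :=
  hF.out.comp ![f, g, h, k] fun i => by fin_cases i <;> assumption

instance (priority := low) Dl₁.comp {P : M.Num → Prop} [hP : Dl₁ P]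
    {f : (Fin n → M.Num) → M.Num} [Rec M f] : Dl M (fun v => P (f v)) :=
  hP.out.comp ![f] fun i => by fin_cases i; assumption

instance (priority := low) Dl₂.comp {P : M.Num → M.Num → Prop} [hP : Dl₂ P]
    {f g : (Fin n → M.Num) → M.Num} [Rec M f] [Rec M g] : Dl M (fun v => P (f v) (g v)) :=
  hP.out.comp ![f, g] fun i => by fin_cases i <;> assumption

instance : Rec₂ (M := M) (fun x y => x + y) := ⟨(Poly.add (.var _) (.var _)).toRec⟩
instance : Rec₂ (M := M) (fun x y => x * y) := ⟨(Poly.mul (.var _) (.var _)).toRec⟩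

instance Rec.add {f g : (Fin n → M.Num) → M.Num} [Rec M f] [Rec M g] :
    Rec M (fun v => f v + g v) :=
  Rec₂.comp (F := fun x y => x + y)

instance Rec.mul {f g : (Fin n → M.Num) → M.Num} [Rec M f] [Rec M g] :
    Rec M (fun v => f v * g v) :=
  Rec₂.comp (F := fun x y => x * y)

instance Rec.ite {P : (Fin n → M.Num) → Prop} [∀ v, Decidable (P v)]
    {f g : (Fin n → M.Num) → M.Num} [hP : Dl M P] [hf : Rec M f] [hg : Rec M g] :
    Rec M (fun v => if P v then f v else g v) := by
  have := hf.graph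
  have := hg.graph
  have : Dl M (fun w : Fin (n + 1) → M.Num => P (fun i => w i.castSucc)) :=
    hP.comp _ fun i => inferInstance
  refine .of_graph (fun v a => P v ∧ f v = a ∨ ¬ P v ∧ g v = a) fun v a => ?_
  split_ifs with h <;> simp [h]

instance Rec.sub {f g : (Fin n → M.Num) → M.Num} [hf : Rec M f] [hg : Rec M g] :
    Rec M (fun v => f v - g v) := by
  have : Rec₂ (M := M) (fun x y => x - y) := by
    refine ⟨.of_graph (fun v a => v 0 = v 1 + a ∨ v 0 < v 1 ∧ a = 0) fun v a => ?_⟩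
    rcases le_or_gt (v 1) (v 0) with h | h
    · rw [tsub_eq_iff_eq_add_of_le h, add_comm]
      simp [not_lt.2 h]
    · rw [tsub_eq_zero_of_le h.le]
      have : ¬ v 0 = v 1 + a := fun h' => not_le.2 h (h' ▸ le_self_add)
      simp [h, this, eq_comm]
  exact Rec₂.comp (F := fun x y => x - y)

/-- The quotient can be bounded by the dividend; if the divisor is zero, so is the dividend, and the
quotient zero suffices. -/
instance Dl.dvd {f g : (Fin n → M.Num) → M.Num} [hf : Rec M f] [hg : Rec M g] :
    Dl M (fun v => f v ∣ g v) := by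
  have := hf.weaken
  have := hg.weaken
  have h : Dl M (fun v => ∃ a, a < g v + 1 ∧ g v = f v * a) := inferInstance
  refine h.congr fun v => ?_
  constructor
  · rintro ⟨a, ha⟩
    by_cases h : f v = 0
    · exact ⟨0, num_lt_succ.2 zero_le, by rw [ha, h]; simp⟩
    · exact ⟨a, num_lt_succ.2 (ha ▸ le_mul_of_one_le_left zero_le
        (by rw [← zero_add (1 : M.Num), num_succ_le]; exact pos_iff_ne_zero.2 h)), ha⟩
  · rintro ⟨a, -, ha⟩
    exact ⟨a, ha⟩

/-! ### Induction, least elements and comprehension -/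

theorem strong_induction {P : M.Num → Prop} (hP : Dl M (fun v : Fin 1 → M.Num => P (v 0)))
    (h : ∀ n, (∀ k, k < n → P k) → P n) (n : M.Num) : P n := by
  have : Dl₁ P := ⟨hP⟩
  have key : ∀ n, ∀ k, k < n → P k := by
    intro n
    induction n using sig_induction with
    | hP => infer_instance
    | h0 => exact fun k hk => (basic.not_lt_zero _ hk).elim
    | hs n hn =>
      intro k hk
      rcases (num_lt_succ.1 hk).lt_or_eq with hk | rfl
      · exact hn k hk
      · exact h k hn
  exact key (n + 1) n (num_lt_succ_self n)

/-- A non-empty `Δ⁰₁` class has a least element. -/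
theorem exists_least {P : M.Num → Prop} (hP : Dl M (fun v : Fin 1 → M.Num => P (v 0)))
    (h : ∃ n, P n) : ∃ n, P n ∧ ∀ k, k < n → ¬ P k := by
  by_contra! h'
  obtain ⟨n, hn⟩ := h
  have : Dl₁ P := ⟨hP⟩
  refine strong_induction (P := fun n => ¬ P n) inferInstance (fun n ih hn => ?_) n hn
  obtain ⟨k, hk, hPk⟩ := h' n hn
  exact ih k hk hPk

/-- A non-empty `Σ⁰₁` class has a least element. -/
theorem sig_exists_least {P : M.Num → Prop} (hP : Sig M (fun v : Fin 1 → M.Num => P (v 0)))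
    (h : ∃ n, P n) : ∃ n, P n ∧ ∀ k, k < n → ¬ P k := by
  by_contra! h'
  obtain ⟨n, hn⟩ := h
  -- Without a least element one can descend any number `d` of times. This is Σ⁰₁ in `d`, and `d = n
  -- + 1` is absurd.
  have key : ∀ d, ∃ k, P k ∧ k + d ≤ n := by
    intro d
    induction d using sig_induction with
    | hP =>
      have : Sig M (fun v : Fin (1 + 1) → M.Num => P (v (Fin.last 1))) :=
        hP.subst (fun _ v => v 1) fun _ => .var _
      infer_instance
    | h0 => exact ⟨n, hn, by simp⟩
    | hs d hd =>
      obtain ⟨k, hk, hkd⟩ := hd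
      obtain ⟨l, hl, hPl⟩ := h' k hk
      refine ⟨l, hPl, ?_⟩
      have := num_succ_le.2 hl
      simp only [Diff.transfer] at *
      linarith
  obtain ⟨k, -, hk⟩ := key (n + 1)
  simp only [Diff.transfer] at *
  linarith [Diff.of_nonneg k]

/-- A Σ⁰₁ definition of the complement is negated to give the Π⁰₁ formula. The parameters of the two
formulas are placed in the consecutive blocks below `r` and from `r` on. -/
theorem comprehension {P : M.Num → Prop} (hP : Dl M (fun v : Fin 1 → M.Num => P (v 0))) :
    {n | P n} ∈ M.sets := by
  obtain ⟨P', hP', h'⟩ := hP.sig.out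
  obtain ⟨Q', hQ', h''⟩ := hP.sig_not.out
  obtain ⟨φ, r, p, E, hφ, hφ'⟩ := hP'.exists_formula 0
  obtain ⟨ψ, r', p', E', hψ, hψ'⟩ := hQ'.exists_formula r
  have e₂ : ∀ (e : ℕ → M.Num) a, (fun i : Fin (1 + 1) => Function.update e 2 a (2 * (i : ℕ))) =
      ext (fun i : Fin 1 => e (2 * (i : ℕ))) a := by
    intro e a
    funext i
    fin_cases i <;> simp [ext, Fin.snoc]
  have k₁ : ∀ n, M.Sat (Function.update (fun k => if k / 2 < r then p (k / 2) else p' (k / 2)) 0 n)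
      (fun k => if k < r then E k else E' k) (.ex 2 φ) ↔ P n := by
    intro n
    refine Iff.trans (exists_congr fun a => ?_) (h' fun _ => n).symm
    rw [hφ' _ _ fun k _ hk => ?_, e₂]
    · simp [ext]
    · rw [Function.update_of_ne (by omega), Function.update_of_ne (by omega)]
      rw [show (2 * k + 1) / 2 = k by omega, if_pos (by omega), if_pos (by omega)]
      exact ⟨rfl, rfl⟩
  have k₂ : ∀ n, M.Sat (Function.update (fun k => if k / 2 < r then p (k / 2) else p' (k / 2)) 0 n)
      (fun k => if k < r then E k else E' k) (.all 2 (.not ψ)) ↔ P n := by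
    intro n
    have := (h'' fun _ => n).not
    rw [not_not, not_exists] at this
    refine Iff.trans (forall_congr' fun a => ?_) this.symm
    rw [Sat, hψ' _ _ fun k hk hk' => ?_, e₂]
    · simp [ext]
    · rw [Function.update_of_ne (by omega), Function.update_of_ne (by omega)]
      rw [show (2 * k + 1) / 2 = k by omega, if_neg (by omega), if_neg (by omega)]
      exact ⟨rfl, rfl⟩
  obtain ⟨X, hX, h⟩ := (RCA.models (M := M)).comprehension _ _ ⟨2, φ, hφ, rfl⟩
    ⟨2, .not ψ, .not hψ, rfl⟩ 0 _ _ fun n => (k₁ n).trans (k₂ n).symm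
  rwa [show {n | P n} = X from Set.ext fun n => ((h n).trans (k₁ n)).symm]

end Closure

end SecondOrderStructure

namespace SecondOrderStructure

/-! ## Primitive recursion -/

section Recursion

variable {M : SecondOrderStructure.{u}} {n : ℕ} [RCA M]

instance Dl.bexLe {t : (Fin n → M.Num) → M.Num} [ht : Rec M t]
    {P : (Fin n → M.Num) → M.Num → Prop}
    [hP : Dl M (fun w : Fin (n + 1) → M.Num => P (fun i => w i.castSucc) (w (Fin.last n)))] :
    Dl M (fun v => ∃ a, a ≤ t v ∧ P v a) := by
  have h : Dl M (fun v => ∃ a, a < t v + 1 ∧ P v a) := inferInstance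
  exact h.congr fun v => by simp only [num_lt_succ]

instance : Rec₂ M.pair := ⟨by unfold pair; infer_instance⟩

/-- With s = i + j the code lies between s² and s² + s, and these intervals are disjoint for
different s. -/
theorem pair_inj {i j a b : M.Num} : M.pair i j = M.pair a b ↔ i = a ∧ j = b := by
  constructor
  · intro h
    have hs : i + j = a + b := by
      by_contra hs
      have := Diff.of_nonneg a
      have := Diff.of_nonneg b
      have := Diff.of_nonneg i
      have := Diff.of_nonneg j
      rcases lt_or_gt_of_ne hs with hs | hs <;>
      · simp only [pair, Diff.transfer] at *
        nlinarith
    simp only [pair, hs] at h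
    obtain rfl := add_left_cancel h
    exact ⟨rfl, add_left_cancel hs⟩
  · rintro ⟨rfl, rfl⟩
    rfl

theorem left_le_pair (i j : M.Num) : i ≤ M.pair i j := le_add_self

theorem right_le_pair (i j : M.Num) : j ≤ M.pair i j := by
  have := Diff.of_nonneg i
  have hj := Diff.of_nonneg j
  simp only [pair, Diff.transfer]
  rcases eq_or_lt_of_le hj with h | h
  · rw [← h]
    nlinarith
  · have h' := (Diff.of_lt (a := 0) (b := j)).1 h
    simp only [Diff.transfer] at h'
    nlinarith

theorem num_dvd_cancel {a b c : M.Num} (h : a ∣ b + c) (hb : a ∣ b) : a ∣ c := by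
  obtain ⟨x, hx⟩ := h
  obtain ⟨y, rfl⟩ := hb
  rcases le_total y x with h | h
  · obtain ⟨z, rfl⟩ := exists_add_of_le h
    rw [mul_add] at hx
    exact ⟨z, add_left_cancel hx⟩
  · have : a * x ≤ a * y := mul_le_mul_right h a
    have : c = 0 := by
      have hc := Diff.of_nonneg c
      simp only [Diff.transfer] at *
      linarith
    simp [this]

/-- The number `m * (k + 1) + 1` has no common divisors with `m`. -/
theorem dvd_of_dvd_mul_base {m k X : M.Num} (h : m * (k + 1) + 1 ∣ X * m) :
    m * (k + 1) + 1 ∣ X := by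
  have h' : m * (k + 1) + 1 ∣ X * (m * (k + 1)) + X := ⟨X, by ring⟩
  refine num_dvd_cancel h' ?_
  rw [← mul_assoc]
  exact h.mul_right _

/-- The two moduli differ by `m * (d + 1)` with `d < K`. The factor `m` can be cancelled by
`dvd_of_dvd_mul_base`; since `d + 1` divides `m`, the factor `d + 1` can be completed to `m` and
cancelled in the same way. No prime factors are needed. -/
theorem dvd_of_dvd_mul_other {m K i j X : M.Num} (hm : ∀ d, d < K → d + 1 ∣ m) (hi : i < K)
    (hj : j < K) (hij : i ≠ j) (h : m * (i + 1) + 1 ∣ X * (m * (j + 1) + 1)) :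
    m * (i + 1) + 1 ∣ X := by
  have key : ∃ d, d < K ∧ m * (i + 1) + 1 ∣ X * (d + 1) * m := by
    rcases lt_or_gt_of_ne hij with hij | hij
    · obtain ⟨d, rfl⟩ := exists_add_of_le (num_succ_le.2 hij)
      refine ⟨d, lt_of_le_of_lt le_add_self hj, ?_⟩
      have e : X * (m * (i + 1 + d + 1) + 1) = X * (m * (i + 1) + 1) + X * (d + 1) * m := by ring
      rw [e] at h
      exact num_dvd_cancel h (dvd_mul_left _ _)
    · obtain ⟨d, rfl⟩ := exists_add_of_le (num_succ_le.2 hij)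
      refine ⟨d, lt_of_le_of_lt le_add_self hi, ?_⟩
      have e : X * (m * (j + 1) + 1) + X * (d + 1) * m = X * (m * (j + 1 + d + 1) + 1) := by ring
      exact num_dvd_cancel (e ▸ dvd_mul_left _ _) h
  obtain ⟨d, hd, h⟩ := key
  obtain ⟨t, ht⟩ := hm d hd
  refine dvd_of_dvd_mul_base (X := X) ?_
  rw [ht, ← mul_assoc, ← ht]
  exact (dvd_of_dvd_mul_base h).mul_right t

/-- Finite sets can be coded by numbers. -/
theorem exists_code {P : M.Num → Prop} (hP : Dl M (fun v : Fin 1 → M.Num => P (v 0)))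
    (K : M.Num) : ∃ m n, ∀ k, k < K → (m * (k + 1) + 1 ∣ n ↔ P k) := by
  have : Dl₁ P := ⟨hP⟩
  -- `m` plays the role of the factorial of `K`.
  obtain ⟨m, hm0, hm⟩ : ∃ m, ¬ m = 0 ∧ ∀ d, d < K → d + 1 ∣ m := by
    induction K using sig_induction with
    | hP => infer_instance
    | h0 => exact ⟨1, one_ne_zero, fun d hd => (basic.not_lt_zero _ hd).elim⟩
    | hs K h =>
      obtain ⟨m, hm0, hm⟩ := h
      refine ⟨m * (K + 1), mul_ne_zero hm0 (basic.succ_ne_zero K), fun d hd => ?_⟩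
      rcases (num_lt_succ.1 hd).lt_or_eq with hd | rfl
      · exact (hm d hd).mul_right _
      · exact dvd_mul_left _ _
  -- `n` is the product of the moduli `m * (k + 1) + 1` over those `k < K` below `j` that satisfy
  -- `P`.
  have key : ∀ j, ∃ n, ∀ k, k < K → (m * (k + 1) + 1 ∣ n ↔ k < j ∧ P k) := by
    intro j
    induction j using sig_induction with
    | hP => infer_instance
    | h0 =>
      refine ⟨1, fun k _ => iff_of_false ?_ fun h => basic.not_lt_zero _ h.1⟩
      rintro ⟨c, hc⟩
      have hm' := pos_iff_ne_zero.2 hm0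
      have hc' : 0 < c := pos_iff_ne_zero.2 fun h => by simp [h] at hc
      have := Diff.of_nonneg k
      simp only [Diff.transfer] at *
      nlinarith [mul_nonneg (sub_nonneg.2 hm') this, mul_nonneg (sub_nonneg.2 hc') this]
    | hs j h =>
      obtain ⟨n, hn⟩ := h
      by_cases hj : j < K ∧ P j
      · refine ⟨n * (m * (j + 1) + 1), fun k hk => ?_⟩
        by_cases hkj : k = j
        · subst hkj
          exact iff_of_true (dvd_mul_left _ _) ⟨num_lt_succ_self _, hj.2⟩
        · rw [num_lt_succ, le_iff_lt_or_eq, or_iff_left hkj, ← hn k hk]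
          exact ⟨dvd_of_dvd_mul_other hm hk hj.1 hkj, fun h => h.mul_right _⟩
      · refine ⟨n, fun k hk => ?_⟩
        rw [hn k hk, num_lt_succ, le_iff_lt_or_eq]
        constructor
        · exact fun h => ⟨.inl h.1, h.2⟩
        · rintro ⟨h | rfl, h'⟩
          · exact ⟨h, h'⟩
          · exact (hj ⟨hk, h'⟩).elim
  obtain ⟨n, hn⟩ := key K
  exact ⟨m, n, fun k hk => by rw [hn k hk, and_iff_right hk]⟩

/-- The elements below `K` of the set with code `(m, n)` belong to the graph of the function that
is defined by recursion from `g` and `h`. -/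
def IsTrace (g : M.Num → M.Num → M.Num) (h : M.Num → M.Num → M.Num → M.Num → M.Num)
    (x y m n K : M.Num) : Prop :=
  ∀ k, k < K → m * (k + 1) + 1 ∣ n → k = M.pair 0 (g x y) ∨
    ∃ j, j < K ∧ ∃ a, a < K ∧ k = M.pair (j + 1) (h x y j a) ∧ M.pair j a < K ∧
      m * (M.pair j a + 1) + 1 ∣ n

/-- An entry at `j + 1` can only stem from an entry at `j` of the same trace. The bounds by `K` and
`K'` keep the claim Δ⁰₁, as the induction requires. -/
theorem IsTrace.unique {g : M.Num → M.Num → M.Num} {h : M.Num → M.Num → M.Num → M.Num → M.Num}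
    {x y m n K m' n' K' : M.Num} (H : IsTrace g h x y m n K) (H' : IsTrace g h x y m' n' K')
    (j : M.Num) : ∀ a, a < K → ∀ a', a' < K' → M.pair j a < K → m * (M.pair j a + 1) + 1 ∣ n →
      M.pair j a' < K' → m' * (M.pair j a' + 1) + 1 ∣ n' → a = a' := by
  induction j using sig_induction with
  | hP => infer_instance
  | h0 =>
    intro a _ a' _ h₁ h₂ h₃ h₄
    rcases H _ h₁ h₂ with e | ⟨j, _, b, _, e, _⟩
    · rcases H' _ h₃ h₄ with e' | ⟨j, _, b, _, e', _⟩
      · rw [(pair_inj.1 e).2, (pair_inj.1 e').2]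
      · exact (basic.succ_ne_zero _ (pair_inj.1 e').1.symm).elim
    · exact (basic.succ_ne_zero _ (pair_inj.1 e).1.symm).elim
  | hs j ih =>
    intro a _ a' _ h₁ h₂ h₃ h₄
    rcases H _ h₁ h₂ with e | ⟨i, _, b, hb, e, h₅, h₆⟩
    · exact (basic.succ_ne_zero _ (pair_inj.1 e).1).elim
    · rcases H' _ h₃ h₄ with e' | ⟨i', _, b', hb', e', h₇, h₈⟩
      · exact (basic.succ_ne_zero _ (pair_inj.1 e').1).elim
      · obtain ⟨e₁, e₂⟩ := pair_inj.1 e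
        obtain ⟨e₃, e₄⟩ := pair_inj.1 e'
        obtain rfl := add_right_cancel e₁
        obtain rfl := add_right_cancel e₃
        rw [e₂, e₄, ih b hb b' hb' h₅ h₆ h₇ h₈]

/-- Each value is witnessed by a coded finite trace. Traces exist by Σ⁰₁ induction, and since they
agree with each other, the function has a Σ⁰₁ graph. -/
theorem exists_recursion (g : M.Num → M.Num → M.Num) (h : M.Num → M.Num → M.Num → M.Num → M.Num)
    [Rec₂ g] [Rec₄ h] : ∃ F : M.Num → M.Num → M.Num → M.Num, Rec₃ F ∧ (∀ x y, F x y 0 = g x y) ∧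
      ∀ x y j, F x y (j + 1) = h x y j (F x y j) := by
  let W (x y j a : M.Num) : Prop := ∃ m n K, IsTrace g h x y m n K ∧ M.pair j a < K ∧
    m * (M.pair j a + 1) + 1 ∣ n
  have huniq : ∀ x y j a a', W x y j a → W x y j a' → a = a' := by
    rintro x y j a a' ⟨m, n, K, H, h₁, h₂⟩ ⟨m', n', K', H', h₃, h₄⟩
    exact H.unique H' j a ((right_le_pair _ _).trans_lt h₁) a' ((right_le_pair _ _).trans_lt h₃)
      h₁ h₂ h₃ h₄
  have hzero : ∀ x y, W x y 0 (g x y) := by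
    intro x y
    obtain ⟨m, n, hmn⟩ := exists_code (P := fun k => k = M.pair 0 (g x y)) inferInstance
      (M.pair 0 (g x y) + 1)
    exact ⟨m, n, _, fun k hk hk' => .inl ((hmn k hk).1 hk'), num_lt_succ_self _,
      (hmn _ (num_lt_succ_self _)).2 rfl⟩
  have hsucc : ∀ x y j a, W x y j a → W x y (j + 1) (h x y j a) := by
    rintro x y j a ⟨m, n, K, H, h₁, h₂⟩
    -- The finite set is coded anew, with the next pair of the recursion added.
    obtain ⟨m', n', hmn⟩ := exists_code (P := fun k => (k < K ∧ m * (k + 1) + 1 ∣ n) ∨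
      k = M.pair (j + 1) (h x y j a)) (by infer_instance) (max K (M.pair (j + 1) (h x y j a) + 1))
    have hK : ∀ {k}, k < K → k < max K (M.pair (j + 1) (h x y j a) + 1) := lt_max_of_lt_left
    refine ⟨m', n', max K _, fun k hk hk' => ?_, lt_max_of_lt_right (num_lt_succ_self _),
      (hmn _ (lt_max_of_lt_right (num_lt_succ_self _))).2 (.inr rfl)⟩
    rcases (hmn k hk).1 hk' with ⟨h₃, h₄⟩ | rfl
    · rcases H k h₃ h₄ with e | ⟨i, hi, b, hb, e, h₅, h₆⟩
      · exact .inl e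
      · exact .inr ⟨i, hK hi, b, hK hb, e, hK h₅, (hmn _ (hK h₅)).2 (.inl ⟨h₅, h₆⟩)⟩
    · exact .inr ⟨j, hK ((left_le_pair _ _).trans_lt h₁), a, hK ((right_le_pair _ _).trans_lt h₁),
        rfl, hK h₁, (hmn _ (hK h₁)).2 (.inl ⟨h₁, h₂⟩)⟩
  have hex : ∀ x y j, ∃ a, W x y j a := by
    intro x y j
    induction j using sig_induction with
    | hP => simp only [W, IsTrace]; infer_instance
    | h0 => exact ⟨_, hzero x y⟩
    | hs j ih =>
      obtain ⟨a, ha⟩ := ih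
      exact ⟨_, hsucc x y j a ha⟩
  choose F hF using hex
  have hW : Sig M (fun v : Fin 4 → M.Num => W (v 0) (v 1) (v 2) (v 3)) := by
    simp only [W, IsTrace]
    infer_instance
  refine ⟨F, ⟨.of_graph (hP := hW) (fun v a => W (v 0) (v 1) (v 2) a) fun v a => ?_⟩,
    fun x y => huniq _ _ _ _ _ (hF _ _ _) (hzero x y),
    fun x y j => huniq _ _ _ _ _ (hF _ _ _) (hsucc _ _ _ _ (hF _ _ _))⟩
  · exact ⟨fun e => e ▸ hF _ _ _, fun h => huniq _ _ _ _ _ (hF _ _ _) h⟩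

/-- The function that is defined by primitive recursion, with two parameters. -/
noncomputable def prec (g : M.Num → M.Num → M.Num) (h : M.Num → M.Num → M.Num → M.Num → M.Num)
    [Rec₂ g] [Rec₄ h] : M.Num → M.Num → M.Num → M.Num :=
  (exists_recursion g h).choose

section

variable (g : M.Num → M.Num → M.Num) (h : M.Num → M.Num → M.Num → M.Num → M.Num) [Rec₂ g] [Rec₄ h]

instance : Rec₃ (prec g h) := (exists_recursion g h).choose_spec.1

theorem prec_zero (x y : M.Num) : prec g h x y 0 = g x y :=
  (exists_recursion g h).choose_spec.2.1 x y

theorem prec_succ (x y j : M.Num) : prec g h x y (j + 1) = h x y j (prec g h x y j) :=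
  (exists_recursion g h).choose_spec.2.2 x y j

end

/-- The least element of a decidable class (zero if the class is empty). -/
noncomputable def least (P : M.Num → Prop) : M.Num :=
  open Classical in if h : ∃ n, P n ∧ ∀ k, k < n → ¬ P k then h.choose else 0

theorem least_unique {P : M.Num → Prop} {n : M.Num} (h : P n) (h' : ∀ k, k < n → ¬ P k) :
    least P = n := by
  have H : ∃ n, P n ∧ ∀ k, k < n → ¬ P k := ⟨n, h, h'⟩
  have e : least P = H.choose := dif_pos H
  obtain ⟨h₁, h₂⟩ := H.choose_spec
  rw [e]
  refine le_antisymm (not_lt.1 fun hl => h₂ _ hl h) (not_lt.1 fun hl => h' _ hl h₁)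

theorem least_spec {P : M.Num → Prop} (hP : Dl M (fun v : Fin 1 → M.Num => P (v 0)))
    (h : ∃ n, P n) : P (least P) ∧ ∀ k, k < least P → ¬ P k := by
  obtain ⟨n, hn, hn'⟩ := exists_least hP h
  rw [least_unique hn hn']
  exact ⟨hn, hn'⟩

theorem Rec.least {P : (Fin n → M.Num) → M.Num → Prop}
    (hP : Dl M (fun w : Fin (n + 1) → M.Num => P (fun i => w i.castSucc) (w (Fin.last n))))
    (h : ∀ v, ∃ a, P v a) : Rec M (fun v => least (P v)) := by
  have h₁ : Dl M (fun w : Fin (n + 1) → M.Num => ∀ b, b < w (Fin.last n) →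
      ¬ P (fun i => w i.castSucc) b) := by
    have : Dl M (fun w : Fin (n + 1 + 1) → M.Num =>
        P (fun i => w i.castSucc.castSucc) (w (Fin.last (n + 1)))) :=
      (hP.comp (fun i w => ext (fun j : Fin n => w j.castSucc.castSucc) (w (Fin.last (n + 1))) i)
        fun i => (poly_ext (fun i => .var _) (.var _) i).toRec).congr fun v => by simp [ext]
    infer_instance
  refine .of_graph (fun v a => P v a ∧ ∀ b, b < a → ¬ P v b) fun v a => ⟨?_, fun h => ?_⟩
  · rintro rfl
    exact least_spec (P := P v) ((hP.comp (fun i w => ext v (w 0) i)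
      fun i => (poly_ext (fun i => .const _) (.var 0) i).toRec).congr fun w => by simp [ext]) (h v)
  · exact least_unique h.1 h.2

/-! ### Functions as sets -/

/-- The graph of a function. -/
def graphOf (F : M.Num → M.Num) : Set M.Num := {x | ∃ i, i < x + 1 ∧ x = M.pair i (F i)}

theorem app_graphOf {F : M.Num → M.Num} {i j : M.Num} : M.App (graphOf F) i j ↔ j = F i := by
  constructor
  · rintro ⟨i', -, h⟩
    obtain ⟨rfl, rfl⟩ := pair_inj.1 h
    rfl
  · rintro rfl
    exact ⟨i, num_lt_succ.2 (left_le_pair _ _), rfl⟩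

theorem isFun_graphOf (F : M.Num → M.Num) [Rec₁ F] : M.IsFun (graphOf F) := by
  refine ⟨comprehension inferInstance, fun x hx => ?_, fun i => ⟨F i, app_graphOf.2 rfl,
    fun j hj => app_graphOf.1 hj⟩⟩
  obtain ⟨i, -, h⟩ := hx
  exact ⟨i, _, h⟩

theorem IsFun.exists_rec {f : Set M.Num} (hf : M.IsFun f) :
    ∃ F : M.Num → M.Num, Rec₁ F ∧ ∀ i j, M.App f i j ↔ j = F i := by
  obtain ⟨hs, -, h⟩ := hf
  choose F hF hF' using h
  have key : ∀ i j, M.App f i j ↔ j = F i :=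
    fun i j => ⟨fun h => hF' i j h, fun h => h ▸ hF i⟩
  refine ⟨F, ⟨.of_graph (fun v a => M.pair (v 0) a ∈ (⟨f, hs⟩ : M.sets).1) fun v a => ?_⟩, key⟩
  rw [eq_comm]
  exact (key _ _).symm

end Recursion

end SecondOrderStructure

namespace SecondOrderStructure

/-! ## Exponentiation and binary digits -/

section Binary

variable {M : SecondOrderStructure.{u}} {n : ℕ} [RCA M]

instance : Rec₂ (M := M) (fun _ _ => 1) := ⟨inferInstance⟩
instance : Rec₄ (M := M) (fun _ _ _ a => a + a) := ⟨inferInstance⟩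

/-- The powers of two. -/
noncomputable def pow2 (x : M.Num) : M.Num := prec (fun _ _ => 1) (fun _ _ _ a => a + a) 0 0 x

instance : Rec₁ (M := M) pow2 := ⟨by unfold pow2; infer_instance⟩

theorem pow2_zero : pow2 (0 : M.Num) = 1 := prec_zero _ _ _ _

theorem pow2_succ (x : M.Num) : pow2 (x + 1) = 2 * pow2 x :=
  (prec_succ _ _ _ _ _).trans (two_mul _).symm

theorem pow2_one : pow2 (1 : M.Num) = 2 := by
  rw [← zero_add (1 : M.Num), pow2_succ, pow2_zero, mul_one]

theorem pow2_pos (x : M.Num) : 0 < pow2 x := by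
  induction x using sig_induction with
  | hP => infer_instance
  | h0 => rw [pow2_zero]; exact zero_lt_one
  | hs x h => rw [pow2_succ]; exact mul_pos two_pos h

theorem pow2_add (x y : M.Num) : pow2 (x + y) = pow2 x * pow2 y := by
  induction y using sig_induction with
  | hP => infer_instance
  | h0 => rw [add_zero, pow2_zero, mul_one]
  | hs y h => rw [← add_assoc, pow2_succ, pow2_succ, h]; ring

theorem pow2_dvd {x y : M.Num} (h : x ≤ y) : pow2 x ∣ pow2 y := by
  obtain ⟨z, rfl⟩ := exists_add_of_le h
  rw [pow2_add]
  exact dvd_mul_right _ _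

theorem one_le_pow2 (x : M.Num) : 1 ≤ pow2 x := by
  rw [← zero_add (1 : M.Num), num_succ_le]
  exact pow2_pos x

theorem pow2_le {x y : M.Num} (h : x ≤ y) : pow2 x ≤ pow2 y := by
  obtain ⟨z, rfl⟩ := exists_add_of_le h
  rw [pow2_add]
  exact le_mul_of_one_le_right zero_le (one_le_pow2 z)

theorem pow2_lt_succ (x : M.Num) : pow2 x < pow2 (x + 1) := by
  rw [pow2_succ, two_mul]
  exact lt_add_of_pos_left _ (pow2_pos x)

theorem pow2_lt {x y : M.Num} (h : x < y) : pow2 x < pow2 y :=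
  (pow2_lt_succ x).trans_le (pow2_le (num_succ_le.2 h))

theorem lt_of_pow2_lt {x y : M.Num} (h : pow2 x < pow2 y) : x < y :=
  not_le.1 fun h' => not_le.2 h (pow2_le h')

theorem lt_pow2 (x : M.Num) : x < pow2 x := by
  induction x using sig_induction with
  | hP => infer_instance
  | h0 => exact pow2_pos 0
  | hs x h => exact (num_succ_le.2 h).trans_lt (pow2_lt_succ x)

theorem pow_iff {x y : M.Num} : M.Pow x y ↔ y = pow2 x := by
  constructor
  · rintro ⟨p, hp, h0, hs, h⟩
    obtain ⟨F, hF, hpF⟩ := hp.exists_rec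
    simp only [hpF] at h0 hs h
    have key : ∀ i, F i = pow2 i := by
      intro i
      induction i using sig_induction with
      | hP => infer_instance
      | h0 => rw [← h0, pow2_zero]
      | hs i hi => rw [← hs i _ rfl, hi, pow2_succ, two_mul]
    rw [h, key]
  · rintro rfl
    refine ⟨_, isFun_graphOf pow2, ?_, fun i u h => ?_, ?_⟩ <;> rw [app_graphOf] at *
    · exact pow2_zero.symm
    · rw [h, pow2_succ, two_mul]

theorem exists_div {d : M.Num} (hd : 0 < d) (u : M.Num) : ∃ q r, u = d * q + r ∧ r < d := by
  induction u using sig_induction with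
  | hP => infer_instance
  | h0 => exact ⟨0, 0, by simp, hd⟩
  | hs u h =>
    obtain ⟨q, r, rfl, hr⟩ := h
    rcases (num_succ_le.2 hr).lt_or_eq with h | h
    · exact ⟨q, r + 1, by ring, h⟩
    · exact ⟨q + 1, 0, by rw [add_assoc, h]; ring, hd⟩

theorem mul_le_mul_add_iff {a x y r : M.Num} (hr : r < a) : a * y ≤ a * x + r ↔ y ≤ x := by
  constructor
  · intro h
    by_contra! h'
    have := Diff.of_nonneg r
    have := Diff.of_nonneg x
    simp only [Diff.transfer] at *
    nlinarith [mul_nonneg (sub_nonneg.2 h') (Diff.of_nonneg a)]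
  · exact fun h => (mul_le_mul_right h a).trans le_self_add

theorem div_unique {a x y r s : M.Num} (hr : r < a) (hs : s < a) (h : a * x + r = a * y + s) :
    x = y ∧ r = s := by
  have h₁ : x ≤ y := (mul_le_mul_add_iff hs).1 (le_self_add.trans h.le)
  have h₂ : y ≤ x := (mul_le_mul_add_iff hr).1 (le_self_add.trans h.ge)
  obtain rfl := le_antisymm h₁ h₂
  exact ⟨rfl, add_left_cancel h⟩

/-- The binary digit of `u` at position `n` is one. -/
def Bit (u n : M.Num) : Prop :=
  ∃ q, q ≤ u ∧ ∃ r, r ≤ u ∧ u = pow2 (n + 1) * q + (pow2 n + r) ∧ r < pow2 n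

instance : Dl₂ (M := M) Bit := ⟨by unfold Bit; infer_instance⟩

theorem bit_iff {u n q s : M.Num} (hs : s < pow2 (n + 1)) (h : u = pow2 (n + 1) * q + s) :
    Bit u n ↔ pow2 n ≤ s := by
  constructor
  · rintro ⟨q', -, r, -, h', hr⟩
    have hr' : pow2 n + r < pow2 (n + 1) := by
      rw [pow2_succ, two_mul]
      exact add_lt_add_right hr _
    rw [(div_unique hs hr' (h.symm.trans h')).2]
    exact le_self_add
  · intro hn
    obtain ⟨r, rfl⟩ := exists_add_of_le hn
    refine ⟨q, ?_, r, ?_, h, ?_⟩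
    · rw [h]
      exact (le_mul_of_one_le_left zero_le (one_le_pow2 _)).trans le_self_add
    · rw [h]
      exact le_add_self.trans le_add_self
    · rw [pow2_succ, two_mul] at hs
      exact lt_of_add_lt_add_left hs

theorem Bit.le {u n : M.Num} (h : Bit u n) : pow2 n ≤ u := by
  obtain ⟨q, -, r, -, h, -⟩ := h
  rw [h]
  exact le_self_add.trans le_add_self

theorem not_bit_of_lt {u t n : M.Num} (h : u < pow2 t) (hn : t ≤ n) : ¬ Bit u n :=
  fun hb => not_le.2 h ((pow2_le hn).trans hb.le)

theorem not_bit_of_dvd {u t n : M.Num} (h : pow2 t ∣ u) (hn : n < t) : ¬ Bit u n := by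
  obtain ⟨q, hq⟩ := (pow2_dvd (num_succ_le.2 hn)).trans h
  rw [bit_iff (q := q) (s := 0) (pow2_pos _) (by rw [hq, add_zero])]
  exact not_le.2 (pow2_pos n)

theorem bit_add_of_lt {U T t n : M.Num} (hU : pow2 t ∣ U) (hn : n < t) :
    Bit (U + T) n ↔ Bit T n := by
  obtain ⟨q, rfl⟩ := (pow2_dvd (num_succ_le.2 hn)).trans hU
  obtain ⟨q', s, rfl, hs⟩ := exists_div (pow2_pos (n + 1)) T
  rw [bit_iff (q := q + q') hs (by ring), bit_iff hs rfl]

/-- No carry occurs, since `U` ends with `t` zeros and `T` fits into these places. -/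
theorem bit_add_of_le {U T t n : M.Num} (hU : pow2 t ∣ U) (hT : T < pow2 t) (hn : t ≤ n) :
    Bit (U + T) n ↔ Bit U n := by
  obtain ⟨q, s, rfl, hs⟩ := exists_div (pow2_pos (n + 1)) U
  obtain ⟨s, rfl⟩ := num_dvd_cancel hU ((pow2_dvd (hn.trans le_self_add)).mul_right q)
  obtain ⟨d, rfl⟩ := exists_add_of_le hn
  have hs' : pow2 t * s + T < pow2 (t + d + 1) := by
    rw [add_assoc, pow2_add] at hs ⊢
    have h₁ : s < pow2 (d + 1) := lt_of_mul_lt_mul_left hs zero_le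
    have h₂ := mul_le_mul_right (num_succ_le.2 h₁) (pow2 t)
    rw [mul_add, mul_one] at h₂
    exact (add_lt_add_right hT _).trans_le h₂
  rw [bit_iff (q := q) hs' (by ring), bit_iff hs rfl, pow2_add, mul_le_mul_add_iff hT,
    mul_le_mul_iff_right₀ (pow2_pos t)]

theorem bit_pow2 {t n : M.Num} : Bit (pow2 t) n ↔ n = t := by
  constructor
  · intro h
    rcases lt_trichotomy n t with hn | hn | hn
    · exact (not_bit_of_dvd dvd_rfl hn h).elim
    · exact hn
    · exact (not_le.2 (pow2_lt hn) h.le).elim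
  · rintro rfl
    exact (bit_iff (q := 0) (pow2_lt_succ n) (by simp)).2 le_rfl

/-- The position of the leading binary digit. -/
noncomputable def lg (u : M.Num) : M.Num := least fun n => u < pow2 (n + 1)

theorem exists_lt_pow2 (u : M.Num) : ∃ n, u < pow2 (n + 1) :=
  ⟨u, (lt_pow2 u).trans (pow2_lt_succ u)⟩

instance : Rec₁ (M := M) lg :=
  ⟨Rec.least (P := fun (v : Fin 1 → M.Num) n => v 0 < pow2 (n + 1)) inferInstance
    fun _ => exists_lt_pow2 _⟩

theorem lt_pow2_lg (u : M.Num) : u < pow2 (lg u + 1) :=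
  (least_spec (P := fun n => u < pow2 (n + 1)) inferInstance (exists_lt_pow2 u)).1

theorem pow2_lg_le {u : M.Num} (h : u ≠ 0) : pow2 (lg u) ≤ u := by
  rcases eq_or_ne (lg u) 0 with h' | h'
  · rw [h', pow2_zero, ← zero_add (1 : M.Num), num_succ_le]
    exact pos_iff_ne_zero.2 h
  · obtain ⟨m, hm⟩ : ∃ m, lg u = m + 1 := by
      obtain ⟨m, hm⟩ := exists_add_of_le (num_succ_le.2 (pos_iff_ne_zero.2 h'))
      exact ⟨m, by rw [hm, zero_add, add_comm]⟩
    have := (least_spec (P := fun n => u < pow2 (n + 1)) inferInstance (exists_lt_pow2 u)).2 m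
      (by rw [← lg, hm]; exact num_lt_succ_self m)
    rw [hm]
    exact not_lt.1 this

theorem lg_lt {u t : M.Num} (h : u ≠ 0) (hu : u < pow2 t) : lg u < t :=
  lt_of_pow2_lt ((pow2_lg_le h).trans_lt hu)

theorem sub_pow2_lg_lt (u : M.Num) : u - pow2 (lg u) < pow2 (lg u) := by
  rcases eq_or_ne u 0 with rfl | h
  · rw [tsub_eq_zero_of_le zero_le]
    exact pow2_pos _
  · rw [tsub_lt_iff_right (pow2_lg_le h), ← two_mul, ← pow2_succ]
    exact lt_pow2_lg u

/-- The exponent of the largest power of two that divides `u` (if `u` is positive). -/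
noncomputable def val2 (u : M.Num) : M.Num := least fun n => u = 0 ∨ ¬ pow2 (n + 1) ∣ u

theorem exists_not_dvd (u : M.Num) : ∃ n, u = 0 ∨ ¬ pow2 (n + 1) ∣ u := by
  rcases eq_or_ne u 0 with h | h
  · exact ⟨0, .inl h⟩
  · refine ⟨u, .inr fun ⟨q, hq⟩ => ?_⟩
    have hq0 : q ≠ 0 := fun h' => h (by rw [hq, h', mul_zero])
    have : pow2 (u + 1) ≤ u := by
      conv_rhs => rw [hq]
      refine le_mul_of_one_le_right zero_le ?_
      rw [← zero_add (1 : M.Num), num_succ_le]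
      exact pos_iff_ne_zero.2 hq0
    exact not_lt.2 this ((lt_pow2 u).trans (pow2_lt_succ u))

instance : Rec₁ (M := M) val2 :=
  ⟨Rec.least (P := fun (v : Fin 1 → M.Num) n => v 0 = 0 ∨ ¬ pow2 (n + 1) ∣ v 0) inferInstance
    fun _ => exists_not_dvd _⟩

theorem val2_spec {u : M.Num} (h : u ≠ 0) :
    pow2 (val2 u) ∣ u ∧ ¬ pow2 (val2 u + 1) ∣ u := by
  have := least_spec (P := fun n => u = 0 ∨ ¬ pow2 (n + 1) ∣ u) inferInstance (exists_not_dvd u)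
  simp only [h, false_or, not_not] at this
  have e : val2 u = least fun n => ¬ pow2 (n + 1) ∣ u := by simp only [val2, h, false_or]
  rw [← e] at this
  refine ⟨?_, this.1⟩
  rcases eq_or_ne (val2 u) 0 with h' | h'
  · rw [h', pow2_zero]
    exact one_dvd _
  · obtain ⟨m, hm⟩ := exists_add_of_le (num_succ_le.2 (pos_iff_ne_zero.2 h'))
    have := this.2 m (by rw [hm, zero_add, add_comm]; exact num_lt_succ_self m)
    rwa [hm, zero_add, add_comm]

theorem le_val2_iff {u t : M.Num} (h : u ≠ 0) : t ≤ val2 u ↔ pow2 t ∣ u := by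
  refine ⟨fun h' => (pow2_dvd h').trans (val2_spec h).1, fun h' => ?_⟩
  by_contra! hl
  exact (val2_spec h).2 ((pow2_dvd (num_succ_le.2 hl)).trans h')

theorem val2_eq {u t : M.Num} (h : u ≠ 0) (h₁ : pow2 t ∣ u) (h₂ : ¬ pow2 (t + 1) ∣ u) :
    val2 u = t := by
  rw [← le_val2_iff h] at h₁ h₂
  rw [not_le, num_lt_succ] at h₂
  exact le_antisymm h₂ h₁

/-- A number is the sum of an even multiple of a power of two and this power. -/
theorem exists_sub_pow2 {u t : M.Num} (h₁ : pow2 t ∣ u) (h₂ : ¬ pow2 (t + 1) ∣ u) :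
    ∃ U, u = U + pow2 t ∧ pow2 (t + 1) ∣ U := by
  obtain ⟨q, rfl⟩ := h₁
  obtain ⟨k, r, rfl, hr⟩ := exists_div (d := (2 : M.Num)) two_pos q
  rw [← one_add_one_eq_two, num_lt_succ] at hr
  rcases hr.lt_or_eq with hr | rfl
  · rw [← zero_add (1 : M.Num), num_lt_succ] at hr
    obtain rfl := le_antisymm hr zero_le
    exact (h₂ ⟨k, by rw [pow2_succ]; ring⟩).elim
  · exact ⟨pow2 (t + 1) * k, by rw [pow2_succ]; ring, dvd_mul_right _ _⟩

end Binary

end SecondOrderStructure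

namespace SecondOrderStructure

/-! ## Change of exponents in binary representations -/

section Hat

variable {M : SecondOrderStructure.{u}} [RCA M]

theorem exists_eq_succ {a : M.Num} (h : a ≠ 0) : ∃ m, a = m + 1 := by
  obtain ⟨m, hm⟩ := exists_add_of_le (num_succ_le.2 (pos_iff_ne_zero.2 h))
  exact ⟨m, by rw [hm, zero_add, add_comm]⟩

theorem pow2_add_two (x : M.Num) : pow2 (x + 2) = 4 * pow2 x := by
  have : x + 2 = x + 1 + 1 := by ring
  rw [this, pow2_succ, pow2_succ]
  ring

instance : Rec₂ (M := M) (fun _ _ => 0) := ⟨inferInstance⟩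

variable (C : M.Num → M.Num → M.Num) [Rec₂ C] {i : M.Num}

open Classical in
instance : Rec₄ (M := M) (fun i u n a => a + if Bit u n then pow2 (C i n) else 0) :=
  ⟨inferInstance⟩

open Classical in
/-- The sum of the numbers `2 ^ C i m` for the non-zero binary digits `m < n` of `u`. -/
noncomputable def hsum (i u n : M.Num) : M.Num :=
  prec (fun _ _ => 0) (fun i u n a => a + if Bit u n then pow2 (C i n) else 0) i u n

instance : Rec₃ (hsum C) := ⟨by unfold hsum; infer_instance⟩

theorem hsum_zero (i u : M.Num) : hsum C i u 0 = 0 := prec_zero _ _ _ _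

variable {C}

theorem hsum_succ_of {u n : M.Num} (h : Bit u n) :
    hsum C i u (n + 1) = hsum C i u n + pow2 (C i n) :=
  (prec_succ _ _ _ _ _).trans (by rw [if_pos h]; rfl)

theorem hsum_succ_of_not {u n : M.Num} (h : ¬ Bit u n) :
    hsum C i u (n + 1) = hsum C i u n :=
  (prec_succ _ _ _ _ _).trans (by rw [if_neg h, add_zero]; rfl)

/-- As the new exponents increase strictly, this is the estimate of a sum of distinct powers of two
by the next power. -/
theorem hsum_lt (hC : StrictMono (C i)) (u n : M.Num) : hsum C i u n < pow2 (C i n) := by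
  induction n using sig_induction with
  | hP => infer_instance
  | h0 => rw [hsum_zero]; exact pow2_pos _
  | hs n h =>
    refine lt_of_lt_of_le ?_ (pow2_le (num_succ_le.2 (hC (num_lt_succ_self n))))
    rw [pow2_succ, two_mul]
    by_cases hb : Bit u n
    · rw [hsum_succ_of hb]
      exact add_lt_add_left h _
    · rw [hsum_succ_of_not hb]
      exact h.trans_le le_self_add

theorem hsum_eq_of_le {u t s : M.Num} (hu : u < pow2 t) (hs : t ≤ s) :
    hsum C i u s = hsum C i u t := by
  obtain ⟨d, rfl⟩ := exists_add_of_le hs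
  clear hs
  induction d using sig_induction with
  | hP => infer_instance
  | h0 => rw [add_zero]
  | hs d h => rw [← add_assoc, hsum_succ_of_not (not_bit_of_lt hu le_self_add), h]

theorem hsum_add {U T t : M.Num} (hU : pow2 t ∣ U) (hT : T < pow2 t) (n : M.Num) :
    hsum C i (U + T) n = hsum C i U n + hsum C i T n := by
  induction n using sig_induction with
  | hP => infer_instance
  | h0 => simp only [hsum_zero, add_zero]
  | hs n h =>
    rcases lt_or_ge n t with hn | hn
    · rw [hsum_succ_of_not (not_bit_of_dvd hU hn)]
      by_cases hb : Bit T n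
      · rw [hsum_succ_of hb, hsum_succ_of ((bit_add_of_lt hU hn).2 hb), h, add_assoc]
      · rw [hsum_succ_of_not hb, hsum_succ_of_not (mt (bit_add_of_lt hU hn).1 hb), h]
    · rw [hsum_succ_of_not (not_bit_of_lt hT hn)]
      by_cases hb : Bit U n
      · rw [hsum_succ_of hb, hsum_succ_of ((bit_add_of_le hU hT hn).2 hb), h, add_right_comm]
      · rw [hsum_succ_of_not hb, hsum_succ_of_not (mt (bit_add_of_le hU hT hn).1 hb), h]

theorem dvd_hsum (hC : StrictMono (C i)) {U t : M.Num} (hU : pow2 t ∣ U) (n : M.Num) :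
    pow2 (C i t) ∣ hsum C i U n := by
  induction n using sig_induction with
  | hP => infer_instance
  | h0 => rw [hsum_zero]; exact dvd_zero _
  | hs n h =>
    by_cases hb : Bit U n
    · rw [hsum_succ_of hb]
      exact dvd_add h (pow2_dvd (hC.monotone (not_lt.1 fun hn => not_bit_of_dvd hU hn hb)))
    · rwa [hsum_succ_of_not hb]

variable (C) in
/-- The sum of the numbers `2 ^ C i m` for the non-zero binary digits `m` of `u`. -/
noncomputable def hat (i u : M.Num) : M.Num := hsum C i u u

instance : Rec₂ (hat C) := ⟨by unfold hat; infer_instance⟩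

theorem hat_eq_hsum {u t : M.Num} (hu : u < pow2 t) : hat C i u = hsum C i u t := by
  rcases le_total t u with h | h
  · exact hsum_eq_of_le hu h
  · exact (hsum_eq_of_le (lt_pow2 u) h).symm

/-- The digits of the two summands are concatenated without overlap. All later arguments about
changes of exponents rest on this additivity. -/
theorem hat_add {U T t : M.Num} (hU : pow2 t ∣ U) (hT : T < pow2 t) :
    hat C i (U + T) = hat C i U + hat C i T := by
  rw [hat, hsum_add hU hT, ← hat_eq_hsum, ← hat_eq_hsum]
  · exact (lt_pow2 T).trans_le (pow2_le le_add_self)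
  · exact (lt_pow2 U).trans_le (pow2_le le_self_add)

theorem hat_lt (hC : StrictMono (C i)) {u t : M.Num} (hu : u < pow2 t) :
    hat C i u < pow2 (C i t) := by
  rw [hat_eq_hsum hu]
  exact hsum_lt hC _ _

theorem dvd_hat (hC : StrictMono (C i)) {u t : M.Num} (hu : pow2 t ∣ u) :
    pow2 (C i t) ∣ hat C i u :=
  dvd_hsum hC hu _

theorem hat_zero : hat C i 0 = 0 := hsum_zero C i 0

theorem hat_pow2 (t : M.Num) : hat C i (pow2 t) = pow2 (C i t) := by
  have key : ∀ n, n ≤ t → hsum C i (pow2 t) n = 0 := by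
    intro n
    induction n using sig_induction with
    | hP => infer_instance
    | h0 => exact fun _ => hsum_zero _ _ _
    | hs n ih =>
      intro hn
      rw [hsum_succ_of_not, ih (le_self_add.trans hn)]
      rw [bit_pow2]
      exact (num_succ_le.1 hn).ne
  rw [hat_eq_hsum (pow2_lt_succ t), hsum_succ_of (bit_pow2.2 rfl), key t le_rfl, zero_add]

theorem hat_eq_add_of_ne_zero {u : M.Num} (h : u ≠ 0) :
    hat C i u = hat C i (u - pow2 (lg u)) + pow2 (C i (lg u)) := by
  conv_lhs => rw [← num_add_sub (pow2_lg_le h)]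
  rw [hat_add dvd_rfl (sub_pow2_lg_lt u), hat_pow2, add_comm]

theorem hat_pos {u : M.Num} (h : u ≠ 0) : 0 < hat C i u := by
  rw [hat_eq_add_of_ne_zero h]
  exact add_pos_of_nonneg_of_pos zero_le (pow2_pos _)

/-- If all exponents are increased by two, the number is multiplied by four. -/
theorem hat_eq_four_mul {u p : M.Num} (hp : pow2 p ∣ u) (hC : ∀ x, p ≤ x → C i x = x + 2) :
    hat C i u = 4 * u := by
  -- Here `s` is the remainder of `u` modulo `2 ^ n`; the partial sum up to `n` is four times this
  -- remainder.
  have key : ∀ n, ∃ q, ∃ s, u = pow2 n * q + s ∧ s < pow2 n ∧ hsum C i u n = 4 * s := by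
    intro n
    induction n using sig_induction with
    | hP => infer_instance
    | h0 => exact ⟨u, 0, by rw [pow2_zero, one_mul, add_zero], pow2_pos _,
        by rw [hsum_zero, mul_zero]⟩
    | hs n ih =>
      obtain ⟨q, s, hu, hs, h⟩ := ih
      obtain ⟨k, r, rfl, hr⟩ := exists_div (d := (2 : M.Num)) two_pos q
      have hs' : pow2 n * r + s < pow2 (n + 1) := by
        rw [pow2_succ]
        rw [← one_add_one_eq_two, num_lt_succ] at hr
        have := mul_le_mul_right hr (pow2 n)
        simp only [Diff.transfer] at *
        linarith
      have hu' : u = pow2 (n + 1) * k + (pow2 n * r + s) := by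
        rw [hu, pow2_succ]
        ring
      refine ⟨k, _, hu', hs', ?_⟩
      by_cases hb : Bit u n
      · have hn : p ≤ n := not_lt.1 fun hn => not_bit_of_dvd hp hn hb
        have hr0 : r = 1 := by
          rw [← one_add_one_eq_two, num_lt_succ] at hr
          rcases hr.lt_or_eq with hr | hr
          · rw [← zero_add (1 : M.Num), num_lt_succ] at hr
            obtain rfl := le_antisymm hr zero_le
            rw [bit_iff hs' hu', mul_zero, zero_add] at hb
            exact (not_lt.2 hb hs).elim
          · exact hr
        rw [hsum_succ_of hb, h, hC n hn, hr0, pow2_add_two]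
        ring
      · have hr0 : r = 0 := by
          by_contra hr0
          refine hb ((bit_iff hs' hu').2 ?_)
          have := mul_le_mul_right (num_succ_le.2 (pos_iff_ne_zero.2 hr0)) (pow2 n)
          rw [zero_add, mul_one] at this
          exact this.trans le_self_add
        rw [hsum_succ_of_not hb, h, hr0, mul_zero, zero_add]
  obtain ⟨q, s, hu, hs, h⟩ := key u
  have : q = 0 := by
    by_contra hq
    have := mul_le_mul_right (num_succ_le.2 (pos_iff_ne_zero.2 hq)) (pow2 u)
    rw [zero_add, mul_one] at this
    exact not_lt.2 ((this.trans le_self_add).trans hu.ge) (lt_pow2 u)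
  rw [this, mul_zero, zero_add] at hu
  rw [hat, h, ← hu]

end Hat

/-! ### Goodstein steps in terms of `hat` -/

section Step

variable {M : SecondOrderStructure.{u}} [RCA M]

/-- The values of a sequence of partial sums. -/
theorem PowSum.exists_rec {f : Set M.Num} {F : M.Num → M.Num} {k s : M.Num}
    (hF : ∀ i j, M.App f i j ↔ j = F i) (h : M.PowSum f k s) :
    ∃ S : M.Num → M.Num, Rec₁ S ∧ S 0 = 0 ∧ (∀ j, j ≤ k → S (j + 1) = S j + pow2 (F j)) ∧
      S (k + 1) = s := by
  obtain ⟨σ, hσ, h₀, h₁, h₂⟩ := h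
  obtain ⟨S, hS, hσS⟩ := hσ.exists_rec
  simp only [hσS, hF, pow_iff] at h₀ h₁ h₂
  exact ⟨S, hS, h₀.symm, fun j hj => (h₁ j _ _ _ hj.lt_or_eq rfl rfl rfl).symm, h₂.symm⟩

theorem PowSum.of_rec {f : Set M.Num} {F S : M.Num → M.Num} [Rec₁ S] {k : M.Num}
    (hF : ∀ i j, M.App f i j ↔ j = F i) (h₀ : S 0 = 0)
    (h : ∀ j, j ≤ k → S (j + 1) = S j + pow2 (F j)) : M.PowSum f k (S (k + 1)) := by
  refine ⟨_, isFun_graphOf S, app_graphOf.2 h₀.symm, fun j n p u hj hn hp hu => ?_,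
    app_graphOf.2 rfl⟩
  rw [hF] at hn
  rw [pow_iff] at hp
  rw [app_graphOf] at *
  rw [hu, hp, hn, h j (le_iff_lt_or_eq.2 hj)]

variable {b c : Set M.Num} {B : M.Num → M.Num} {C : M.Num → M.Num → M.Num} [Rec₂ C]

/-- Since the exponents decrease, each partial sum is a multiple of its last power of two, which
exceeds the next summand. So `hat_add` applies to one summand after the other. -/
theorem GoodsteinStep.eq_hat (hC : ∀ i n k, M.FamApp c i n k → k = C i n) {i u v : M.Num}
    (h : M.GoodsteinStep b c i u v) (hu : u ≠ 0) : v + 1 = hat C i u := by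
  rcases h with h | ⟨k, f, g, hf, hg, -, hdec, hu', hfg, hv⟩
  · exact (hu h.1).elim
  obtain ⟨F, _, hF⟩ := hf.exists_rec
  obtain ⟨G, _, hG⟩ := hg.exists_rec
  obtain ⟨S, _, hS₀, hS, hSu⟩ := hu'.exists_rec hF
  obtain ⟨T, _, hT₀, hT, hTv⟩ := hv.exists_rec hG
  simp only [hF, hG] at hdec hfg
  have key : ∀ j, j ≤ k → T (j + 1) = hat C i (S (j + 1)) ∧ pow2 (F j) ∣ S (j + 1) := by
    intro j
    induction j using sig_induction with
    | hP => infer_instance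
    | h0 =>
      intro h
      rw [hS 0 h, hT 0 h, hS₀, hT₀, zero_add, zero_add, hat_pow2,
        hC _ _ _ (hfg 0 _ _ h.lt_or_eq rfl rfl)]
      exact ⟨rfl, dvd_rfl⟩
    | hs j ih =>
      intro h
      obtain ⟨h₁, h₂⟩ := ih (le_self_add.trans h)
      have hlt := hdec j _ _ (num_succ_le.1 h) rfl rfl
      rw [hS _ h, hT _ h, hat_add h₂ (pow2_lt hlt), hat_pow2, h₁,
        hC _ _ _ (hfg _ _ _ h.lt_or_eq rfl rfl)]
      exact ⟨rfl, dvd_add ((pow2_dvd hlt.le).trans h₂) dvd_rfl⟩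
  rw [← hTv, ← hSu]
  exact (key k le_rfl).1

instance : Rec₂ (M := M) (fun u _ => u) := ⟨inferInstance⟩
instance : Rec₄ (M := M) (fun _ _ _ a => a - pow2 (lg a)) := ⟨inferInstance⟩

/-- The number that remains when the `j` leading summands of the binary representation of `u` are
removed. -/
noncomputable def digitTail (u j : M.Num) : M.Num :=
  prec (fun u _ => u) (fun _ _ _ a => a - pow2 (lg a)) u 0 j

instance : Rec₂ (M := M) digitTail := ⟨by unfold digitTail; infer_instance⟩

theorem digitTail_zero (u : M.Num) : digitTail u 0 = u := prec_zero _ _ _ _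

theorem digitTail_succ (u j : M.Num) :
    digitTail u (j + 1) = digitTail u j - pow2 (lg (digitTail u j)) := prec_succ _ _ _ _ _

theorem digitTail_le (u j : M.Num) : digitTail u j ≤ u := by
  induction j using sig_induction with
  | hP => infer_instance
  | h0 => rw [digitTail_zero]
  | hs j h => rw [digitTail_succ]; exact tsub_le_self.trans h

theorem hat_digitTail_le (i u j : M.Num) : hat C i (digitTail u j) ≤ hat C i u := by
  induction j using sig_induction with
  | hP => infer_instance
  | h0 => rw [digitTail_zero]
  | hs j h =>
    rcases eq_or_ne (digitTail u j) 0 with h₀ | h₀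
    · rw [digitTail_succ, h₀, tsub_eq_zero_of_le zero_le, hat_zero]
      exact zero_le
    · rw [hat_eq_add_of_ne_zero h₀, ← digitTail_succ] at h
      exact le_self_add.trans h

theorem exists_digitTail_eq_zero (u : M.Num) : ∃ j, digitTail u j = 0 := by
  have key : ∀ j, digitTail u j = 0 ∨ digitTail u j + j ≤ u := by
    intro j
    induction j using sig_induction with
    | hP => infer_instance
    | h0 => exact .inr (by rw [digitTail_zero, add_zero])
    | hs j h =>
      rcases eq_or_ne (digitTail u j) 0 with h₀ | h₀
      · left
        rw [digitTail_succ, h₀, tsub_eq_zero_of_le zero_le]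
      · right
        have h₁ := num_add_sub (pow2_lg_le h₀)
        rw [← digitTail_succ] at h₁
        have h₂ := h.resolve_left h₀
        have h₃ := pow2_pos (lg (digitTail u j))
        simp only [Diff.transfer] at *
        linarith
  refine ⟨u + 1, (key _).resolve_right fun h => ?_⟩
  exact not_lt.2 (le_add_self.trans h) (num_lt_succ_self u)

/-- The exponents are found by repeated removal of the leading summand. Partial sums are the
differences between the full number and what remains. -/
theorem GoodsteinStep.of_eq_hat (hB : ∀ i u, M.App b i u ↔ u = B i)
    (hC : ∀ i n, n < B i → M.FamApp c i n (C i n)) {i u v : M.Num} (hu : u ≠ 0)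
    (hub : u < pow2 (B i)) (h : v + 1 = hat C i u) : M.GoodsteinStep b c i u v := by
  right
  obtain ⟨K, hK, hK'⟩ := exists_least (P := fun j => digitTail u j = 0) inferInstance
    (exists_digitTail_eq_zero u)
  -- `K` counts the summands, while the last index of the sequence of exponents is `k`.
  obtain ⟨k, rfl⟩ : ∃ k, K = k + 1 := by
    refine exists_eq_succ ?_
    rintro rfl
    exact hu (digitTail_zero u ▸ hK)
  have hne : ∀ j, j ≤ k → digitTail u j ≠ 0 := fun j hj => hK' j (num_lt_succ.2 hj)
  have hf : Rec₁ (fun j => lg (digitTail u j)) := ⟨inferInstance⟩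
  have hg : Rec₁ (fun j => C i (lg (digitTail u j))) := ⟨inferInstance⟩
  have hσ : Rec₁ (fun j => u - digitTail u j) := ⟨inferInstance⟩
  have hτ : Rec₁ (fun j => hat C i u - hat C i (digitTail u j)) := ⟨inferInstance⟩
  refine ⟨k, _, _, isFun_graphOf (fun j => lg (digitTail u j)),
    isFun_graphOf (fun j => C i (lg (digitTail u j))), ?_, ?_, ?_, ?_, ?_⟩
  · intro n w hn hw
    rw [app_graphOf, digitTail_zero] at hn
    rw [hn, (hB _ _).1 hw]
    exact lg_lt hu hub
  · intro j n n' hj hn hn'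
    rw [app_graphOf] at hn hn'
    rw [hn, hn']
    refine lg_lt (hne _ (num_succ_le.2 hj)) ?_
    rw [digitTail_succ]
    exact sub_pow2_lg_lt _
  · have := PowSum.of_rec (k := k) (S := fun j => u - digitTail u j)
      (fun i j => app_graphOf (F := fun j => lg (digitTail u j))) ?_ fun j hj => ?_
    · simpa only [hK, tsub_zero] using this
    · simp only [digitTail_zero, tsub_self]
    · have h₁ := num_add_sub (pow2_lg_le (hne j hj))
      rw [← digitTail_succ] at h₁
      have h₂ := num_add_sub (digitTail_le u j)
      have h₃ := num_add_sub (digitTail_le u (j + 1))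
      simp only [Diff.transfer] at *
      linarith
  · intro j n n' hj hn hn'
    rw [app_graphOf] at hn hn'
    rw [hn, hn']
    exact hC _ _ (lg_lt (hne j (le_iff_lt_or_eq.2 hj)) ((digitTail_le u j).trans_lt hub))
  · have := PowSum.of_rec (k := k) (S := fun j => hat C i u - hat C i (digitTail u j))
      (fun i' j => app_graphOf (F := fun j => C i (lg (digitTail u j)))) ?_ fun j hj => ?_
    · simpa only [hK, hat_zero, tsub_zero, ← h] using this
    · simp only [digitTail_zero, tsub_self]
    · have h₁ := hat_eq_add_of_ne_zero (C := C) (i := i) (hne j hj)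
      rw [← digitTail_succ] at h₁
      have h₂ := num_add_sub (hat_digitTail_le (C := C) i u j)
      have h₃ := num_add_sub (hat_digitTail_le (C := C) i u (j + 1))
      simp only [Diff.transfer] at *
      linarith

end Step

end SecondOrderStructure

namespace SecondOrderStructure

/-! ## Iterations -/

section Iteration

variable {M : SecondOrderStructure.{u}} [RCA M]

instance : Rec₂ (M := M) (fun _ x => x) := ⟨inferInstance⟩

variable (D : M.Num → M.Num → M.Num) [Rec₂ D]

open Classical in
instance : Rec₄ (M := M) (fun i x k a => if k < i then x else D k a) := ⟨inferInstance⟩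

open Classical in
/-- The value of `D (k - 1) ∘ … ∘ D i` at `x` (which is `x` if `k ≤ i`). -/
noncomputable def iter (i x k : M.Num) : M.Num :=
  prec (fun _ x => x) (fun i x k a => if k < i then x else D k a) i x k

instance : Rec₃ (iter D) := ⟨by unfold iter; infer_instance⟩

variable {D}

theorem iter_of_le {i x k : M.Num} (h : k ≤ i) : iter D i x k = x := by
  induction k using sig_induction with
  | hP => infer_instance
  | h0 => exact prec_zero _ _ _ _
  | hs k _ => exact (prec_succ _ _ _ _ _).trans (if_pos (num_succ_le.1 h))

theorem iter_succ {i k : M.Num} (h : i ≤ k) (x : M.Num) :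
    iter D i x (k + 1) = D k (iter D i x k) :=
  (prec_succ _ _ _ _ _).trans (if_neg (not_lt.2 h))

theorem iter_strictMono (hD : ∀ i, StrictMono (D i)) (i k : M.Num) :
    StrictMono (fun x => iter D i x k) := by
  intro x y hxy
  induction k using sig_induction with
  | hP => infer_instance
  | h0 => simpa only [iter_of_le zero_le] using hxy
  | hs k ih =>
    rcases lt_or_ge k i with h | h
    · simpa only [iter_of_le (num_succ_le.2 h)] using hxy
    · simpa only [iter_succ h] using hD k ih

theorem iter_iter {i j k : M.Num} (hij : i ≤ j) (hjk : j ≤ k) (x : M.Num) :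
    iter D j (iter D i x j) k = iter D i x k := by
  obtain ⟨d, rfl⟩ := exists_add_of_le hjk
  clear hjk
  induction d using sig_induction with
  | hP => infer_instance
  | h0 => rw [add_zero, iter_of_le le_rfl]
  | hs d ih => rw [← add_assoc, iter_succ le_self_add, ih, iter_succ (hij.trans le_self_add)]

variable {C : M.Num → M.Num → M.Num} [Rec₂ C]

theorem IterApp.eq_iter {c : Set M.Num} (hc : ∀ i n k, M.FamApp c i n k → k = C i n)
    {i j x y : M.Num} (h : M.IterApp c i j x y) (hij : i ≤ j) : y = iter C i x j := by
  obtain ⟨f, hf, hx, hy, h⟩ := h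
  obtain ⟨F, _, hF⟩ := hf.exists_rec
  simp only [hF] at hx hy h
  obtain ⟨d, rfl⟩ := exists_add_of_le hij
  have key : ∀ e, e ≤ d → F (i + e) = iter C i x (i + e) := by
    intro e
    induction e using sig_induction with
    | hP => infer_instance
    | h0 => intro _; rw [add_zero, iter_of_le le_rfl, hx]
    | hs e ih =>
      intro he
      rw [← add_assoc, iter_succ le_self_add, ← ih (le_self_add.trans he)]
      exact hc _ _ _ (h (i + e) _ _ (le_self_add (a := i)).lt_or_eq
        (add_lt_add_right (num_succ_le.1 he) _) rfl rfl)
  rw [hy, key d le_rfl]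

theorem iterApp_iter {c : Set M.Num} {B : M.Num → M.Num}
    (hc : ∀ i n, n < B i → M.FamApp c i n (C i n)) (hB : ∀ i n, n < B i → C i n < B (i + 1))
    [Rec₁ B] {i x : M.Num} (hx : x < B i) (j : M.Num) :
    M.IterApp c i j x (iter C i x j) := by
  have : Rec₁ (iter C i x) := ⟨inferInstance⟩
  refine ⟨_, isFun_graphOf (iter C i x), ?_, app_graphOf.2 rfl, fun k u v hik hkj hu hv => ?_⟩
  · rw [app_graphOf, iter_of_le le_rfl]
  · replace hik := le_iff_lt_or_eq.2 hik
    rw [app_graphOf] at hu hv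
    rw [hu, hv, iter_succ hik]
    refine hc _ _ ?_
    obtain ⟨d, rfl⟩ := exists_add_of_le hik
    clear hu hv hkj hik
    induction d using sig_induction with
    | hP => infer_instance
    | h0 => rwa [add_zero, iter_of_le le_rfl]
    | hs d ih => rw [← add_assoc, iter_succ le_self_add]; exact hB _ _ ih

/-- The separation of high and low digits at position `t` survives the iteration, with `t` itself
moved along by the functions `C`. -/
theorem iter_hat_add (hC : ∀ i, StrictMono (C i)) {i U T t : M.Num} (hU : pow2 t ∣ U)
    (hT : T < pow2 t) {k : M.Num} (hik : i ≤ k) :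
    pow2 (iter C i t k) ∣ iter (hat C) i U k ∧ iter (hat C) i T k < pow2 (iter C i t k) ∧
      iter (hat C) i (U + T) k = iter (hat C) i U k + iter (hat C) i T k := by
  obtain ⟨d, rfl⟩ := exists_add_of_le hik
  clear hik
  induction d using sig_induction with
  | hP => infer_instance
  | h0 => simp only [add_zero, iter_of_le le_rfl, hU, hT, and_self]
  | hs d ih =>
    obtain ⟨h₁, h₂, h₃⟩ := ih
    simp only [← add_assoc, iter_succ (le_self_add (a := i))]
    refine ⟨dvd_hat (hC _) h₁, hat_lt (hC _) h₂, ?_⟩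
    rw [h₃, hat_add h₁ h₂]

theorem iter_hat_pow2 {i t k : M.Num} (hik : i ≤ k) :
    iter (hat C) i (pow2 t) k = pow2 (iter C i t k) := by
  obtain ⟨d, rfl⟩ := exists_add_of_le hik
  clear hik
  induction d using sig_induction with
  | hP => infer_instance
  | h0 => simp only [add_zero, iter_of_le le_rfl]
  | hs d ih => simp only [← add_assoc, iter_succ (le_self_add (a := i)), ih, hat_pow2]

theorem iter_hat_zero {i k : M.Num} : iter (hat C) i 0 k = 0 := by
  induction k using sig_induction with
  | hP => infer_instance
  | h0 => exact iter_of_le zero_le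
  | hs k ih =>
    rcases lt_or_ge k i with h | h
    · exact iter_of_le (num_succ_le.2 h)
    · rw [iter_succ h, ih, hat_zero]

theorem pow2_succ_iter_dvd (hC : ∀ i, StrictMono (C i)) {i U t : M.Num} (hU : pow2 (t + 1) ∣ U)
    {k : M.Num} (hik : i ≤ k) : pow2 (iter C i t k + 1) ∣ iter (hat C) i U k :=
  (pow2_dvd (num_succ_le.2 (iter_strictMono hC i k (num_lt_succ_self t)))).trans
    (iter_hat_add hC hU (pow2_pos _) hik).1

/-! ## Termination of Goodstein sequences -/

instance : Rec₄ (M := M) (fun _ _ i a => hat C i a - 1) := ⟨inferInstance⟩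

variable (C) in
/-- The Goodstein sequence with starting value `m`. -/
noncomputable def goodstein (m i : M.Num) : M.Num :=
  prec (fun u _ => u) (fun _ _ i a => hat C i a - 1) m 0 i

instance : Rec₂ (goodstein C) := ⟨by unfold goodstein; infer_instance⟩

theorem goodstein_zero (m : M.Num) : goodstein C m 0 = m := prec_zero _ _ _ _

theorem goodstein_succ (m i : M.Num) :
    goodstein C m (i + 1) = hat C i (goodstein C m i) - 1 := prec_succ _ _ _ _ _

theorem goodstein_succ_add_one {m i : M.Num} (h : goodstein C m i ≠ 0) :
    goodstein C m (i + 1) + 1 = hat C i (goodstein C m i) := by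
  rw [goodstein_succ, add_comm]
  refine num_add_sub ?_
  rw [← zero_add (1 : M.Num), num_succ_le]
  exact hat_pos h

theorem goodstein_lt {B : M.Num → M.Num} [Rec₁ B] (hC : ∀ i, StrictMono (C i))
    (hB : ∀ i, C i (B i) = B (i + 1)) {m : M.Num} (hm : m < pow2 (B 0)) (i : M.Num) :
    goodstein C m i < pow2 (B i) := by
  induction i using sig_induction with
  | hP => infer_instance
  | h0 => rwa [goodstein_zero]
  | hs i h =>
    rw [goodstein_succ, ← hB]
    exact tsub_le_self.trans_lt (hat_lt (hC i) h)

/-- The last summand of a value of the Goodstein sequence has been used up when a later value is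
divisible by the iterated image of that summand. -/
theorem goodstein_first_return (hC : ∀ i, StrictMono (C i)) {m j j' U t : M.Num}
    (h0 : ∀ i, goodstein C m i ≠ 0) (hU : pow2 (t + 1) ∣ U) (hG : goodstein C m j = U + pow2 t)
    (hj : j < j') (hlt : ∀ k, j < k → k < j' → val2 (goodstein C m k) < iter C j t k)
    (hle : iter C j t j' ≤ val2 (goodstein C m j')) :
    goodstein C m j' = iter (hat C) j U j' := by
  -- Directly after `j` the last summand has turned into a power of two minus one. From then on `T`
  -- is what is left of it. As long as `T` is positive, the subtraction of one affects only `T`; if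
  -- `T` were zero before `j'`, the last exponent would be too large for `hlt`.
  have key : ∀ d, j + 1 + d ≤ j' → ∃ T, goodstein C m (j + 1 + d) =
      iter (hat C) j U (j + 1 + d) + T ∧ T < pow2 (iter C j t (j + 1 + d)) := by
    intro d
    induction d using sig_induction with
    | hP => infer_instance
    | h0 =>
      intro _
      rw [add_zero, iter_succ le_rfl, iter_succ le_rfl, iter_of_le le_rfl, iter_of_le le_rfl]
      have h := goodstein_succ_add_one (h0 j)
      rw [hG, hat_add hU (pow2_lt_succ t), hat_pow2] at h
      obtain ⟨T, hT⟩ := exists_eq_succ (pow2_pos (C j t)).ne'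
      rw [hT, ← add_assoc] at h
      exact ⟨T, add_right_cancel h, hT ▸ num_lt_succ_self T⟩
    | hs d ih =>
      intro hd
      rw [← add_assoc] at hd ⊢
      have hjd : j ≤ j + 1 + d := le_self_add.trans le_self_add
      obtain ⟨T, hT, hTlt⟩ := ih (le_self_add.trans hd)
      have hT0 : T ≠ 0 := by
        rintro rfl
        refine not_le.2 (hlt (j + 1 + d) ?_ (num_succ_le.1 hd)) ?_
        · exact (num_lt_succ_self j).trans_le le_self_add
        · rw [le_val2_iff (h0 _), hT, add_zero]
          exact (pow2_dvd le_self_add).trans (pow2_succ_iter_dvd hC hU hjd)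
      have h := goodstein_succ_add_one (h0 (j + 1 + d))
      rw [hT, hat_add ((pow2_dvd le_self_add).trans (pow2_succ_iter_dvd hC hU hjd)) hTlt] at h
      obtain ⟨S, hS⟩ := exists_eq_succ (hat_pos (C := C) (i := j + 1 + d) hT0).ne'
      rw [hS, ← add_assoc, ← iter_succ (D := hat C) hjd] at h
      refine ⟨S, add_right_cancel h, ?_⟩
      rw [iter_succ hjd]
      refine lt_trans ?_ (hat_lt (hC _) hTlt)
      rw [hS]
      exact num_lt_succ_self S
  obtain ⟨d, rfl⟩ := exists_add_of_le (num_succ_le.2 hj)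
  obtain ⟨T, hT, hTlt⟩ := key d le_rfl
  -- At `j'` the power of two that exceeds `T` also divides it.
  have : T = 0 := by
    rw [le_val2_iff (h0 _), hT] at hle
    obtain ⟨q, rfl⟩ := num_dvd_cancel hle
      ((pow2_dvd le_self_add).trans (pow2_succ_iter_dvd hC hU hj.le))
    have : q < 1 := lt_of_mul_lt_mul_left (by rwa [mul_one]) zero_le
    rw [← zero_add (1 : M.Num), num_lt_succ] at this
    rw [le_antisymm this zero_le, mul_zero]
  rw [hT, this, add_zero]

theorem exists_goodstein_eq_zero {B : M.Num → M.Num} [Rec₁ B] (hC : ∀ i, StrictMono (C i))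
    (hB : ∀ i, C i (B i) = B (i + 1)) {m : M.Num} (hm : m < pow2 (B 0)) {i₀ : M.Num}
    (hret : ∀ j, i₀ ≤ j → ∃ j', j < j' ∧
      iter C j (val2 (goodstein C m j)) j' ≤ val2 (goodstein C m j')) :
    ∃ i, goodstein C m i = 0 := by
  by_contra! h0
  -- `U` consists of the digits of the value at `i₀` from position `t` on. At stage `j` all lower
  -- digits have been worked off and exactly the image of `U` is left.
  have key : ∀ t, ∃ j, i₀ ≤ j ∧ ∃ U, pow2 t ∣ U ∧ U ≤ goodstein C m i₀ ∧
      goodstein C m i₀ < U + pow2 t ∧ goodstein C m j = iter (hat C) i₀ U j := by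
    intro t
    induction t using sig_induction with
    | hP => infer_instance
    | h0 =>
      exact ⟨i₀, le_rfl, _, by rw [pow2_zero]; exact one_dvd _, le_rfl,
        by rw [pow2_zero]; exact num_lt_succ_self _, (iter_of_le le_rfl).symm⟩
    | hs t ih =>
      obtain ⟨j, hj, U, hU, hUu, huU, hG⟩ := ih
      by_cases hUt : pow2 (t + 1) ∣ U
      · exact ⟨j, hj, U, hUt, hUu, huU.trans_le (add_le_add_right (pow2_lt_succ t).le _), hG⟩
      · obtain ⟨V, rfl, hV⟩ := exists_sub_pow2 hU hUt
        obtain ⟨h₁, h₂, h₃⟩ := iter_hat_add hC hV (pow2_lt_succ t) hj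
        rw [h₃, iter_hat_pow2 hj] at hG
        have hdvd := pow2_succ_iter_dvd hC hV hj
        have hval : val2 (goodstein C m j) = iter C i₀ t j := by
          refine val2_eq (h0 j) ?_ fun h => ?_
          · rw [hG]
            exact dvd_add ((pow2_dvd le_self_add).trans hdvd) dvd_rfl
          · rw [hG] at h
            exact not_bit_of_dvd (num_dvd_cancel h hdvd) (num_lt_succ_self _) (bit_pow2.2 rfl)
        -- The digit at position `t` is present and is worked off at the first return after `j`.
        obtain ⟨j', ⟨hjj', hle⟩, hmin⟩ := exists_least (P := fun j' => j < j' ∧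
          iter C j (val2 (goodstein C m j)) j' ≤ val2 (goodstein C m j')) (by infer_instance)
          (hret j hj)
        refine ⟨j', hj.trans hjj'.le, V, hV, le_self_add.trans hUu, ?_, ?_⟩
        · rwa [pow2_succ, two_mul, ← add_assoc]
        · rw [← iter_iter hj hjj'.le]
          rw [hval] at hle hmin
          refine goodstein_first_return hC h0 hdvd hG hjj' (fun k hk hk' => ?_) hle
          have := hmin k hk'
          rw [not_and, not_le] at this
          exact this hk
  -- The value at `i₀` is below `2 ^ B i₀`, so no digits are left in `U`.
  obtain ⟨j, hj, U, ⟨q, rfl⟩, hUu, huU, hG⟩ := key (B i₀)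
  have : q < 1 := lt_of_mul_lt_mul_left
    (by rw [mul_one]; exact hUu.trans_lt (goodstein_lt hC hB hm i₀)) (zero_le (a := pow2 (B i₀)))
  rw [← zero_add (1 : M.Num), num_lt_succ] at this
  rw [le_antisymm this zero_le, mul_zero, iter_hat_zero] at hG
  exact h0 j hG

end Iteration

/-! ### Σ⁰₁ comprehension implies the extended Goodstein theorem -/

section Forward

variable {M : SecondOrderStructure.{u}} [RCA M]

theorem GoodsteinSystem.exists_rec {b c : Set M.Num} (h : M.GoodsteinSystem b c) :
    ∃ (B : M.Num → M.Num) (C : M.Num → M.Num → M.Num), Rec₁ B ∧ Rec₂ C ∧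
      (∀ i u, M.App b i u ↔ u = B i) ∧ (∀ i n k, M.FamApp c i n k ↔ n < B i ∧ k = C i n) ∧
      (∀ i, StrictMono (C i)) ∧ ∀ i, C i (B i) = B (i + 1) := by
  obtain ⟨B, _, hB⟩ := h.isFun.exists_rec
  -- Beyond `B i` the functions are continued by the translation that takes `B i` to `B (i + 1)`.
  -- This makes them total and keeps them strictly increasing.
  have htot : ∀ i n, ∃ k, (n < B i ∧ M.FamApp c i n k) ∨ ¬ n < B i ∧ k = B (i + 1) + (n - B i) := by
    intro i n
    by_cases hn : n < B i
    · obtain ⟨k, hk, -⟩ := h.isFamily.total i n _ ((hB _ _).2 rfl) hn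
      exact ⟨k, .inl ⟨hn, hk⟩⟩
    · exact ⟨_, .inr ⟨hn, rfl⟩⟩
  choose C hC using htot
  have hfam : ∀ i n k, M.FamApp c i n k ↔ n < B i ∧ k = C i n := by
    intro i n k
    constructor
    · intro hk
      have hn : n < B i := by
        obtain ⟨i', n', k', u, hx, hu, hn⟩ := h.isFamily.domain _ hk
        obtain ⟨h₁, rfl⟩ := pair_inj.1 hx
        obtain ⟨rfl, rfl⟩ := pair_inj.1 h₁
        rwa [(hB _ _).1 hu] at hn
      rcases hC i n with ⟨-, hk'⟩ | h'
      · exact ⟨hn, (h.isFamily.total i n _ ((hB _ _).2 rfl) hn).unique hk hk'⟩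
      · exact (h'.1 hn).elim
    · rintro ⟨hn, rfl⟩
      rcases hC i n with ⟨-, hk'⟩ | h'
      · exact hk'
      · exact (h'.1 hn).elim
  have hge : ∀ i n, B i ≤ n → C i n = B (i + 1) + (n - B i) := by
    intro i n hn
    rcases hC i n with h' | h'
    · exact (not_lt.2 hn h'.1).elim
    · exact h'.2
  refine ⟨B, C, ‹_›, ⟨.of_graph (fun v a => (v 1 < B (v 0) ∧
    M.pair (M.pair (v 0) (v 1)) a ∈ (⟨c, h.isFamily.mem_sets⟩ : M.sets).1) ∨
    ¬ v 1 < B (v 0) ∧ a = B (v 0 + 1) + (v 1 - B (v 0))) fun v a => ?_⟩, hB, hfam,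
    fun i x y hxy => ?_, fun i => ?_⟩
  · constructor
    · rintro rfl
      exact hC _ _
    · rintro (⟨hn, hk⟩ | ⟨hn, rfl⟩)
      · exact ((hfam _ _ _).1 hk).2.symm
      · exact hge _ _ (not_lt.1 hn)
  · rcases lt_or_ge y (B i) with hy | hy
    · exact h.strictMono i x y _ _ hxy ((hfam _ _ _).2 ⟨hxy.trans hy, rfl⟩)
        ((hfam _ _ _).2 ⟨hy, rfl⟩)
    · rw [hge i y hy]
      rcases lt_or_ge x (B i) with hx | hx
      · exact (h.isFamily.codomain i x _ _ ((hfam _ _ _).2 ⟨hx, rfl⟩) ((hB _ _).2 rfl)).trans_le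
          le_self_add
      · rw [hge i x hx]
        exact add_lt_add_right (tsub_lt_tsub_right_of_le hx hxy) _
  · rw [hge i _ le_rfl, tsub_self, add_zero]

theorem ExtendedGoodstein.of_comprehension
    (hM : ∀ P : M.Num → Prop, Sig M (fun v : Fin 1 → M.Num => P (v 0)) → {n | P n} ∈ M.sets) :
    M.ExtendedGoodstein := by
  intro b c hbc m w p hw hp hm
  obtain ⟨B, C, _, _, hB, hFam, hC, hCB⟩ := hbc.exists_rec
  rw [pow_iff.1 hp, (hB _ _).1 hw] at hm
  have hG : Rec₁ (goodstein C m) := ⟨inferInstance⟩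
  refine ⟨graphOf (goodstein C m), ⟨isFun_graphOf _, app_graphOf.2 (goodstein_zero m).symm,
    fun i u v hu hv => ?_⟩, ?_⟩
  · rw [app_graphOf] at hu hv
    subst hu hv
    rcases eq_or_ne (goodstein C m i) 0 with h | h
    · exact .inl ⟨h, by rw [goodstein_succ, h, hat_zero, tsub_eq_zero_of_le zero_le]⟩
    · exact .of_eq_hat hB (fun i n hn => (hFam _ _ _).2 ⟨hn, rfl⟩) h (goodstein_lt hC hCB hm i)
        (goodstein_succ_add_one h)
  · simp only [app_graphOf]
    by_contra! h0
    replace h0 : ∀ i, goodstein C m i ≠ 0 := fun i => (h0 i).symm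
    -- The indices with a later return; only here is Σ⁰₁ comprehension used. The relevant set for
    -- the recurrence condition is the complement.
    have hY := hM (fun i => ∃ j, i < j ∧
      iter C i (val2 (goodstein C m i)) j ≤ val2 (goodstein C m j)) (by infer_instance)
    have hY' : {i | ¬ i ∈ (⟨_, hY⟩ : M.sets).1} ∈ M.sets :=
      comprehension (P := fun i => ¬ i ∈ (⟨_, hY⟩ : M.sets).1) inferInstance
    by_cases hinf : ∀ n, ∃ k ∈ {i | ¬ i ∈ (⟨_, hY⟩ : M.sets).1}, n < k
    · have hd : Rec₁ (fun i => val2 (goodstein C m i)) := ⟨inferInstance⟩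
      have hval : ∀ i u v, M.App (graphOf fun i => val2 (goodstein C m i)) i u → M.App b i v →
          u < v := by
        intro i u v hu hv
        rw [app_graphOf] at hu
        rw [hu, (hB _ _).1 hv]
        refine lt_of_pow2_lt (lt_of_le_of_lt ?_ (goodstein_lt hC hCB hm i))
        obtain ⟨q, hq⟩ := (val2_spec (h0 i)).1
        conv_rhs => rw [hq]
        refine le_mul_of_one_le_right zero_le ?_
        rw [← zero_add (1 : M.Num), num_succ_le, pos_iff_ne_zero]
        rintro rfl
        exact h0 i (by rw [hq, mul_zero])
      obtain ⟨i, hi, j, hj, hij, x, y, z, hx, hy, hz, hyz⟩ := hbc.recurrent _ _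
        (isFun_graphOf fun i => val2 (goodstein C m i)) hval ⟨hY', hinf⟩
      rw [app_graphOf] at hx hz
      refine hi ⟨j, hij, ?_⟩
      rw [← hx, ← hz, ← hy.eq_iter (fun i n k h => ((hFam _ _ _).1 h).2) hij.le]
      exact le_iff_lt_or_eq.2 hyz
    -- Only finitely many indices lack a return, so beyond `N` all last summands get worked off.
    · push Not at hinf
      obtain ⟨N, hN⟩ := hinf
      obtain ⟨i, hi⟩ := exists_goodstein_eq_zero hC hCB hm (i₀ := N + 1) fun j hj => by
        by_contra hj'
        exact not_lt.2 (hN j hj') (num_succ_le.1 hj)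
      exact h0 i hi

end Forward

end SecondOrderStructure

namespace SecondOrderStructure

/-! ## Families of functions as sets -/

section Family

variable {M : SecondOrderStructure.{u}} [RCA M]

/-- The set that codes the restrictions of the functions `C i` to the numbers below `B i`. -/
def familyOf (B : M.Num → M.Num) (C : M.Num → M.Num → M.Num) : Set M.Num :=
  {x | ∃ i, i < x + 1 ∧ ∃ n, n < x + 1 ∧ n < B i ∧ x = M.pair (M.pair i n) (C i n)}

variable {B : M.Num → M.Num} {C : M.Num → M.Num → M.Num}

theorem famApp_familyOf {i n k : M.Num} :
    M.FamApp (familyOf B C) i n k ↔ n < B i ∧ k = C i n := by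
  constructor
  · rintro ⟨i', -, n', -, h, hx⟩
    obtain ⟨h₁, rfl⟩ := pair_inj.1 hx
    obtain ⟨rfl, rfl⟩ := pair_inj.1 h₁
    exact ⟨h, rfl⟩
  · rintro ⟨h, rfl⟩
    exact ⟨i, num_lt_succ.2 ((left_le_pair _ _).trans (left_le_pair _ _)),
      n, num_lt_succ.2 ((right_le_pair _ _).trans (left_le_pair _ _)), h, rfl⟩

variable [Rec₁ B] [Rec₂ C]

theorem isFamily_familyOf (h : ∀ i n, n < B i → C i n < B (i + 1)) :
    M.IsFamily (graphOf B) (familyOf B C) where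
  mem_sets := comprehension inferInstance
  domain := by
    rintro x ⟨i, -, n, -, hn, hx⟩
    exact ⟨i, n, _, _, hx, app_graphOf.2 rfl, hn⟩
  total i n u hu hn := by
    rw [app_graphOf] at hu
    exact ⟨C i n, famApp_familyOf.2 ⟨hu ▸ hn, rfl⟩, fun k hk => (famApp_familyOf.1 hk).2⟩
  codomain i n k v hk hv := by
    rw [app_graphOf] at hv
    obtain ⟨hn, rfl⟩ := famApp_familyOf.1 hk
    exact hv ▸ h i n hn

/-- If the extended Goodstein theorem holds, then a Goodstein sequence that does not terminate
yields a witness for the failure of the condition on Goodstein systems. -/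
theorem ExtendedGoodstein.exists_descending (hM : M.ExtendedGoodstein) (hB : Monotone B)
    (hpos : 0 < B 0) (hBC : ∀ i n, n < B i → C i n < B (i + 1)) (hC : ∀ i, StrictMono (C i))
    {m : M.Num} (hm : m < pow2 (B 0)) (hne : ∀ G : M.Num → M.Num, Rec₁ G → G 0 = m →
      (∀ i, G i ≠ 0 → G (i + 1) + 1 = hat C i (G i)) → ∀ i, G i ≠ 0) :
    ∃ D : M.Num → M.Num, Rec₁ D ∧ (∀ i, D i < B i) ∧ ∃ Y : M.sets,
      (∀ n, ∃ k ∈ (Y : Set M.Num), n < k) ∧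
      ∀ i ∈ (Y : Set M.Num), ∀ j ∈ (Y : Set M.Num), i < j → D j < iter C i (D i) j := by
  by_contra! hcon
  have hsys : M.GoodsteinSystem (graphOf B) (familyOf B C) := by
    refine ⟨isFun_graphOf B, fun i j u v hij hu hv => ?_, fun u hu => ?_, isFamily_familyOf hBC,
      fun i n n' k k' hn hk hk' => ?_, fun d Y hd hdB hY => ?_⟩
    · rw [app_graphOf] at hu hv
      rw [hu, hv]
      exact le_iff_lt_or_eq.1 (hB (le_iff_lt_or_eq.2 hij))
    · rw [app_graphOf] at hu
      rwa [hu]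
    · rw [(famApp_familyOf.1 hk).2, (famApp_familyOf.1 hk').2]
      exact hC i hn
    · obtain ⟨D, hD, hdD⟩ := hd.exists_rec
      have hDB : ∀ i, D i < B i := fun i => hdB i _ _ ((hdD _ _).2 rfl) (app_graphOf.2 rfl)
      obtain ⟨i, hi, j, hj, hij, h⟩ := hcon D hD hDB ⟨Y, hY.1⟩ hY.2
      exact ⟨i, hi, j, hj, hij, _, _, _, (hdD _ _).2 rfl,
        iterApp_iter (fun i n hn => famApp_familyOf.2 ⟨hn, rfl⟩) hBC (hDB i) j,
        (hdD _ _).2 rfl, le_iff_lt_or_eq.1 h⟩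
  obtain ⟨G', ⟨hfun, hstart, hstep⟩, i, hi⟩ :=
    hM _ _ hsys m _ _ (app_graphOf.2 rfl) (pow_iff.2 rfl) hm
  obtain ⟨G, hG, hGG⟩ := hfun.exists_rec
  simp only [hGG] at hstart hstep hi
  refine hne G hG hstart.symm (fun i h => ?_) i hi.symm
  exact (hstep i _ _ rfl rfl).eq_hat (fun i n k h => (famApp_familyOf.1 h).2) h

/-- The part of `u` above position `p` is multiplied by four; the contribution of the lower digits
is dropped. -/
theorem mul_le_hat {i p q u : M.Num} (hC : ∀ x, p ≤ x → C i x = x + 2) (h : pow2 p * q ≤ u) :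
    pow2 (p + 2) * q ≤ hat C i u := by
  obtain ⟨k, r, rfl, hr⟩ := exists_div (pow2_pos p) u
  have hk := (mul_le_mul_add_iff hr).1 h
  rw [hat_add (dvd_mul_right _ _) hr, hat_eq_four_mul (dvd_mul_right _ _) hC, ← mul_assoc,
    ← pow2_add_two]
  exact (mul_le_mul_right hk _).trans le_self_add

end Family

/-! ## The Goodstein system for an enumeration -/

section Enumeration

variable {M : SecondOrderStructure.{u}} [RCA M] (Θ : M.Num → M.Num → Prop) [Dl₂ Θ]

/-- The number `n` has been enumerated before stage `s`. -/
def Stage (s n : M.Num) : Prop := ∃ w, w < s ∧ Θ n w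

instance : Dl₂ (Stage Θ) := ⟨by unfold Stage; infer_instance⟩

variable {Θ} in
theorem Stage.mono {s t n : M.Num} (h : Stage Θ s n) (hst : s ≤ t) : Stage Θ t n := by
  obtain ⟨w, hw, h⟩ := h
  exact ⟨w, hw.trans_le hst, h⟩

/-- The least number below `l` that is enumerated at stage `i` (and `l` if there is none). -/
noncomputable def cut (i l : M.Num) : M.Num :=
  least fun n => n = l ∨ Stage Θ (i + 1) n ∧ ¬ Stage Θ i n

instance : Rec₂ (cut Θ) :=
  ⟨Rec.least (P := fun (v : Fin 2 → M.Num) n => n = v 1 ∨ Stage Θ (v 0 + 1) n ∧ ¬ Stage Θ (v 0) n)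
    inferInstance fun _ => ⟨_, .inl rfl⟩⟩

theorem cut_spec (i l : M.Num) :
    (cut Θ i l = l ∨ cut Θ i l < l ∧ Stage Θ (i + 1) (cut Θ i l) ∧ ¬ Stage Θ i (cut Θ i l)) ∧
      ∀ n, n < cut Θ i l → Stage Θ (i + 1) n → Stage Θ i n := by
  obtain ⟨h₁, h₂⟩ := least_spec (P := fun n => n = l ∨ Stage Θ (i + 1) n ∧ ¬ Stage Θ i n)
    (by infer_instance) ⟨l, .inl rfl⟩
  have hle : cut Θ i l ≤ l := not_lt.1 fun h => h₂ l h (.inl rfl)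
  refine ⟨?_, fun n hn h => by_contra fun h' => h₂ n hn (.inr ⟨h, h'⟩)⟩
  rcases hle.eq_or_lt with h | h
  · exact .inl h
  · exact .inr ⟨h, h₁.resolve_left h.ne⟩

instance : Rec₄ (M := M) (fun _ _ i l => cut Θ i l + 1) := ⟨inferInstance⟩

/-- The height of the stack of candidates at stage `i`. -/
noncomputable def height (i : M.Num) : M.Num :=
  prec (fun _ _ => 0) (fun _ _ i l => cut Θ i l + 1) 0 0 i

instance : Rec₁ (height Θ) := ⟨by unfold height; infer_instance⟩

theorem height_zero : height Θ 0 = 0 := prec_zero _ _ _ _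

theorem height_succ (i : M.Num) : height Θ (i + 1) = cut Θ i (height Θ i) + 1 :=
  prec_succ _ _ _ _ _

open Classical in
/-- The bound for the part of the stack that is kept at stage `i`. -/
noncomputable def keep (i : M.Num) : M.Num :=
  -- After a proper cut at k the bound 2k+1 is the distance of the digit of k, which is still moved.
  -- Otherwise the bound is twice the height, the distance of the marker.
  2 * cut Θ i (height Θ i) + if cut Θ i (height Θ i) < height Θ i then 1 else 0

open Classical in
instance : Rec₁ (keep Θ) := ⟨by unfold keep; infer_instance⟩

theorem keep_of_eq {i : M.Num} (h : cut Θ i (height Θ i) = height Θ i) :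
    keep Θ i = 2 * height Θ i := by
  rw [keep, if_neg h.not_lt, add_zero, h]

theorem keep_of_lt {i : M.Num} (h : cut Θ i (height Θ i) < height Θ i) :
    keep Θ i = 2 * cut Θ i (height Θ i) + 1 := by
  rw [keep, if_pos h]

theorem keep_le (i : M.Num) : keep Θ i ≤ 2 * height Θ i := by
  rcases (cut_spec Θ i (height Θ i)).1 with h | ⟨h, -⟩
  · exact (keep_of_eq Θ h).le
  · rw [keep_of_lt Θ h]
    simp only [Diff.transfer] at *
    linarith

theorem height_succ_le (i : M.Num) : height Θ (i + 1) ≤ height Θ i + 1 := by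
  rw [height_succ]
  rcases (cut_spec Θ i (height Θ i)).1 with h | ⟨h, -⟩
  · rw [h]
  · exact add_le_add_left h.le 1

theorem height_le (i : M.Num) : height Θ i ≤ i := by
  induction i using sig_induction with
  | hP => infer_instance
  | h0 => rw [height_zero]
  | hs i h => exact (height_succ_le Θ i).trans (add_le_add_left h 1)

open Classical in
/-- The exponent `x` is increased by two when its distance from `2 * i` is small. -/
noncomputable def shift (i x : M.Num) : M.Num := if 2 * i ≤ x + keep Θ i then x + 2 else x

open Classical in
instance : Rec₂ (shift Θ) := ⟨by unfold shift; infer_instance⟩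

theorem shift_of_le {i x : M.Num} (h : 2 * i ≤ x + keep Θ i) : shift Θ i x = x + 2 := if_pos h

theorem shift_of_lt {i x : M.Num} (h : x + keep Θ i < 2 * i) : shift Θ i x = x :=
  if_neg (not_le.2 h)

theorem shift_strictMono (i : M.Num) : StrictMono (shift Θ i) := by
  intro x y hxy
  rcases le_or_gt (2 * i) (x + keep Θ i) with h | h
  · rw [shift_of_le Θ h, shift_of_le Θ (h.trans (add_le_add_left hxy.le _))]
    exact add_lt_add_left hxy 2
  · rw [shift_of_lt Θ h]
    rcases le_or_gt (2 * i) (y + keep Θ i) with h' | h'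
    · rw [shift_of_le Θ h']
      exact hxy.trans_le le_self_add
    · rwa [shift_of_lt Θ h']

theorem shift_lt {i x : M.Num} (h : x < 2 * i + 1) : shift Θ i x < 2 * (i + 1) + 1 := by
  rcases le_or_gt (2 * i) (x + keep Θ i) with h' | h'
  · rw [shift_of_le Θ h']
    simp only [Diff.transfer] at *
    linarith
  · rw [shift_of_lt Θ h']
    simp only [Diff.transfer] at *
    linarith

open Classical in
instance : Rec₄ (M := M) (fun s _ n a => 4 * a + if Stage Θ s n then 0 else 1) := ⟨inferInstance⟩

open Classical in
/-- The number with base four digits that indicate which numbers below `n` have not been enumerated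
before stage `s`. -/
noncomputable def missing (s n : M.Num) : M.Num :=
  prec (fun _ _ => 0) (fun s _ n a => 4 * a + if Stage Θ s n then 0 else 1) s 0 n

instance : Rec₂ (missing Θ) := ⟨by unfold missing; infer_instance⟩

theorem missing_zero (s : M.Num) : missing Θ s 0 = 0 := prec_zero _ _ _ _

variable {Θ}

theorem missing_succ_of {s n : M.Num} (h : Stage Θ s n) :
    missing Θ s (n + 1) = 4 * missing Θ s n :=
  (prec_succ _ _ _ _ _).trans (by rw [if_pos h, add_zero]; rfl)

theorem missing_succ_of_not {s n : M.Num} (h : ¬ Stage Θ s n) :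
    missing Θ s (n + 1) = 4 * missing Θ s n + 1 :=
  (prec_succ _ _ _ _ _).trans (by rw [if_neg h]; rfl)

theorem four_mul_missing_le (s n : M.Num) : 4 * missing Θ s n ≤ missing Θ s (n + 1) := by
  by_cases h : Stage Θ s n
  · rw [missing_succ_of h]
  · rw [missing_succ_of_not h]
    exact le_self_add

theorem missing_succ_le (s n : M.Num) : missing Θ s (n + 1) ≤ 4 * missing Θ s n + 1 := by
  by_cases h : Stage Θ s n
  · rw [missing_succ_of h]
    exact le_self_add
  · rw [missing_succ_of_not h]

theorem missing_antitone {s t : M.Num} (h : s ≤ t) (n : M.Num) : missing Θ t n ≤ missing Θ s n := by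
  induction n using sig_induction with
  | hP => infer_instance
  | h0 => rw [missing_zero, missing_zero]
  | hs n ih =>
    by_cases hs : Stage Θ s n
    · rw [missing_succ_of hs, missing_succ_of (hs.mono h)]
      exact mul_le_mul_right ih 4
    · rw [missing_succ_of_not hs]
      exact (missing_succ_le t n).trans (add_le_add_left (mul_le_mul_right ih 4) 1)

theorem pow2_mul_missing_le (s n e : M.Num) :
    pow2 (2 * e) * missing Θ s n ≤ missing Θ s (n + e) := by
  induction e using sig_induction with
  | hP => infer_instance
  | h0 => rw [mul_zero, pow2_zero, one_mul, add_zero]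
  | hs e ih =>
    rw [← add_assoc, mul_add, mul_one, pow2_add_two, mul_assoc]
    exact (mul_le_mul_right ih 4).trans (four_mul_missing_le _ _)

/-- The Goodstein sequence for the enumeration does not reach zero. -/
theorem missing_le_of_step {G : M.Num → M.Num} [Rec₁ G] (h0 : G 0 = 1)
    (hG : ∀ i, G i ≠ 0 → G (i + 1) + 1 = hat (shift Θ) i (G i)) (i : M.Num) :
    pow2 (2 * (i - height Θ i)) * (2 * missing Θ i (height Θ i) + 1) ≤ G i := by
  induction i using sig_induction with
  | hP => infer_instance
  | h0 =>
    rw [h0, height_zero, tsub_self, missing_zero, mul_zero, pow2_zero, zero_add, one_mul]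
  | hs i ih =>
    have hne : G i ≠ 0 := by
      refine (lt_of_lt_of_le (mul_pos (pow2_pos _) ?_) ih).ne'
      exact zero_lt_one.trans_le le_add_self
    have hstep := hG i hne
    obtain ⟨d, hd⟩ := exists_add_of_le (height_le Θ i)
    rw [tsub_eq_of_eq_add (hd.trans (add_comm _ _))] at ih
    have hanti := missing_antitone (Θ := Θ) (num_lt_succ_self i).le
    have hpos := one_le_pow2 (2 * d)
    rw [height_succ]
    rcases (cut_spec Θ i (height Θ i)).1 with h | ⟨h, h₁, h₂⟩
    -- A push. With X = 2^(2d) and b the old value of `missing`, the estimate is 4X(2b+1) - 1 ≥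
    -- X(2(4b+1)+1), which holds since X ≥ 1.
    · have hv := mul_le_hat (C := shift Θ) (i := i) (fun x hx => shift_of_le Θ ?_) ih
      · rw [← hstep, pow2_add_two] at hv
        rw [h, tsub_eq_of_eq_add (c := d) (by conv_lhs => rw [hd]
                                              ring)]
        have hm := (missing_succ_le (Θ := Θ) (i + 1) (height Θ i)).trans
          (add_le_add_left (mul_le_mul_right (hanti _) 4) 1)
        have hm' := mul_le_mul_right hm (pow2 (2 * d))
        generalize missing Θ (i + 1) (height Θ i + 1) = a at *
        generalize missing Θ i (height Θ i) = b at *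
        generalize pow2 (2 * d) = X at *
        simp only [Diff.transfer] at hv hm' hpos ⊢
        linarith
      · rw [keep_of_eq Θ h]
        simp only [Diff.transfer] at *
        linarith
    -- A proper cut at k. The digits above k and the old marker are discarded. With X = 2^(2(d+e)+1)
    -- and b = `missing Θ i k` the estimate is 4X(4b+1) - 1 ≥ 2X(8b+1), where the digit of k
    -- accounts for the surplus.
    · obtain ⟨e, he⟩ := exists_add_of_le (num_succ_le.2 h)
      have hme := pow2_mul_missing_le (Θ := Θ) i (cut Θ i (height Θ i) + 1) e
      rw [← he, missing_succ_of_not h₂] at hme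
      have hpow : pow2 (2 * (d + e) + 1) = 2 * pow2 (2 * d) * pow2 (2 * e) := by
        rw [pow2_succ, mul_add, pow2_add, mul_assoc]
      have hu : pow2 (2 * (d + e) + 1) * (4 * missing Θ i (cut Θ i (height Θ i)) + 1) ≤ G i := by
        refine le_trans ?_ ih
        rw [hpow]
        have := mul_le_mul_right hme (pow2 (2 * d))
        simp only [Diff.transfer] at this hpos ⊢
        linarith
      have hv := mul_le_hat (C := shift Θ) (i := i) (fun x hx => shift_of_le Θ ?_) hu
      · rw [← hstep, pow2_add_two] at hv
        rw [missing_succ_of h₁, tsub_eq_of_eq_add (c := d + e + 1) (by conv_lhs => rw [hd, he]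
                                                                       ring)]
        have hZ : pow2 (2 * (d + e + 1)) = 2 * pow2 (2 * (d + e) + 1) := by
          rw [← pow2_succ]
          exact congrArg _ (by ring)
        rw [hZ]
        have hm := mul_le_mul_right (hanti (cut Θ i (height Θ i))) (pow2 (2 * (d + e) + 1))
        have hpos := one_le_pow2 (2 * (d + e) + 1)
        generalize pow2 (2 * (d + e) + 1) = X at *
        simp only [Diff.transfer] at hv hm hpos ⊢
        linarith
      · rw [keep_of_lt Θ h]
        simp only [Diff.transfer] at *
        linarith

/-! ### Decision of the enumerated class -/

open Classical in
variable (Θ) in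
/-- The effect of the functions `shift Θ i` on the distance from `2 * i`. -/
noncomputable def lift (i y : M.Num) : M.Num := if y ≤ keep Θ i then y else y + 2

open Classical in
instance : Rec₂ (lift Θ) := ⟨by unfold lift; infer_instance⟩

theorem lift_of_le {i y : M.Num} (h : y ≤ keep Θ i) : lift Θ i y = y := if_pos h

theorem lift_of_lt {i y : M.Num} (h : keep Θ i < y) : lift Θ i y = y + 2 := if_neg (not_le.2 h)

theorem le_lift (i y : M.Num) : y ≤ lift Θ i y := by
  rcases le_or_gt y (keep Θ i) with h | h
  · rw [lift_of_le h]
  · rw [lift_of_lt h]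
    exact le_self_add

theorem shift_add_lift {i x y : M.Num} (h : x + y = 2 * i) :
    shift Θ i x + lift Θ i y = 2 * (i + 1) := by
  rcases le_or_gt y (keep Θ i) with h' | h'
  · rw [lift_of_le h', shift_of_le]
    · rw [add_right_comm, h]
      ring
    · rw [← h]
      exact add_le_add_right h' _
  · rw [lift_of_lt h', shift_of_lt]
    · rw [← add_assoc, h]
      ring
    · rw [← h]
      exact add_lt_add_right h' _

theorem iter_shift_add_iter_lift {i x y : M.Num} (h : x + y = 2 * i) (d : M.Num) :
    iter (shift Θ) i x (i + d) + iter (lift Θ) i y (i + d) = 2 * (i + d) := by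
  induction d using sig_induction with
  | hP => infer_instance
  | h0 => rwa [add_zero, iter_of_le le_rfl, iter_of_le le_rfl]
  | hs d ih => rw [← add_assoc, iter_succ le_self_add, iter_succ le_self_add, shift_add_lift ih]

theorem le_iter_lift (i y d : M.Num) : y ≤ iter (lift Θ) i y (i + d) := by
  induction d using sig_induction with
  | hP => infer_instance
  | h0 => rw [add_zero, iter_of_le le_rfl]
  | hs d ih => rw [← add_assoc, iter_succ le_self_add]; exact ih.trans (le_lift _ _)

/-- A distance beyond the stack is never caught up: it grows by two, while the height grows by at
most one. -/
theorem lift_eq_of_height_lt {i y : M.Num} (h : 2 * height Θ i < y) :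
    lift Θ i y = y + 2 ∧ 2 * height Θ (i + 1) < y + 2 := by
  refine ⟨lift_of_lt ((keep_le Θ i).trans_lt h), ?_⟩
  have := height_succ_le Θ i
  simp only [Diff.transfer] at *
  linarith

theorem iter_lift_of_height_lt {i y : M.Num} (h : 2 * height Θ i < y) (d : M.Num) :
    iter (lift Θ) i y (i + d) = y + 2 * d ∧ 2 * height Θ (i + d) < y + 2 * d := by
  induction d using sig_induction with
  | hP => infer_instance
  | h0 => rw [add_zero, iter_of_le le_rfl, mul_zero, add_zero]; exact ⟨rfl, h⟩
  | hs d ih =>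
    rw [← add_assoc, iter_succ le_self_add, ih.1, mul_add, mul_one, ← add_assoc]
    exact lift_eq_of_height_lt ih.2

/-- As long as cuts occur above `n` only, the number `n` stays on the stack and is not enumerated. A
cut at or below `n` brings the height down to at most `n + 1` and pushes the distance off the stack,
where it remains. -/
theorem iter_lift_of_not_stage {i y n : M.Num} (hn : n < height Θ i) (hy : 2 * n + 1 < y)
    (hs : ¬ Stage Θ i n) (d : M.Num) :
    2 * height Θ (i + d) < iter (lift Θ) i y (i + d) ∨
      n < height Θ (i + d) ∧ ¬ Stage Θ (i + d) n ∧ 2 * n + 1 < iter (lift Θ) i y (i + d) := by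
  induction d using sig_induction with
  | hP => infer_instance
  | h0 => rw [add_zero, iter_of_le le_rfl]; exact .inr ⟨hn, hs, hy⟩
  | hs d ih =>
    rw [← add_assoc, iter_succ le_self_add]
    generalize i + d = j at *
    generalize iter (lift Θ) i y j = z at *
    rcases ih with h | ⟨h₁, h₂, h₃⟩
    · obtain ⟨h₁, h₂⟩ := lift_eq_of_height_lt h
      rw [h₁]
      exact .inl h₂
    · obtain ⟨hc, hc'⟩ := cut_spec Θ j (height Θ j)
      rw [height_succ]
      rcases lt_or_ge n (cut Θ j (height Θ j)) with hnc | hnc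
      · exact .inr ⟨hnc.trans (num_lt_succ_self _), fun h => h₂ (hc' n hnc h),
          h₃.trans_le (le_lift _ _)⟩
      -- The cut is at most `n`, so twice the new height is at most `2 * n + 2`, whereas the
      -- distance exceeds `2 * n + 1` and is increased by two.
      · left
        have hlt := hnc.trans_lt h₁
        rw [lift_of_lt]
        · simp only [Diff.transfer] at *
          linarith
        · rw [keep_of_lt Θ hlt]
          simp only [Diff.transfer] at *
          linarith

theorem exists_decision (D : M.Num → M.Num) [Rec₁ D] (hD : ∀ i, D i < 2 * i + 1) (Y : M.sets)
    (hY : ∀ n, ∃ k ∈ (Y : Set M.Num), n < k)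
    (hdesc : ∀ i ∈ (Y : Set M.Num), ∀ j ∈ (Y : Set M.Num), i < j → D j < iter (shift Θ) i (D i) j) :
    {n | ∃ w, Θ n w} ∈ M.sets := by
  have hDy : ∀ i, D i + (2 * i - D i) = 2 * i := fun i => num_add_sub (num_lt_succ.1 (hD i))
  -- Passing to distances from `2 * i` turns the descent of `D` into an ascent.
  have hlt : ∀ i ∈ (Y : Set M.Num), ∀ d, i + d ∈ (Y : Set M.Num) → 0 < d →
      iter (lift Θ) i (2 * i - D i) (i + d) < 2 * (i + d) - D (i + d) := by
    intro i hi d hid hd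
    have h₁ := hdesc i hi _ hid (lt_add_of_pos_right i hd)
    have h₂ := iter_shift_add_iter_lift (Θ := Θ) (hDy i) d
    have h₃ := hDy (i + d)
    generalize 2 * (i + d) - D (i + d) = z at *
    generalize 2 * i - D i = y at *
    simp only [Diff.transfer] at h₁ h₂ h₃ ⊢
    linarith
  have hnext : ∀ i, ∃ d, i + d ∈ (Y : Set M.Num) ∧ 0 < d := by
    intro i
    obtain ⟨j, hj, hij⟩ := hY i
    obtain ⟨d, rfl⟩ := exists_add_of_le hij.le
    exact ⟨d, hj, pos_of_lt_add_right hij⟩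
  -- Beyond the stack every step adds two to the distance, which means that the exponent is fixed.
  -- The next index in `Y` is then of the same kind with a smaller value of `D`, against the choice
  -- of a least value.
  have hle : ∀ i ∈ (Y : Set M.Num), 2 * i - D i ≤ 2 * height Θ i := by
    by_contra! hex
    obtain ⟨i, hi, hi'⟩ := hex
    obtain ⟨a, ⟨i, hi, hi', rfl⟩, hmin⟩ := sig_exists_least
      (P := fun a => ∃ i, i ∈ (Y : Set M.Num) ∧ 2 * height Θ i < 2 * i - D i ∧ D i = a)
      (by infer_instance) ⟨_, i, hi, hi', rfl⟩
    obtain ⟨d, hid, hd⟩ := hnext i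
    obtain ⟨h₁, h₂⟩ := iter_lift_of_height_lt hi' d
    have h₃ := hlt i hi d hid hd
    refine hmin (D (i + d)) ?_ ⟨i + d, hid, h₂.trans (h₁ ▸ h₃), rfl⟩
    rw [h₁] at h₃
    have h₄ := hDy i
    have h₅ := hDy (i + d)
    generalize 2 * (i + d) - D (i + d) = z at *
    generalize 2 * i - D i = y at *
    simp only [Diff.transfer] at h₃ h₄ h₅ ⊢
    linarith
  have hunb : ∀ N, ∃ i, i ∈ (Y : Set M.Num) ∧ N < 2 * i - D i := by
    intro N
    induction N using sig_induction with
    | hP => infer_instance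
    | h0 =>
      obtain ⟨i, hi, -⟩ := hY 0
      obtain ⟨d, hid, hd⟩ := hnext i
      exact ⟨i + d, hid, zero_le.trans_lt (hlt i hi d hid hd)⟩
    | hs N ih =>
      obtain ⟨i, hi, hN⟩ := ih
      obtain ⟨d, hid, hd⟩ := hnext i
      exact ⟨i + d, hid, (num_succ_le.2 hN).trans_lt
        ((le_iter_lift _ _ _).trans_lt (hlt i hi d hid hd))⟩
  -- If `n` were enumerated with witness `w`, then at an index of `Y` beyond `i + w` the distance
  -- would exceed the stack, contrary to `hle`.
  have hdec : ∀ i ∈ (Y : Set M.Num), ∀ n, 2 * n + 1 < 2 * i - D i → ¬ Stage Θ i n →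
      ¬ ∃ w, Θ n w := by
    rintro i hi n hn hs ⟨w, hw⟩
    have hn' : n < height Θ i := by
      have := hn.trans_le (hle i hi)
      simp only [Diff.transfer] at this ⊢
      linarith
    obtain ⟨j, hj, hij⟩ := hY (i + w)
    obtain ⟨d, rfl⟩ := exists_add_of_le (le_self_add.trans hij.le)
    have hd : w < d := lt_of_add_lt_add_left hij
    rcases iter_lift_of_not_stage hn' hn hs d with h | ⟨-, h, -⟩
    · exact not_le.2 (h.trans (hlt i hi d hj (zero_le.trans_lt hd))) (hle _ hj)
    · exact h ⟨w, hd.trans_le le_add_self, hw⟩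
  refine comprehension ⟨inferInstance, ?_⟩
  refine Sig.congr (P := fun v : Fin 1 → M.Num => ∃ i, i ∈ (Y : Set M.Num) ∧
    2 * v 0 + 1 < 2 * i - D i ∧ ¬ Stage Θ i (v 0)) (by infer_instance) fun v => ⟨fun h => ?_, ?_⟩
  · obtain ⟨i, hi, hi'⟩ := hunb (2 * v 0 + 1)
    exact ⟨i, hi, hi', fun ⟨w, _, hw⟩ => h ⟨w, hw⟩⟩
  · rintro ⟨i, hi, hi', hs⟩
    exact hdec i hi _ hi' hs

/-- The extended Goodstein theorem entails `Σ⁰₁` comprehension. -/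
theorem ExtendedGoodstein.sig_comprehension (hM : M.ExtendedGoodstein) {P : M.Num → Prop}
    (hP : Sig M (fun v : Fin 1 → M.Num => P (v 0))) : {n | P n} ∈ M.sets := by
  obtain ⟨Q, hQ, h⟩ := hP.out
  have : Dl₂ (fun n w => Q (ext (fun _ : Fin 1 => n) w)) :=
    ⟨(hQ.substExt (fun _ => .var 0) (.var 1)).sig,
      (hQ.not.substExt (fun _ => .var 0) (.var 1)).sig⟩
  have hB : Rec₁ (M := M) (fun i => 2 * i + 1) := ⟨inferInstance⟩
  -- At stage zero the stack is empty, and the starting value 1 = 2^0 is the marker alone.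
  obtain ⟨D, hD, hDlt, Y, hY, hdesc⟩ := hM.exists_descending (B := fun i => 2 * i + 1)
    (C := shift fun n w => Q (ext (fun _ : Fin 1 => n) w)) (m := 1)
    (fun i j hij => add_le_add_left (mul_le_mul_right hij 2) 1)
    (by rw [mul_zero, zero_add]; exact zero_lt_one) (fun i n hn => shift_lt _ hn)
    (shift_strictMono _) (by rw [mul_zero, zero_add, pow2_one]; exact one_lt_two)
    fun G hG h0 hstep i => (lt_of_lt_of_le (mul_pos (pow2_pos _)
      (zero_lt_one.trans_le le_add_self)) (missing_le_of_step h0 hstep i)).ne'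
  rw [show {n | P n} = {n | ∃ w, Q (ext (fun _ : Fin 1 => n) w)} from Set.ext fun n => h fun _ => n]
  exact exists_decision D hDlt Y hY hdesc

end Enumeration

end SecondOrderStructure

namespace SecondOrderStructure

/-! ## Arithmetical comprehension and `Σ⁰₁` comprehension -/

section ArithmeticalComprehension

variable {M : SecondOrderStructure.{u}} [RCA M]

theorem _root_.SecondOrderArithmetic.Formula.IsBounded.isArithmetical {φ : Formula}
    (h : φ.IsBounded) : φ.IsArithmetical := by
  induction h <;> simp_all [Formula.IsArithmetical]

theorem ArithmeticalComprehension.sig_comprehension (hM : M.ArithmeticalComprehension)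
    {P : M.Num → Prop} (hP : Sig M (fun v : Fin 1 → M.Num => P (v 0))) : {n | P n} ∈ M.sets := by
  obtain ⟨θ, e₀, E, hθ, h⟩ := hP.exists_formula
  obtain ⟨X, hX, hXφ⟩ := hM (.ex (2 * 1) θ) hθ.isArithmetical 0 e₀ E
  rwa [show {n | P n} = X from Set.ext fun a => by
    rw [hXφ, h _ fun k => by rw [Function.update_of_ne (by omega)]]
    simp]

/-- For one argument the class is a set, and membership in a set is Δ⁰₁. More arguments are reduced
to this case by pairing the last two. -/
theorem Sig.dl_of_comprehension
    (hM : ∀ P : M.Num → Prop, Sig M (fun v : Fin 1 → M.Num => P (v 0)) → {n | P n} ∈ M.sets)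
    {n : ℕ} {P : (Fin (n + 1) → M.Num) → Prop} (hP : Sig M P) : Dl M P := by
  induction n with
  | zero =>
    have h := hM (fun a => P fun _ => a) (hP.subst (fun _ v => v 0) fun _ => .var 0)
    refine (Dl.mem (f := fun v : Fin 1 → M.Num => v 0) ⟨_, h⟩).congr fun v => ?_
    exact iff_of_eq (congrArg P (funext fun i => by rw [Subsingleton.elim i 0]))
  | succ n ih =>
    have hP' : Sig M (fun w : Fin (n + 1 + 1 + 1) → M.Num =>
        P (ext (ext (fun i : Fin n => w i.castSucc.castSucc.castSucc)
          (w (Fin.last (n + 1)).castSucc)) (w (Fin.last (n + 2))))) :=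
      hP.subst (fun i w => ext (ext (fun i : Fin n => w i.castSucc.castSucc.castSucc)
        (w (Fin.last (n + 1)).castSucc)) (w (Fin.last (n + 2))) i)
        (poly_ext (poly_ext (fun i => .var _) (.var _)) (.var _))
    have h : Sig M (fun w : Fin (n + 1) → M.Num => ∃ a b, w (Fin.last n) = M.pair a b ∧
        P (ext (ext (fun i : Fin n => w i.castSucc) a) b)) := by
      infer_instance
    refine ((ih h).comp (fun i v => ext (fun i : Fin n => v i.castSucc.castSucc)
      (M.pair (v (Fin.last n).castSucc) (v (Fin.last (n + 1)))) i) fun i => ?_).congr fun v => ?_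
    · refine Fin.lastCases ?_ (fun j => ?_) i
      · simp only [ext, Fin.snoc_last]
        infer_instance
      · simp only [ext, Fin.snoc_castSucc]
        infer_instance
    · simp only [ext, Fin.snoc_last, Fin.snoc_castSucc]
      have hv : v = ext (ext (fun i : Fin n => v i.castSucc.castSucc) (v (Fin.last n).castSucc))
          (v (Fin.last (n + 1))) := by
        funext i
        refine Fin.lastCases (by simp [ext]) (fun j => ?_) i
        exact Fin.lastCases (by simp [ext]) (fun k => by simp [ext]) j
      constructor
      · intro h
        rw [hv] at h
        exact ⟨_, _, rfl, h⟩
      · rintro ⟨a, b, hab, h⟩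
        obtain ⟨rfl, rfl⟩ := pair_inj.1 hab
        rw [hv]
        exact h

theorem poly_value {n : ℕ} {w : ℕ → (Fin n → M.Num) → M.Num} (hw : ∀ k, Poly M (w k)) (t : Term) :
    Poly M (fun v => M.value (fun k => w k v) t) := by
  induction t with
  | var x => exact hw x
  | zero => exact .const 0
  | one => exact .const 1
  | add s t hs ht => exact .add hs ht
  | mul s t hs ht => exact .mul hs ht

/-- Induction on the formula. The assignment is given by polynomial functions of a tuple, and a
quantifier adds one entry to the tuple. The resulting Σ⁰₁ predicate is Δ⁰₁ again by comprehension,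
so the quantifier complexity never grows. -/
theorem dl_sat
    (hM : ∀ P : M.Num → Prop, Sig M (fun v : Fin 1 → M.Num => P (v 0)) → {n | P n} ∈ M.sets)
    (E : ℕ → M.sets) {φ : Formula} (hφ : φ.IsArithmetical) {n : ℕ}
    {w : ℕ → (Fin (n + 1) → M.Num) → M.Num} (hw : ∀ k, Poly M (w k)) :
    Dl M (fun v => M.Sat (fun k => w k v) E φ) := by
  have hex : ∀ (x : ℕ) (n : ℕ) (w : ℕ → (Fin (n + 1) → M.Num) → M.Num) (φ : Formula),
      Dl M (fun v : Fin (n + 1 + 1) → M.Num => M.Sat (fun k => if k = x then v (Fin.last (n + 1))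
        else w k fun i => v i.castSucc) E φ) →
      Dl M (fun v => ∃ a, M.Sat (Function.update (fun k => w k v) x a) E φ) := by
    intro x n w φ h
    refine (h.sig.exSnoc.dl_of_comprehension hM).congr fun v => exists_congr fun a => ?_
    refine iff_of_eq (congrArg (fun e => M.Sat e E φ) (funext fun k => ?_))
    by_cases hk : k = x <;> simp [hk, ext]
  have hpoly : ∀ (x : ℕ) {n : ℕ} {w : ℕ → (Fin (n + 1) → M.Num) → M.Num}, (∀ k, Poly M (w k)) →
      ∀ k, Poly M (fun v : Fin (n + 1 + 1) → M.Num => if k = x then v (Fin.last (n + 1))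
        else w k fun i => v i.castSucc) := by
    intro x n w hw k
    by_cases hk : k = x
    · simpa only [hk, if_true] using Poly.var _
    · simpa only [hk, if_false] using (hw k).weaken
  induction φ generalizing n with
  | eq s t =>
    have := (poly_value hw s).toRec
    have := (poly_value hw t).toRec
    exact Dl.eq
  | lt s t =>
    have := (poly_value hw s).toRec
    have := (poly_value hw t).toRec
    exact Dl.lt
  | mem t X =>
    have := (poly_value hw t).toRec
    exact Dl.mem _
  | not φ h =>
    have := h hφ hw
    exact Dl.not
  | and φ ψ h h' =>
    have := h hφ.1 hw
    have := h' hφ.2 hw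
    exact Dl.and
  | or φ ψ h h' =>
    have := h hφ.1 hw
    have := h' hφ.2 hw
    exact Dl.or
  | imp φ ψ h h' =>
    have := h hφ.1 hw
    have := h' hφ.2 hw
    exact Dl.imp
  | all x φ h =>
    have h' := h hφ (hpoly x hw)
    have := hex x n w (.not φ) Dl.not
    refine (Dl.not (P := fun v => ∃ a, M.Sat (Function.update (fun k => w k v) x a) E
      (.not φ))).congr fun v => ?_
    simp only [Sat, not_exists, not_not]
  | ex x φ h => exact hex x n w φ (h hφ (hpoly x hw))
  | allSet X φ h => exact hφ.elim
  | exSet X φ h => exact hφ.elim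

theorem ArithmeticalComprehension.of_sig_comprehension
    (hM : ∀ P : M.Num → Prop, Sig M (fun v : Fin 1 → M.Num => P (v 0)) → {n | P n} ∈ M.sets) :
    M.ArithmeticalComprehension := by
  intro φ hφ x e E
  refine ⟨{a | M.Sat (Function.update e x a) E φ}, comprehension ?_, fun n => Iff.rfl⟩
  refine (dl_sat hM E hφ (w := fun k v => if k = x then v 0 else e k) fun k => ?_).congr fun v => ?_
  · by_cases hk : k = x
    · simpa only [hk, if_true] using Poly.var _
    · simpa only [hk, if_false] using Poly.const _
  · refine iff_of_eq (congrArg (fun e => M.Sat e E φ) (funext fun k => ?_))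
    by_cases hk : k = x <;> simp [hk]

end ArithmeticalComprehension

end SecondOrderStructure

/-- Over `RCA₀`, arithmetical comprehension is equivalent to the extended Goodstein theorem for the
binary representation: the two have the same truth value in every model of `RCA₀` (including
models with non-standard numbers). -/
theorem theorem2 (M : SecondOrderStructure.{u}) (hM : M.ModelsRCA) :
    M.ArithmeticalComprehension ↔ M.ExtendedGoodstein := by
  have : SecondOrderStructure.RCA M := ⟨hM⟩
  exact ⟨fun h => .of_comprehension fun _ hP => h.sig_comprehension hP,
    fun h => .of_sig_comprehension fun _ hP => h.sig_comprehension hP⟩
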